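/- **Setting.** Let $E$ be an elliptic curve over a finite field $F$ and let $P\in E(F)$ have prime order $q$. Let $t\ge 1$, $k\ge 0$ be integers. Let $\mathcal I$ (identities) and $\mathcal M$ (messages) be sets, and let $H_1:\mathcal I\times E(F)\to\{1,\dots,t\}^k$ and $H_5:\mathcal M\times E(F)\to\mathbb Z_q$ be independent random oracles. *Certificateless scheme.* The master secret key is a uniform $(v_1,\dots,v_t)\in\mathbb Z_q^t$; the master public key is $(V_i)_i=(v_iP)_i$. A user $ID$ has a uniform secret value $\alpha\in\mathbb Z_q$ with $U=\alpha P$. The key centre draws a uniform $\beta\in\mathbb Z_q$, sets $Q=U+\beta P$, $(j_1,\dots,j_k)=H_1(ID,Q)$, and issues the partial private key $w=\sum_i v_{j_i}+\beta$. If $Q-U=wP-\sum_iV_{j_i}$, the private key is $x=w+\alpha$; otherwise it is $\perp$. To sign $m$, draw a uniform $r\in\mathbb Z_q$ and output $(s,e)$ with $e=H_5(m,rP)$, $s=r-ex$. A signature $(s,e)$ is valid for $(m,ID,Q)$ if $e=H_5\bigl(m,\,sP+e(\sum_iV_{j_i}+Q)\bigr)$, where $(j_1,\dots,j_k)=H_1(ID,Q)$.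 *Identity-based scheme.* The same setup, signing and verification, but the centre draws a uniform $\beta$, sets $Q=\beta P$, $(j_1,\dots,j_k)=H_1(ID,Q)$ and issues the private key $x=\sum_iv_{j_i}+\beta$. There is no user secret value: formally $\alpha=0$, $U=0$, $w=x$. *EU-CMA experiment (Type-I).* The adversary gets $(V_1,\dots,V_t)$ and may adaptively query $H_1$, $H_5$, $\mathsf{PubKey}(ID)=(U,Q)$, $\mathsf{PartKey}(ID)=(w,Q)$, $\mathsf{SecKey}(ID)=\alpha$, $\mathsf{Corrupt}(ID)=x$ and $\mathsf{Sign}(ID,m)$. The keys of each identity are generated once, honestly, when it first occurs. The adversary outputs $(ID^*,m^*,\sigma^*)$ and wins if $\sigma^*$ is valid for $(m^*,ID^*,Q_{ID^*})$, $ID^*$ was submitted neither to $\mathsf{Corrupt}$ nor to $\mathsf{PartKey}$, and $(ID^*,m^*)$ was not submitted to $\mathsf{Sign}$. Its advantage $\varepsilon$ is its probability of winning. *Algorithms with the adversary as a subroutine.* Such an algorithm is a finite program, given as a decision tree, over registers that hold scalars, points, identities, messages, and suspended runs of the adversary. Its instructions are: drawing a uniform scalar, loading a constant scalar, $+,-,\cdot,/$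 on scalars, addition of points and multiplication of a point by a scalar, equality tests, uniform choice among $n$ continuations, starting the adversary on a fresh random tape, branching on the kind of message that a suspended run has sent and copying its content, and resuming a suspended run with an answer (a suspended run may be resumed more than once). Each instruction costs $1$, except that a choice among $n$ continuations costs $n$ and that starting or answering the adversary costs $t+1$ or $k+1$ respectively; in addition, the time spent by the adversary in the runs is charged. **Statement.** There is an absolute constant $c$ such that the following holds for all primes $q$, all $t\ge 1$ and $k\ge 0$, each of the two schemes, and all query bounds $q_{H_1},q_{H_5},q_{\mathsf{Pub}},q_{\mathsf{Part}},q_{\mathsf{Sec}},q_{\mathsf{Cor}},q_{\mathsf{S}}\ge 0$. There is one such algorithm $\mathcal C$ (depending only on these data) such that for all $F,E,P,\mathcal I,\mathcal M$ as above, with $P$ of order $q$, and for every Type-I adversary $\mathcal A$ that respects the query bounds and has running time at most $T$, the algorithm $\mathcal C$, running $\mathcal A$ as a subroutine on input $(P,aP)$, always takes time at most $$2T+c\,(t+k+q_{H_1}+q_{H_5}+q_{\mathsf{Pub}}+q_{\mathsf{Part}}+q_{\mathsf{Sec}}+q_{\mathsf{Cor}}+q_{\mathsf S}+1)^3,$$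 and for uniformly random $a\in\mathbb Z_q$ it outputs $a$ with probability at least $$\mathrm{acc}\left(\frac{\mathrm{acc}}{q_{H_5}+q_{\mathsf S}+1}-\frac1q\right),\qquad \mathrm{acc}=\max\left(0,\ \frac{\varepsilon}{q_{\mathsf{Pub}}+q_{\mathsf{Part}}+q_{\mathsf{Sec}}+q_{\mathsf{Cor}}+q_{\mathsf S}+1}-\frac{q_{\mathsf S}(q_{H_5}+q_{\mathsf S})}{q}\right),$$ where $\varepsilon$ is the EU-CMA advantage of $\mathcal A$ against the scheme. -/

import Mathlib

namespace SchnorrCL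

noncomputable section

/-! ## The schemes, with their two hash functions as lazily sampled random oracles

`G` is the (additively written) group of points, `P : G` the base point of prime order `q`, `ID` the
set of identities, `M` the set of messages. A master key has `t` entries and `k` of them are
selected by the first hash function. -/

/-- Multiplication of a point by a scalar in `ℤ/q`. -/
def smulPt {q : ℕ} {G : Type} [AddCommGroup G] (c : ZMod q) (X : G) : G := c.val • X

/-- A registered user: secret value `α` with commitment `U`, partial private key `w` with
commitment `Q`, and private key `x` (`none` stands for `⊥`). -/
structure User (q : ℕ) (G : Type) where
  α : ZMod q
  U : G
  w : ZMod q
  Q : G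
  x : Option (ZMod q)

/-- State of the experiment: the tables of the random oracles
`H₁ : ID × G → {1,…,t}ᵏ` and `H₅ : M × G → ℤ/q`, the registered users, and the identities
submitted to the oracles `Corrupt`, `PartKey` and the pairs submitted to `Sign`. -/
structure GameState (q t k : ℕ) (ID M G : Type) where
  tableH1 : ID → G → Option (Fin k → Fin t)
  tableH5 : M → G → Option (ZMod q)
  users : ID → Option (User q G)
  corrupted : List ID
  partKeyed : List ID
  signed : List (ID × M)

def GameState.init (q t k : ℕ) (ID M G : Type) : GameState q t k ID M G where
  tableH1 := fun _ _ => none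
  tableH5 := fun _ _ => none
  users := fun _ => none
  corrupted := []
  partKeyed := []
  signed := []

/-- Randomized computations that may use the oracles of the experiment. -/
abbrev Game (q t k : ℕ) (ID M G : Type) : Type → Type := StateT (GameState q t k ID M G) PMF

section Scheme

variable {q t k : ℕ} [Fact q.Prime] [NeZero t] {ID M G : Type} [DecidableEq ID] [DecidableEq M]
  [AddCommGroup G] [DecidableEq G]

/-- Uniform sampling from a finite set. -/
def sample (S : Type) [Fintype S] [Nonempty S] : Game q t k ID M G S :=
  StateT.lift (PMF.uniformOfFintype S)

/-- The random oracle `H₁`: a fresh query is answered by a uniform element, which is recorded. -/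
def hash1 (id : ID) (Q : G) : Game q t k ID M G (Fin k → Fin t) := do
  let st ← get
  match st.tableH1 id Q with
  | some j => pure j
  | none =>
    let j ← sample (Fin k → Fin t)
    set { st with
      tableH1 := Function.update st.tableH1 id (Function.update (st.tableH1 id) Q (some j)) }
    pure j

/-- The random oracle `H₅`. -/
def hash5 (m : M) (R : G) : Game q t k ID M G (ZMod q) := do
  let st ← get
  match st.tableH5 m R with
  | some e => pure e
  | none =>
    let e ← sample (ZMod q)
    set { st with
      tableH5 := Function.update st.tableH5 m (Function.update (st.tableH5 m) R (some e)) }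
    pure e

/-- `KGCSetup`: the master secret key. -/
def kgcSetup : Game q t k ID M G (Fin t → ZMod q) := sample (Fin t → ZMod q)

/-- The master public key `V₁, …, V_t` that belongs to the master secret key `v`. -/
def masterPublicKey (P : G) (v : Fin t → ZMod q) : Fin t → G := fun i => smulPt (v i) P

/-- `UserSetup`. -/
def userSetup (P : G) : Game q t k ID M G (ZMod q × G) := do
  let α ← sample (ZMod q)
  pure (α, smulPt α P)

/-- `PartKeyGen`. -/
def partKeyGen (P : G) (v : Fin t → ZMod q) (id : ID) (U : G) :
    Game q t k ID M G (ZMod q × G) := do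
  let β ← sample (ZMod q)
  let W := smulPt β P
  let Q := U + W
  let j ← hash1 id Q
  let y := ∑ i, v (j i)
  pure (y + β, Q)

/-- `UserKeyGen`: checks the partial private key against the master public key `V`. -/
def userKeyGen (P : G) (V : Fin t → G) (id : ID) (α : ZMod q) (U : G) (w : ZMod q) (Q : G) :
    Game q t k ID M G (Option (ZMod q)) := do
  let j ← hash1 id Q
  let Y := ∑ i, V (j i)
  if Q - U = smulPt w P - Y then pure (some (w + α)) else pure none

/-- `Extract` of the identity-based scheme. -/
def extract (P : G) (v : Fin t → ZMod q) (id : ID) : Game q t k ID M G (ZMod q × G) := do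
  let β ← sample (ZMod q)
  let Q := smulPt β P
  let j ← hash1 id Q
  let y := ∑ i, v (j i)
  pure (y + β, Q)

/-- `Sign`, the same algorithm in both schemes. -/
def sign (P : G) (m : M) (x : ZMod q) : Game q t k ID M G (ZMod q × ZMod q) := do
  let r ← sample (ZMod q)
  let e ← hash5 m (smulPt r P)
  pure (r - e * x, e)

/-- `Verify`, the same algorithm in both schemes, for the signature `σ = (s, e)`. -/
def verify (P : G) (V : Fin t → G) (m : M) (id : ID) (Q : G) (σ : ZMod q × ZMod q) :
    Game q t k ID M G Bool := do
  let j ← hash1 id Q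
  let Y := ∑ i, V (j i)
  let e ← hash5 m (smulPt σ.1 P + smulPt σ.2 (Y + Q))
  pure (decide (σ.2 = e))

end Scheme

/-- The two signature schemes. -/
inductive Scheme where
  | certificateless
  | identityBased

/-- Generation of all keys of one user. In the identity-based scheme a user has no secret value
of her own, and `Extract` delivers her private key together with `Q`. -/
def userKeys {q t k : ℕ} [Fact q.Prime] [NeZero t] {ID M G : Type} [DecidableEq ID]
    [AddCommGroup G] [DecidableEq G] (P : G) (v : Fin t → ZMod q) (id : ID) :
    Scheme → Game q t k ID M G (User q G)
  | .certificateless => do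
    let (α, U) ← userSetup P
    let (w, Q) ← partKeyGen P v id U
    let x ← userKeyGen P (masterPublicKey P v) id α U w Q
    pure ⟨α, U, w, Q, x⟩
  | .identityBased => do
    let (x, Q) ← extract P v id
    pure ⟨0, 0, x, Q, some x⟩

/-! ## Adversaries -/

/-- The oracles of a Type-I adversary. -/
inductive OracleKind where
  | h1 | h5 | pubKey | partKey | secKey | corrupt | sign
deriving DecidableEq

inductive Query (ID M G : Type) where
  | h1 (id : ID) (Q : G)
  | h5 (m : M) (R : G)
  | pubKey (id : ID)
  | partKey (id : ID)
  | secKey (id : ID)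
  | corrupt (id : ID)
  | sign (id : ID) (m : M)

def Query.kind {ID M G : Type} : Query ID M G → OracleKind
  | .h1 _ _ => .h1
  | .h5 _ _ => .h5
  | .pubKey _ => .pubKey
  | .partKey _ => .partKey
  | .secKey _ => .secKey
  | .corrupt _ => .corrupt
  | .sign _ _ => .sign

/-- The type of the answer to a query: the public key is `(U, Q)`, the partial private key comes as
`(w, Q)`, the secret key is `α`, the private key is `x`. -/
def Query.Answer (q t k : ℕ) {ID M G : Type} : Query ID M G → Type
  | .h1 _ _ => Fin k → Fin t
  | .h5 _ _ => ZMod q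
  | .pubKey _ => G × G
  | .partKey _ => ZMod q × G
  | .secKey _ => ZMod q
  | .corrupt _ => Option (ZMod q)
  | .sign _ _ => Option (ZMod q × ZMod q)

/-- An adversary after its coins and its input are fixed: it either stops with a claimed forgery
or asks a query and continues in a way that depends on the answer. The number `work` is the
running time that it spends to produce this message from the previous answer. -/
inductive Strategy (q t k : ℕ) (ID M G : Type) where
  | forge (work : ℕ) (id : ID) (m : M) (σ : ZMod q × ZMod q)
  | ask (work : ℕ) (c : Query ID M G) (next : c.Answer q t k → Strategy q t k ID M G)

namespace Strategy

variable {q t k : ℕ} {ID M G : Type}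

def work : Strategy q t k ID M G → ℕ
  | .forge w _ _ _ => w
  | .ask w _ _ => w

/-- The total running time is at most the given number, whatever the answers are. -/
def RunsIn : Strategy q t k ID M G → ℕ → Prop
  | .forge w _ _ _, T => w ≤ T
  | .ask w _ next, T => ∃ T', w + T' ≤ T ∧ ∀ r, (next r).RunsIn T'

/-- At most `B o` queries go to each oracle `o`, whatever the answers are. -/
def QueriesWithin : Strategy q t k ID M G → (OracleKind → ℕ) → Prop
  | .forge _ _ _ _, _ => True
  | .ask _ c next, B =>
    0 < B c.kind ∧ ∀ r, (next r).QueriesWithin (Function.update B c.kind (B c.kind - 1))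

end Strategy

/-- A Type-I adversary: it draws a random tape and is given the master public key. -/
structure Adversary (q t k : ℕ) (ID M G : Type) where
  Tape : Type
  tape : PMF Tape
  strategy : Tape → (Fin t → G) → Strategy q t k ID M G

def Adversary.RunsIn {q t k : ℕ} {ID M G : Type} (A : Adversary q t k ID M G) (T : ℕ) : Prop :=
  ∀ ω V, (A.strategy ω V).RunsIn T

def Adversary.QueriesWithin {q t k : ℕ} {ID M G : Type} (A : Adversary q t k ID M G)
    (B : OracleKind → ℕ) : Prop :=
  ∀ ω V, (A.strategy ω V).QueriesWithin B

/-! ## The experiment -/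

section Experiment

variable {q t k : ℕ} [Fact q.Prime] [NeZero t] {ID M G : Type} [DecidableEq ID] [DecidableEq M]
  [AddCommGroup G] [DecidableEq G]

/-- The keys of `id`, which are generated when `id` is used for the first time. -/
def user (S : Scheme) (P : G) (v : Fin t → ZMod q) (id : ID) : Game q t k ID M G (User q G) := do
  let st ← get
  match st.users id with
  | some u => pure u
  | none =>
    let u ← userKeys P v id S
    modify fun st' => { st' with users := Function.update st'.users id (some u) }
    pure u

/-- The oracles of the adversary. -/
def oracle (S : Scheme) (P : G) (v : Fin t → ZMod q) :
    (c : Query ID M G) → Game q t k ID M G (c.Answer q t k)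
  | .h1 id Q => hash1 id Q
  | .h5 m R => hash5 m R
  | .pubKey id => do
    let u ← user S P v id
    pure (u.U, u.Q)
  | .partKey id => do
    let u ← user S P v id
    modify fun st => { st with partKeyed := id :: st.partKeyed }
    pure (u.w, u.Q)
  | .secKey id => do
    let u ← user S P v id
    pure u.α
  | .corrupt id => do
    let u ← user S P v id
    modify fun st => { st with corrupted := id :: st.corrupted }
    pure u.x
  | .sign id m => do
    let u ← user S P v id
    modify fun st => { st with signed := (id, m) :: st.signed }
    match u.x with
    | some x => do
      let σ ← sign P m x
      pure (some σ)
    | none => pure none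

/-- Run an adversary with its oracles until it outputs a claimed forgery. -/
def play (S : Scheme) (P : G) (v : Fin t → ZMod q) :
    Strategy q t k ID M G → Game q t k ID M G (ID × M × (ZMod q × ZMod q))
  | .forge _ id m σ => pure (id, m, σ)
  | .ask _ c next => do
    let r ← oracle S P v c
    play S P v (next r)

/-- The experiment for existential unforgeability under chosen message attack, for a Type-I
adversary: the signature verifies under the public key of `ID*`, the identity `ID*` was submitted
neither to `Corrupt` nor to `PartKey`, and no signature of `ID*` on `m*` was requested. -/
def euCMA (S : Scheme) (P : G) (A : Adversary q t k ID M G) : Game q t k ID M G Bool := do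
  let v ← kgcSetup
  let V := masterPublicKey P v
  let ω ← StateT.lift A.tape
  let (id, m, σ) ← play S P v (A.strategy ω V)
  let u ← user S P v id
  let valid ← verify P V m id u.Q σ
  let st ← get
  pure (valid && decide (id ∉ st.corrupted) && decide (id ∉ st.partKeyed)
    && decide ((id, m) ∉ st.signed))

/-- The probability that the adversary wins the experiment. -/
def advantage (S : Scheme) (P : G) (A : Adversary q t k ID M G) : ℝ :=
  (((euCMA S P A).run' (GameState.init q t k ID M G)) true).toReal

end Experiment

/-! ## Algorithms that run an adversary as a subroutine

The algorithms are programs for a machine with five sorts of registers: scalars in `ℤ/q`, points,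
identities, messages, and suspended runs of the adversary. A program sees none of the contents of
the registers: it computes with them by the listed instructions only, and its control flow depends
on them only through tests for equality and through the kind of the query that a suspended run is
waiting for. Every result goes into a fresh register (the registers of each sort are numbered
`0, 1, 2, …` in the order in which they are filled). A suspended run stays available after it has
been resumed, so it can be resumed again with another answer ("rewinding"). -/

inductive ScalarOp where
  | add | sub | mul | div

def ScalarOp.eval {q : ℕ} : ScalarOp → ZMod q → ZMod q → ZMod q
  | .add, a, b => a + b
  | .sub, a, b => a - b
  | .mul, a, b => a * b
  | .div, a, b => a * b⁻¹

/-- An answer to a query of the adversary, in terms of the numbers of the registers that hold it. -/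
inductive Reply (t k : ℕ) where
  | h1 (j : Fin k → Fin t)
  | h5 (e : ℕ)
  | pubKey (U Q : ℕ)
  | partKey (w Q : ℕ)
  | secKey (α : ℕ)
  | corrupt (x : ℕ)
  | sign (s e : ℕ)

/-- Programs. They do not mention the group, the identities, the messages or the adversary. -/
inductive Prog (q t k : ℕ) where
  /-- Stop without a result. -/
  | fail
  /-- Stop with the content of scalar register `i` as the result. -/
  | output (i : ℕ)
  /-- Draw a uniform scalar. -/
  | random (next : Prog q t k)
  | const (c : ZMod q) (next : Prog q t k)
  | scalarOp (o : ScalarOp) (i j : ℕ) (next : Prog q t k)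
  /-- Add the points in registers `i` and `j`. -/
  | addPt (i j : ℕ) (next : Prog q t k)
  /-- Multiply the point in register `j` by the scalar in register `i`. -/
  | mulPt (i j : ℕ) (next : Prog q t k)
  /-- Compare the contents of two scalar registers. -/
  | eqScalar (i j : ℕ) (yes no : Prog q t k)
  | eqPt (i j : ℕ) (yes no : Prog q t k)
  | eqID (i j : ℕ) (yes no : Prog q t k)
  | eqMsg (i j : ℕ) (yes no : Prog q t k)
  /-- Continue with one of `n + 1` programs, chosen uniformly at random. -/
  | branch (n : ℕ) (next : Fin (n + 1) → Prog q t k)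
  /-- Start a run of the adversary on a fresh random tape, with the points in the registers `V i` as
  master public key, until its first message. -/
  | start (V : Fin t → ℕ) (next : Prog q t k)
  /-- Look at the message of the suspended run in register `i`: its content is copied to registers,
  and the program branches on the kind of the query (`none` for a claimed forgery). -/
  | inspect (i : ℕ) (next : Option OracleKind → Prog q t k)
  /-- Resume the suspended run in register `i` with an answer, until its next message. -/
  | reply (i : ℕ) (r : Reply t k) (next : Prog q t k)

/-- Contents of the registers, and the time spent so far. -/
structure Machine (q t k : ℕ) (ID M G : Type) where
  scalars : List (ZMod q)
  points : List G
  ids : List ID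
  msgs : List M
  runs : List (Strategy q t k ID M G)
  clock : ℕ

namespace Machine

variable {q t k : ℕ} {ID M G : Type}

def tick (s : Machine q t k ID M G) (n : ℕ) : Machine q t k ID M G :=
  { s with clock := s.clock + n }

def pushScalar (s : Machine q t k ID M G) (x : ZMod q) : Machine q t k ID M G :=
  { s with scalars := s.scalars ++ [x] }

def pushPt (s : Machine q t k ID M G) (X : G) : Machine q t k ID M G :=
  { s with points := s.points ++ [X] }

def pushID (s : Machine q t k ID M G) (id : ID) : Machine q t k ID M G :=
  { s with ids := s.ids ++ [id] }

def pushMsg (s : Machine q t k ID M G) (m : M) : Machine q t k ID M G :=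
  { s with msgs := s.msgs ++ [m] }

/-- Store a suspended run; the time that the adversary spent on its last message is charged. -/
def pushRun (s : Machine q t k ID M G) (a : Strategy q t k ID M G) : Machine q t k ID M G :=
  { s with runs := s.runs ++ [a], clock := s.clock + a.work }

/-- Scalar registers that were not filled hold `0`. -/
def scalar (s : Machine q t k ID M G) (i : ℕ) : ZMod q := s.scalars.getD i 0

/-- Point registers that were not filled hold the point at infinity. -/
def point [AddCommGroup G] (s : Machine q t k ID M G) (i : ℕ) : G := s.points.getD i 0

def pushQuery (s : Machine q t k ID M G) : Query ID M G → Machine q t k ID M G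
  | .h1 id Q => (s.pushID id).pushPt Q
  | .h5 m R => (s.pushMsg m).pushPt R
  | .pubKey id => s.pushID id
  | .partKey id => s.pushID id
  | .secKey id => s.pushID id
  | .corrupt id => s.pushID id
  | .sign id m => (s.pushID id).pushMsg m

/-- The content of an answer; `none` if it does not fit the query. -/
def answer [AddCommGroup G] (s : Machine q t k ID M G) :
    (c : Query ID M G) → Reply t k → Option (c.Answer q t k)
  | .h1 _ _, .h1 j => some j
  | .h5 _ _, .h5 e => some (s.scalar e)
  | .pubKey _, .pubKey U Q => some (s.point U, s.point Q)
  | .partKey _, .partKey w Q => some (s.scalar w, s.point Q)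
  | .secKey _, .secKey α => some (s.scalar α)
  | .corrupt _, .corrupt x => some (some (s.scalar x))
  | .sign _ _, .sign e₁ e₂ => some (some (s.scalar e₁, s.scalar e₂))
  | _, _ => none

end Machine

section Execution

variable {q t k : ℕ} [Fact q.Prime] {ID M G : Type} [DecidableEq ID] [DecidableEq M]
  [AddCommGroup G] [DecidableEq G]

/-- Joint law of the result and of the running time of a program that is started on `s` and runs the
adversary `A`. Every instruction takes one unit of time, except that a choice among `n` programs
takes `n` units, that writing the input of length `t` or an answer of length `k` of the adversary
takes `t` or `k` additional units, and that the time that the adversary spends is charged as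
well. An instruction that refers to an empty register for identities, messages or runs stops
the program without a result, and so does an answer that does not fit the query. -/
def Prog.exec (A : Adversary q t k ID M G) :
    Prog q t k → Machine q t k ID M G → PMF (Option (ZMod q) × ℕ)
  | .fail, s => PMF.pure (none, s.clock)
  | .output i, s => PMF.pure (some (s.scalar i), s.clock + 1)
  | .random p, s =>
    (PMF.uniformOfFintype (ZMod q)).bind fun x => p.exec A ((s.tick 1).pushScalar x)
  | .const c p, s => p.exec A ((s.tick 1).pushScalar c)
  | .scalarOp o i j p, s => p.exec A ((s.tick 1).pushScalar (o.eval (s.scalar i) (s.scalar j)))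
  | .addPt i j p, s => p.exec A ((s.tick 1).pushPt (s.point i + s.point j))
  | .mulPt i j p, s => p.exec A ((s.tick 1).pushPt (smulPt (s.scalar i) (s.point j)))
  | .eqScalar i j yes no, s =>
    if s.scalar i = s.scalar j then yes.exec A (s.tick 1) else no.exec A (s.tick 1)
  | .eqPt i j yes no, s =>
    if s.point i = s.point j then yes.exec A (s.tick 1) else no.exec A (s.tick 1)
  | .eqID i j yes no, s =>
    match s.ids[i]?, s.ids[j]? with
    | some a, some b => if a = b then yes.exec A (s.tick 1) else no.exec A (s.tick 1)
    | _, _ => PMF.pure (none, s.clock)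
  | .eqMsg i j yes no, s =>
    match s.msgs[i]?, s.msgs[j]? with
    | some a, some b => if a = b then yes.exec A (s.tick 1) else no.exec A (s.tick 1)
    | _, _ => PMF.pure (none, s.clock)
  | .branch n next, s =>
    (PMF.uniformOfFintype (Fin (n + 1))).bind fun i => (next i).exec A (s.tick (n + 1))
  | .start V p, s =>
    A.tape.bind fun ω =>
      p.exec A ((s.tick (t + 1)).pushRun (A.strategy ω fun i => s.point (V i)))
  | .inspect i next, s =>
    match s.runs[i]? with
    | some (.forge _ id m σ) =>
      (next none).exec A
        (((((s.tick 1).pushID id).pushMsg m).pushScalar σ.1).pushScalar σ.2)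
    | some (.ask _ c _) => (next (some c.kind)).exec A ((s.tick 1).pushQuery c)
    | none => PMF.pure (none, s.clock)
  | .reply i r p, s =>
    match s.runs[i]? with
    | some (.ask _ c cont) =>
      match s.answer c r with
      | some a => p.exec A ((s.tick (k + 1)).pushRun (cont a))
      | none => PMF.pure (none, s.clock)
    | _ => PMF.pure (none, s.clock)

/-- Execution on the instance `(P, X)` of the elliptic curve discrete logarithm problem. -/
def Prog.run (C : Prog q t k) (A : Adversary q t k ID M G) (P X : G) :
    PMF (Option (ZMod q) × ℕ) :=
  C.exec A ⟨[], [P, X], [], [], [], 0⟩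

/-- The probability that a program solves a random instance `(P, aP)` of the elliptic curve discrete
logarithm problem. -/
def Prog.ecdlpSuccess (C : Prog q t k) (A : Adversary q t k ID M G) (P : G) : ℝ :=
  (((PMF.uniformOfFintype (ZMod q)).bind fun a =>
    (C.run A P (smulPt a P)).map fun o => decide (o.1 = some a)) true).toReal

end Execution

/-! ## The bounds -/

/-- The number of all queries that are allowed by `B`. -/
def totalQueries (B : OracleKind → ℕ) : ℕ :=
  B .h1 + B .h5 + B .pubKey + B .partKey + B .secKey + B .corrupt + B .sign

/-- The number of identities that can occur in queries other than hash queries, or in the forgery. -/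
def identityBound (B : OracleKind → ℕ) : ℕ :=
  B .pubKey + B .partKey + B .secKey + B .corrupt + B .sign + 1

/-- What is left of the advantage `ε` after the target has been guessed and signatures of the
target have been simulated. -/
def accept (q : ℕ) (B : OracleKind → ℕ) (ε : ℝ) : ℝ :=
  max 0 (ε / identityBound B - B .sign * (B .h5 + B .sign) / q)

/-- The success probability after forking. -/
def forkingBound (q : ℕ) (B : OracleKind → ℕ) (ε : ℝ) : ℝ :=
  accept q B ε * (accept q B ε / (B .h5 + B .sign + 1) - 1 / q)

end

end SchnorrCL

/-! The solver plays the key centre with a master key of its own and guesses, by number in the order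
of creation, the user that the forgery will concern. For this target it takes the challenge `aP` in
place of `βP`. The public key that governs verification is then `xP + aP`, where `x` (the selected
master scalars plus `α`) is known and the full private key is `x + a`. All other users are generated
honestly.

Signatures of the target are simulated by drawing `(s, e)` uniformly, computing the commitment that
they determine and entering `e` there in the table of `H₅`. For fixed `e` the map `r ↦ r - e(x + a)`
is a bijection, so this is the honest law unless the commitment already has an entry, which costs at
most (number of entries)/q for each signature. Stopping when a private or partial private key of the
target is requested loses nothing, because such a run cannot win with this target. A winning forgery
never rests on a simulated entry either: the message of such an entry was signed for the target.

So a winning forgery rests on a scalar that was drawn by an honest answer of `H₅`, a `hash` node.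
The solver resumes the adversary from this node with a fresh scalar. If the second run ends at the
same node with another scalar, two signatures share a commitment, and `s₁ + e₁(x₁ + a) = s₂ + e₂(x₂
+ a)` yields `a`; the known parts `x₁`, `x₂` may differ.

The forking bound is proved on abstract probability trees (`Tree.acc_sq_le_val`). For one index `i`,
Jensen's inequality above the node shows that two runs sharing the prefix both end at `i` with
probability at least `prob i ^ 2`, up to `prob i / q` for equal scalars; Cauchy–Schwarz over the `n`
indices gives `acc² ≤ n (success + acc / q)`.

The simulator is written once, as a `Run` with register numbers of its own, and has two meanings.
`Run.tree` turns it into a probability tree; `Run.compile` turns it into a program in which each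
`hash` node leaves a continuation that a later `done` can call. `Run.val_le_prob` compares the two,
and `goodSnap_rewind` says that the rewinding continuation is worth `Tree.refork`. The bookkeeping
of registers and tables takes place while the program is built, so it costs no running time.

On the side of the experiment, `win_le_sum` splits the winning probability over the possible
targets, `expect_winWith` moves the draw of the target's `β` to the beginning, and
`winWith_le_accept` bounds each summand by the acceptance of the simulator plus the error of the
signatures. The time follows from `Run.timeLE_compile`, applied to the first and to the second pass,
and `costLE_simRun`. -/

namespace SchnorrCL

open scoped ENNReal

set_option linter.unusedSectionVars false

noncomputable section

/-! ## Expectations of nonnegative functions -/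

/-- The expectation of a nonnegative function. -/
def expect {α : Type} (p : PMF α) (f : α → ℝ≥0∞) : ℝ≥0∞ := ∑' a, p a * f a

section Expect

variable {α β : Type}

theorem expect_mono {p : PMF α} {f g : α → ℝ≥0∞} (h : ∀ a, f a ≤ g a) :
    expect p f ≤ expect p g :=
  ENNReal.tsum_le_tsum fun a => mul_le_mul_right (h a) _

theorem expect_mono_support {p : PMF α} {f g : α → ℝ≥0∞} (h : ∀ a ∈ p.support, f a ≤ g a) :
    expect p f ≤ expect p g := by
  refine ENNReal.tsum_le_tsum fun a => ?_
  by_cases ha : p a = 0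
  · simp [ha]
  · exact mul_le_mul_right (h a ((p.mem_support_iff a).2 ha)) _

theorem expect_congr_support {p : PMF α} {f g : α → ℝ≥0∞} (h : ∀ a ∈ p.support, f a = g a) :
    expect p f = expect p g :=
  le_antisymm (expect_mono_support fun a ha => (h a ha).le)
    (expect_mono_support fun a ha => (h a ha).ge)

@[simp] theorem expect_const (p : PMF α) (c : ℝ≥0∞) : expect p (fun _ => c) = c := by
  simp [expect, ENNReal.tsum_mul_right]

@[simp] theorem expect_pure (a : α) (f : α → ℝ≥0∞) : expect (PMF.pure a) f = f a := by
  unfold expect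
  rw [tsum_eq_single a]
  · simp
  · intro b hb
    simp [hb]

theorem expect_add (p : PMF α) (f g : α → ℝ≥0∞) :
    expect p (fun a => f a + g a) = expect p f + expect p g := by
  simp [expect, mul_add, ENNReal.tsum_add]

theorem expect_const_mul (p : PMF α) (c : ℝ≥0∞) (f : α → ℝ≥0∞) :
    expect p (fun a => c * f a) = c * expect p f := by
  simp [expect, ← ENNReal.tsum_mul_left, mul_left_comm]

theorem expect_mul_const (p : PMF α) (c : ℝ≥0∞) (f : α → ℝ≥0∞) :
    expect p (fun a => f a * c) = expect p f * c := by
  simp [expect, ← ENNReal.tsum_mul_right, mul_assoc]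

theorem expect_div_const (p : PMF α) (c : ℝ≥0∞) (f : α → ℝ≥0∞) :
    expect p (fun a => f a / c) = expect p f / c := by
  simp only [div_eq_mul_inv, expect_mul_const]

theorem expect_comm (p : PMF α) (r : PMF β) (f : α → β → ℝ≥0∞) :
    expect p (fun a => expect r (f a)) = expect r fun b => expect p fun a => f a b := by
  simp only [expect, ← ENNReal.tsum_mul_left]
  rw [ENNReal.tsum_comm]
  simp only [mul_left_comm]

theorem expect_sum {ι : Type*} (s : Finset ι) (p : PMF α) (f : ι → α → ℝ≥0∞) :
    expect p (fun a => ∑ i ∈ s, f i a) = ∑ i ∈ s, expect p (f i) := by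
  classical
  induction s using Finset.induction_on with
  | empty => simp
  | insert i s hi ih => simp [Finset.sum_insert hi, expect_add, ih]

theorem expect_bind (p : PMF α) (r : α → PMF β) (f : β → ℝ≥0∞) :
    expect (p.bind r) f = expect p fun a => expect (r a) f := by
  simp only [expect, PMF.bind_apply, ← ENNReal.tsum_mul_left, ← ENNReal.tsum_mul_right]
  rw [ENNReal.tsum_comm]
  simp only [mul_assoc]

theorem expect_map (p : PMF α) (r : α → β) (f : β → ℝ≥0∞) :
    expect (p.map r) f = expect p fun a => f (r a) := by
  simp [PMF.map, expect_bind]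

theorem expect_le_one {p : PMF α} {f : α → ℝ≥0∞} (h : ∀ a, f a ≤ 1) : expect p f ≤ 1 :=
  (expect_mono h).trans (by simp)

theorem expect_single [DecidableEq α] (p : PMF α) (a : α) :
    expect p (fun b => if b = a then 1 else 0) = p a := by
  unfold expect
  rw [tsum_eq_single a]
  · simp
  · intro b hb
    simp [hb]

theorem two_mul_mul_le_sq_add_sq (x y : ℝ≥0∞) : x * y + x * y ≤ x ^ 2 + y ^ 2 := by
  rcases eq_or_ne x ⊤ with rfl | hx
  · simp
  rcases eq_or_ne y ⊤ with rfl | hy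
  · simp
  lift x to NNReal using hx
  lift y to NNReal using hy
  norm_cast
  rw [← NNReal.coe_le_coe]
  push_cast
  nlinarith [sq_nonneg ((x : ℝ) - y)]

/-- Jensen's inequality for the square. -/
theorem expect_sq_le (p : PMF α) (f : α → ℝ≥0∞) :
    expect p f ^ 2 ≤ expect p fun a => f a ^ 2 := by
  have h1 : expect p f ^ 2 = expect p fun a => expect p fun b => f a * f b := by
    simp only [expect_const_mul, expect_mul_const, sq]
  -- The inequality is proved doubled, from `2xy ≤ x² + y²` for two independent copies: subtracting
  -- the mean is not available in `ℝ≥0∞`.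
  have h2 : expect p f ^ 2 + expect p f ^ 2 ≤
      (expect p fun a => f a ^ 2) + expect p fun a => f a ^ 2 := by
    rw [h1, ← expect_add]
    calc _ ≤ expect p fun a => (f a ^ 2 + expect p fun b => f b ^ 2) := by
          refine expect_mono fun a => ?_
          rw [← expect_add, ← expect_const p (f a ^ 2), ← expect_add]
          exact expect_mono fun b => by simpa using two_mul_mul_le_sq_add_sq (f a) (f b)
      _ = _ := by rw [expect_add, expect_const]
  rw [← two_mul, ← two_mul] at h2
  exact (ENNReal.mul_le_mul_iff_right (by simp) (by simp)).1 h2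

theorem expect_uniform [Fintype α] [Nonempty α] (f : α → ℝ≥0∞) :
    expect (PMF.uniformOfFintype α) f = (∑ a, f a) / Fintype.card α := by
  simp [expect, tsum_fintype, div_eq_mul_inv, Finset.sum_mul, mul_comm]

theorem expect_uniform_equiv [Fintype α] [Nonempty α] [Fintype β] [Nonempty β] (e : α ≃ β)
    (f : β → ℝ≥0∞) :
    (expect (PMF.uniformOfFintype α) fun a => f (e a)) = expect (PMF.uniformOfFintype β) f := by
  rw [expect_uniform, expect_uniform, e.sum_comp, Fintype.card_congr e]

theorem expect_uniform_prod [Fintype α] [Nonempty α] [Fintype β] [Nonempty β]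
    (f : α × β → ℝ≥0∞) :
    expect (PMF.uniformOfFintype (α × β)) f =
      expect (PMF.uniformOfFintype α) fun a => expect (PMF.uniformOfFintype β) fun b => f (a, b) := by
  simp only [expect_uniform, Fintype.sum_prod_type, Fintype.card_prod, div_eq_mul_inv,
    Finset.sum_mul, mul_assoc]
  refine Finset.sum_congr rfl fun a _ => Finset.sum_congr rfl fun b _ => ?_
  rw [Nat.cast_mul, ENNReal.mul_inv (by simp) (by simp), mul_comm (_⁻¹ : ℝ≥0∞)]

theorem expect_uniform_succ [Fintype α] [Nonempty α] (n : ℕ) (f : (Fin (n + 1) → α) → ℝ≥0∞) :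
    expect (PMF.uniformOfFintype (Fin (n + 1) → α)) f =
      expect (PMF.uniformOfFintype α) fun a =>
        expect (PMF.uniformOfFintype (Fin n → α)) fun v => f (Fin.cons a v) := by
  rw [← expect_uniform_equiv (Fin.consEquiv fun _ => α), expect_uniform_prod]
  rfl

theorem expect_uniform_le [Fintype α] [Nonempty α] [DecidableEq α] (s : Finset α) :
    (expect (PMF.uniformOfFintype α) fun a => if a ∈ s then 1 else 0) =
      s.card / Fintype.card α := by
  rw [expect_uniform]
  simp

end Expect

/-! ## Probability trees with forkable nodes -/

/-- Probabilistic processes that stop with an optional index. The `hash` nodes draw a uniform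
scalar and are numbered along each path. -/
inductive Tree (q : ℕ) : Type 1
  | leaf (i : Option ℕ)
  | coin (S : Type) (p : PMF S) (next : S → Tree q)
  | hash (next : ZMod q → Tree q)

namespace Tree

variable {q : ℕ} [Fact q.Prime]

/-- The expectation of a function of the outcome. -/
def leafE (f : Option ℕ → ℝ≥0∞) : Tree q → ℝ≥0∞
  | leaf i => f i
  | coin _ p next => expect p fun x => (next x).leafE f
  | hash next => expect (PMF.uniformOfFintype (ZMod q)) fun x => (next x).leafE f

/-- The probability of the outcome `some i`. -/
def prob (i : ℕ) (T : Tree q) : ℝ≥0∞ := T.leafE fun o => if o = some i then 1 else 0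

/-- The probability that the outcome is not `none`. -/
def acc (T : Tree q) : ℝ≥0∞ := T.leafE fun o => if o.isSome then 1 else 0

/-- The expectation of a value that is attached to the outcome `some i`: for `i < d` it is `h i`,
for the index `i` of a later `hash` node `w` determines it. -/
def val (w : (ZMod q → Tree q) → ℕ → ZMod q → ℝ≥0∞) :
    (ℕ → ℝ≥0∞) → ℕ → Tree q → ℝ≥0∞
  | h, _, leaf i => i.elim 0 h
  | h, d, coin _ p next => expect p fun x => (next x).val w h d
  | h, d, hash next =>
    expect (PMF.uniformOfFintype (ZMod q)) fun e =>
      (next e).val w (Function.update h d (w next d e)) (d + 1)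

/-- Below `d` `hash` nodes, the outcomes are numbers of `hash` nodes above, and less than `n`. -/
def Indexed (n : ℕ) : ℕ → Tree q → Prop
  | d, leaf i => ∀ j, i = some j → j < d ∧ j < n
  | d, coin _ _ next => ∀ x, (next x).Indexed n d
  | d, hash next => ∀ e, (next e).Indexed n (d + 1)

/-- The probability that a second run from a `hash` node with number `d` gets a scalar different
from `e` and has the outcome `some d`. -/
def refork (next : ZMod q → Tree q) (d : ℕ) (e : ZMod q) : ℝ≥0∞ :=
  expect (PMF.uniformOfFintype (ZMod q)) fun e' => if e' = e then 0 else (next e').prob d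

theorem leafE_mono {f g : Option ℕ → ℝ≥0∞} (h : ∀ o, f o ≤ g o) (T : Tree q) :
    T.leafE f ≤ T.leafE g := by
  induction T with
  | leaf i => exact h i
  | coin S p next ih => exact expect_mono ih
  | hash next ih => exact expect_mono ih

theorem prob_le_one (i : ℕ) (T : Tree q) : T.prob i ≤ 1 := by
  induction T with
  | leaf j => simp only [prob, leafE]; split_ifs <;> simp
  | coin S p next ih => exact expect_le_one ih
  | hash next ih => exact expect_le_one ih

/-- Every later `hash` node writes `0` where `h` already vanishes, so `h` never changes. This
evaluates the second run, in which only an outcome at the rewound node counts. -/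
theorem val_zero {h : ℕ → ℝ≥0∞} {d : ℕ} (hd : ∀ i, d ≤ i → h i = 0) (T : Tree q) :
    T.val (fun _ _ _ => 0) h d = T.leafE fun o => o.elim 0 h := by
  induction T generalizing d with
  | leaf i => rfl
  | coin S p next ih => simp only [val, leafE, ih _ hd]
  | hash next ih =>
    simp only [val, leafE]
    have : Function.update h d 0 = h := by
      rw [Function.update_eq_self_iff]
      exact (hd d le_rfl).symm
    simp only [this]
    congr 1
    funext e
    exact ih e fun i hi => hd i (by omega)

theorem acc_eq_sum {n d : ℕ} {T : Tree q} (hT : T.Indexed n d) :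
    T.acc = ∑ i ∈ Finset.range n, T.prob i := by
  induction T generalizing d with
  | leaf i =>
    cases i with
    | none => simp [acc, prob, leafE]
    | some j =>
      have := (hT j rfl).2
      simp [acc, prob, leafE, this]
  | coin S p next ih =>
    simp only [acc, prob, leafE] at ih ⊢
    rw [← expect_sum]
    exact congrArg _ (funext fun x => ih x (hT x))
  | hash next ih =>
    simp only [acc, prob, leafE] at ih ⊢
    rw [← expect_sum]
    exact congrArg _ (funext fun x => ih x (hT x))

/-- For every first scalar `e`, forbidding the second scalar to equal `e` costs at most `1/q`.
Weighting this with the success probability after `e` and averaging gives the square. -/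
theorem prob_sq_le_refork (next : ZMod q → Tree q) (d : ℕ) :
    (hash next).prob d ^ 2 ≤
      (expect (PMF.uniformOfFintype (ZMod q)) fun e => (next e).prob d * refork next d e) +
        (hash next).prob d / q := by
  have h0 : (hash next).prob d =
    expect (PMF.uniformOfFintype (ZMod q)) fun e => (next e).prob d := rfl
  set f := fun e => (next e).prob d with hf
  have h1 : ∀ e, f e * (hash next).prob d ≤ f e * refork next d e + f e / q := by
    intro e
    have : (hash next).prob d ≤ refork next d e + (q : ℝ≥0∞)⁻¹ := by
      have h2 : (expect (PMF.uniformOfFintype (ZMod q)) fun e' => if e' = e then 1 else 0) =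
          (q : ℝ≥0∞)⁻¹ := by
        rw [expect_single]
        simp [ZMod.card]
      rw [h0, ← h2, refork, ← expect_add]
      refine expect_mono fun e' => ?_
      split_ifs
      · simpa using prob_le_one d _
      · simp [hf]
    calc f e * (hash next).prob d ≤ f e * (refork next d e + (q : ℝ≥0∞)⁻¹) := by gcongr
      _ = _ := by rw [mul_add, div_eq_mul_inv]
  calc (hash next).prob d ^ 2
      = expect (PMF.uniformOfFintype (ZMod q)) fun e => f e * (hash next).prob d := by
        rw [expect_mul_const, sq, ← h0]
    _ ≤ _ := by
        refine (expect_mono h1).trans_eq ?_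
        rw [expect_add, expect_div_const, ← h0]

/-- The forking inequality. -/
theorem sum_prob_sq_le_val {n d : ℕ} {T : Tree q} (hT : T.Indexed n d) (h : ℕ → ℝ≥0∞) :
    (∑ i ∈ Finset.range d, T.prob i * h i) + ∑ i ∈ Finset.Ico d n, T.prob i ^ 2 ≤
      T.val refork h d + (∑ i ∈ Finset.Ico d n, T.prob i) / q := by
  -- The nodes already passed contribute linearly, with the coefficients `h i` fixed when they were
  -- passed; the nodes still to come contribute squares. Passing a `hash` node turns its square into
  -- a linear term with coefficient `refork`.
  induction T generalizing d h with
  | leaf i =>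
    have h2 : ∑ i_1 ∈ Finset.Ico d n, (leaf i : Tree q).prob i_1 ^ 2 = 0 := by
      refine Finset.sum_eq_zero fun j hj => ?_
      have : i ≠ some j := fun hi => by
        have := (hT j hi).1
        simp at hj
        omega
      simp [prob, leafE, this]
    rw [h2, add_zero]
    refine le_add_right ?_
    cases i with
    | none => simp [prob, leafE]
    | some j =>
      have := (hT j rfl).1
      simp [prob, leafE, val, this]
  | coin S p next ih =>
    have hp : ∀ i, (coin S p next).prob i = expect p fun x => (next x).prob i := fun _ => rfl
    simp only [hp, val]
    calc _ ≤ expect p fun x => (∑ i ∈ Finset.range d, (next x).prob i * h i) +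
          ∑ i ∈ Finset.Ico d n, (next x).prob i ^ 2 := by
          rw [expect_add, expect_sum, expect_sum]
          simp only [expect_mul_const]
          gcongr
          exact expect_sq_le _ _
      _ ≤ _ := expect_mono fun x => ih x (hT x) h
      _ = _ := by rw [expect_add, expect_div_const, expect_sum]
  | hash next ih =>
    have hp : ∀ i, (hash next).prob i =
      expect (PMF.uniformOfFintype (ZMod q)) fun x => (next x).prob i := fun _ => rfl
    simp only [val]
    set p := PMF.uniformOfFintype (ZMod q)
    -- The node just passed gets number `d`, and its coefficient is the chance of the second run
    -- given the first scalar `e`.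
    have key := expect_mono (p := p) fun e =>
      ih e (hT e) (Function.update h d (refork next d e))
    have hs : ∀ e, ∑ i ∈ Finset.range (d + 1),
        (next e).prob i * Function.update h d (refork next d e) i =
        (∑ i ∈ Finset.range d, (next e).prob i * h i) + (next e).prob d * refork next d e := by
      intro e
      rw [Finset.sum_range_succ, Function.update_self]
      congr 1
      refine Finset.sum_congr rfl fun i hi => ?_
      rw [Function.update_of_ne (by simp at hi; omega)]
    simp only [hs] at key
    rw [expect_add, expect_add, expect_sum, expect_sum, expect_add, expect_div_const,
      expect_sum] at key
    simp only [expect_mul_const, ← hp] at key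
    have hsq : ∑ i ∈ Finset.Ico (d + 1) n, (hash next).prob i ^ 2 ≤
        ∑ i ∈ Finset.Ico (d + 1) n, expect p fun a => (next a).prob i ^ 2 :=
      Finset.sum_le_sum fun i _ => expect_sq_le _ _
    by_cases hd : d < n
    · rw [Finset.sum_eq_sum_Ico_succ_bot hd, Finset.sum_eq_sum_Ico_succ_bot hd]
      have h2 := prob_sq_le_refork next d
      calc _ ≤ (∑ i ∈ Finset.range d, (hash next).prob i * h i) +
            (((expect p fun e => (next e).prob d * refork next d e) + (hash next).prob d / q) +
            ∑ i ∈ Finset.Ico (d + 1) n, expect p fun a => (next a).prob i ^ 2) := by gcongr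
        _ = ((∑ i ∈ Finset.range d, (hash next).prob i * h i) +
            (expect p fun e => (next e).prob d * refork next d e) +
            ∑ i ∈ Finset.Ico (d + 1) n, expect p fun a => (next a).prob i ^ 2) +
            (hash next).prob d / q := by ring
        _ ≤ _ := by
          refine (add_le_add_left key _).trans_eq ?_
          rw [ENNReal.add_div]
          ring
    -- A node with number at least `n` is never an outcome; both sums of squares are empty, and the
    -- nonnegative term of node `d` is dropped.
    · have e1 : Finset.Ico d n = ∅ := by simp; omega
      have e2 : Finset.Ico (d + 1) n = ∅ := by simp; omega
      simp only [e1, e2, Finset.sum_empty, add_zero, ENNReal.zero_div] at key ⊢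
      exact le_self_add.trans key

/-- Jensen's inequality for the uniform law on the `n` indices; the case of no index is separate
because that law needs a nonempty type. -/
theorem sum_sq_le_card_mul (n : ℕ) (f : ℕ → ℝ≥0∞) :
    (∑ i ∈ Finset.range n, f i) ^ 2 ≤ n * ∑ i ∈ Finset.range n, f i ^ 2 := by
  rcases n with _ | n
  · simp
  have h := expect_sq_le (PMF.uniformOfFintype (Fin (n + 1))) fun i => f i
  rw [expect_uniform, expect_uniform, Fin.sum_univ_eq_sum_range f,
    Fin.sum_univ_eq_sum_range (fun i => f i ^ 2), Fintype.card_fin] at h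
  have hn : ((n + 1 : ℕ) : ℝ≥0∞) ≠ 0 := by simp
  have hn' : ((n + 1 : ℕ) : ℝ≥0∞) ≠ ⊤ := ENNReal.natCast_ne_top _
  calc (∑ i ∈ Finset.range (n + 1), f i) ^ 2
      = ((∑ i ∈ Finset.range (n + 1), f i) / (n + 1 : ℕ)) ^ 2 * (n + 1 : ℕ) ^ 2 := by
        rw [← mul_pow, ENNReal.div_mul_cancel hn hn']
    _ ≤ ((∑ i ∈ Finset.range (n + 1), f i ^ 2) / (n + 1 : ℕ)) * (n + 1 : ℕ) ^ 2 := by gcongr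
    _ = _ := by rw [sq, ← mul_assoc, ENNReal.div_mul_cancel hn hn', mul_comm]

/-- The probability that two runs which share the prefix before a random `hash` node succeed. -/
theorem acc_sq_le_val {n : ℕ} {T : Tree q} (hT : T.Indexed n 0) :
    T.acc ^ 2 ≤ n * (T.val refork (fun _ => 0) 0 + T.acc / q) := by
  have h := sum_prob_sq_le_val hT fun _ => 0
  rw [Finset.range_zero, Finset.sum_empty, zero_add, ← Finset.range_eq_Ico,
    ← acc_eq_sum hT] at h
  calc T.acc ^ 2 ≤ n * ∑ i ∈ Finset.range n, T.prob i ^ 2 := by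
        rw [acc_eq_sum hT]
        exact sum_sq_le_card_mul n _
    _ ≤ _ := by gcongr

end Tree

/-! ## Programs for a single run of the adversary -/

/-- Deterministic computations with scalars and points. -/
inductive Instr (q : ℕ) where
  | const (c : ZMod q)
  | scalarOp (o : ScalarOp) (i j : ℕ)
  | addPt (i j : ℕ)
  | mulPt (i j : ℕ)

/-- Tests for equality. -/
inductive EqTest where
  | scalar (i j : ℕ)
  | pt (i j : ℕ)
  | id (i j : ℕ)
  | msg (i j : ℕ)

/-- Programs that accompany one suspended run of the adversary. The registers are numbered along the
path of the program itself. A scalar that is drawn by `hash R` is the hash value of a commitment in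
the point register `R`, and `done i s e x` claims that `(s, e)` is a signature under the public key
`xP + X` whose commitment and hash value belong to the `hash` node number `i`. -/
inductive Run (q t k : ℕ) where
  | fail
  | done (i s e x : ℕ)
  | random (next : Run q t k)
  | hash (R : ℕ) (next : Run q t k)
  | op (o : Instr q) (next : Run q t k)
  | test (c : EqTest) (yes no : Run q t k)
  | branch (n : ℕ) (next : Fin (n + 1) → Run q t k)
  | inspect (next : Option OracleKind → Run q t k)
  | reply (r : Reply t k) (next : Run q t k)

section Semantics

variable {q t k : ℕ} [Fact q.Prime] {ID M G : Type} [DecidableEq ID] [DecidableEq M]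
  [AddCommGroup G] [DecidableEq G]

/-- The effect of an instruction all of whose arguments are present. -/
def Instr.step (s : Machine q t k ID M G) : Instr q → Option (Machine q t k ID M G)
  | const c => some (s.pushScalar c)
  | scalarOp o i j =>
    (s.scalars[i]?).bind fun x => (s.scalars[j]?).map fun y => s.pushScalar (o.eval x y)
  | addPt i j => (s.points[i]?).bind fun x => (s.points[j]?).map fun y => s.pushPt (x + y)
  | mulPt i j => (s.scalars[i]?).bind fun x => (s.points[j]?).map fun y => s.pushPt (smulPt x y)

/-- The result of a test all of whose arguments are present. -/
def EqTest.eval (s : Machine q t k ID M G) : EqTest → Option Bool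
  | scalar i j => (s.scalars[i]?).bind fun x => (s.scalars[j]?).map fun y => decide (x = y)
  | pt i j => (s.points[i]?).bind fun x => (s.points[j]?).map fun y => decide (x = y)
  | id i j => (s.ids[i]?).bind fun x => (s.ids[j]?).map fun y => decide (x = y)
  | msg i j => (s.msgs[i]?).bind fun x => (s.msgs[j]?).map fun y => decide (x = y)

/-- The content of an answer all of whose parts are present. -/
def Machine.answer? (s : Machine q t k ID M G) :
    (c : Query ID M G) → Reply t k → Option (c.Answer q t k)
  | .h1 _ _, .h1 j => some j
  | .h5 _ _, .h5 e => s.scalars[e]?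
  | .pubKey _, .pubKey U Q => (s.points[U]?).bind fun x => (s.points[Q]?).map fun y => (x, y)
  | .partKey _, .partKey w Q => (s.scalars[w]?).bind fun x => (s.points[Q]?).map fun y => (x, y)
  | .secKey _, .secKey α => s.scalars[α]?
  | .corrupt _, .corrupt x => (s.scalars[x]?).map some
  | .sign _ _, .sign e₁ e₂ =>
    (s.scalars[e₁]?).bind fun x => (s.scalars[e₂]?).map fun y => some (x, y)
  | _, _ => none

/-- The registers hold a signature under the public key `xP + X` that belongs to the `hash` node
number `i`, whose commitments and hash values are recorded in `h`. -/
def Claim (P X : G) (h : List (G × ZMod q)) (i : ℕ) (σ : ZMod q × ZMod q) (x : ZMod q) : Prop :=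
  h[i]? = some (smulPt σ.1 P + smulPt σ.2 (smulPt x P + X), σ.2)

open Classical in
/-- The law of a run. -/
def Run.tree (P X : G) (n : ℕ) : Run q t k → Machine q t k ID M G → List (G × ZMod q) →
    Strategy q t k ID M G → Tree q
  | .fail, _, _, _ => .leaf none
  | .done i a b c, s, h, _ =>
    match s.scalars[a]?, s.scalars[b]?, s.scalars[c]? with
    | some y, some e, some x => if Claim P X h i (y, e) x ∧ i < n then .leaf (some i) else .leaf none
    | _, _, _ => .leaf none
  | .random p, s, h, cur =>
    .coin (ZMod q) (PMF.uniformOfFintype _) fun x => p.tree P X n (s.pushScalar x) h cur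
  | .hash R p, s, h, cur =>
    match s.points[R]? with
    | some Y => .hash fun e => p.tree P X n (s.pushScalar e) (h ++ [(Y, e)]) cur
    | none => .leaf none
  | .op o p, s, h, cur =>
    match o.step s with
    | some s' => p.tree P X n s' h cur
    | none => .leaf none
  | .test c yes no, s, h, cur =>
    match c.eval s with
    | some true => yes.tree P X n s h cur
    | some false => no.tree P X n s h cur
    | none => .leaf none
  | .branch m next, s, h, cur =>
    .coin (Fin (m + 1)) (PMF.uniformOfFintype _) fun i => (next i).tree P X n s h cur
  | .inspect next, s, h, cur =>
    match cur with
    | .forge _ id m σ =>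
      (next none).tree P X n ((((s.pushID id).pushMsg m).pushScalar σ.1).pushScalar σ.2) h cur
    | .ask _ c _ => (next (some c.kind)).tree P X n (s.pushQuery c) h cur
  | .reply r p, s, h, cur =>
    match cur with
    | .ask _ c cont =>
      match s.answer? c r with
      | some a => p.tree P X n s h (cont a)
      | none => .leaf none
    | _ => .leaf none

theorem Run.indexed_tree (P X : G) (n : ℕ) (p : Run q t k) (s : Machine q t k ID M G)
    (h : List (G × ZMod q)) (cur : Strategy q t k ID M G) :
    (p.tree P X n s h cur).Indexed n h.length := by
  induction p generalizing s h cur with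
  | fail => simp [tree, Tree.Indexed]
  | done i a b c =>
    simp only [tree]
    split
    · split_ifs with hc
      · intro j hj
        cases hj
        exact ⟨(List.getElem?_eq_some_iff.1 hc.1).1, hc.2⟩
      · simp [Tree.Indexed]
    · simp [Tree.Indexed]
  | random p ih => exact fun x => ih _ _ _
  | hash R p ih =>
    simp only [tree]
    split
    · rename_i Y _
      intro e
      simpa using ih (s.pushScalar e) (h ++ [(Y, e)]) cur
    · simp [Tree.Indexed]
  | op o p ih =>
    simp only [tree]
    split
    · exact ih _ _ _
    · simp [Tree.Indexed]
  | test c yes no ih1 ih2 =>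
    simp only [tree]
    split
    · exact ih1 _ _ _
    · exact ih2 _ _ _
    · simp [Tree.Indexed]
  | branch m next ih => exact fun x => ih _ _ _ _
  | inspect next ih =>
    cases cur
    · exact ih _ _ _ _
    · exact ih _ _ _ _
  | reply r p ih =>
    cases cur
    · simp [tree, Tree.Indexed]
    · simp only [tree]
      split
      · exact ih _ _ _
      · simp [Tree.Indexed]

end Semantics

/-! ## Compilation -/

/-- For each sort but the runs, the numbers of the registers of the machine that hold the registers
of a `Run`. -/
structure Ren where
  s : List ℕ
  p : List ℕ
  i : List ℕ
  m : List ℕ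

/-- The numbers of filled registers of a machine. -/
structure Ctr where
  s : ℕ
  p : ℕ
  i : ℕ
  m : ℕ
  r : ℕ

namespace Ctr

def pushS (c : Ctr) : Ctr := { c with s := c.s + 1 }
def pushP (c : Ctr) : Ctr := { c with p := c.p + 1 }
def pushI (c : Ctr) : Ctr := { c with i := c.i + 1 }
def pushM (c : Ctr) : Ctr := { c with m := c.m + 1 }
def pushR (c : Ctr) : Ctr := { c with r := c.r + 1 }

end Ctr

namespace Ren

/-- The next scalar register is mapped to the next scalar register of the machine. -/
def pushS (ρ : Ren) (c : Ctr) : Ren := { ρ with s := ρ.s ++ [c.s] }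
def pushP (ρ : Ren) (c : Ctr) : Ren := { ρ with p := ρ.p ++ [c.p] }
def pushI (ρ : Ren) (c : Ctr) : Ren := { ρ with i := ρ.i ++ [c.i] }
def pushM (ρ : Ren) (c : Ctr) : Ren := { ρ with m := ρ.m ++ [c.m] }

def scalar (ρ : Ren) (i : ℕ) : ℕ := ρ.s.getD i 0
def point (ρ : Ren) (i : ℕ) : ℕ := ρ.p.getD i 0
def ident (ρ : Ren) (i : ℕ) : ℕ := ρ.i.getD i 0
def msg (ρ : Ren) (i : ℕ) : ℕ := ρ.m.getD i 0

end Ren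

/-- The counters after the content of a message has been copied. -/
def Ctr.pushMessage (c : Ctr) : Option OracleKind → Ctr
  | none => c.pushI.pushM.pushS.pushS
  | some .h1 => c.pushI.pushP
  | some .h5 => c.pushM.pushP
  | some .sign => c.pushI.pushM
  | some _ => c.pushI

def Ren.pushMessage (ρ : Ren) (c : Ctr) : Option OracleKind → Ren
  | none => ((((ρ.pushI c).pushM c).pushS c).pushS c.pushS)
  | some .h1 => (ρ.pushI c).pushP c
  | some .h5 => (ρ.pushM c).pushP c
  | some .sign => (ρ.pushI c).pushM c
  | some _ => ρ.pushI c

def Reply.rename {t k : ℕ} (ρ : Ren) : Reply t k → Reply t k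
  | .h1 j => .h1 j
  | .h5 e => .h5 (ρ.scalar e)
  | .pubKey U Q => .pubKey (ρ.point U) (ρ.point Q)
  | .partKey w Q => .partKey (ρ.scalar w) (ρ.point Q)
  | .secKey α => .secKey (ρ.scalar α)
  | .corrupt x => .corrupt (ρ.scalar x)
  | .sign s e => .sign (ρ.scalar s) (ρ.scalar e)

section Compile

variable {q t k : ℕ}

def Instr.compile (ρ : Ren) (p : Prog q t k) : Instr q → Prog q t k
  | const z => .const z p
  | scalarOp o i j => .scalarOp o (ρ.scalar i) (ρ.scalar j) p
  | addPt i j => .addPt (ρ.point i) (ρ.point j) p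
  | mulPt i j => .mulPt (ρ.scalar i) (ρ.point j) p

def Instr.isPt : Instr q → Bool
  | addPt _ _ => true
  | mulPt _ _ => true
  | _ => false

def Instr.ren (ρ : Ren) (c : Ctr) (o : Instr q) : Ren := if o.isPt then ρ.pushP c else ρ.pushS c

def Instr.bump (c : Ctr) (o : Instr q) : Ctr := if o.isPt then c.pushP else c.pushS

def EqTest.compile (ρ : Ren) (yes no : Prog q t k) : EqTest → Prog q t k
  | scalar i j => .eqScalar (ρ.scalar i) (ρ.scalar j) yes no
  | pt i j => .eqPt (ρ.point i) (ρ.point j) yes no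
  | id i j => .eqID (ρ.ident i) (ρ.ident j) yes no
  | msg i j => .eqMsg (ρ.msg i) (ρ.msg j) yes no

/-- What to do with a signature whose parts and whose known part of the private key are in the given
registers. -/
abbrev Closure (q t k : ℕ) : Type := ℕ → ℕ → ℕ → Ctr → Prog q t k

/-- It serves as the default of list lookups and stands at those nodes where the second run must not
end. -/
def failClosure : Closure q t k := fun _ _ _ _ => .fail

/-- The program that carries out a `Run` with the suspended run of the adversary in register `r`. At
each `hash` node it stores a closure for a signature that belongs to the node. -/
def Run.compile (snap : Run q t k → ℕ → Ren → ℕ → Closure q t k) :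
    Run q t k → ℕ → List (Closure q t k) → Ren → Ctr → Prog q t k
  | .fail, _, _, _, _ => .fail
  | .done i a b x, _, h, ρ, c =>
    h.getD i failClosure (ρ.scalar a) (ρ.scalar b) (ρ.scalar x) c
  | .random p, r, h, ρ, c => .random (p.compile snap r h (ρ.pushS c) c.pushS)
  -- The snapshot keeps `ρ` from before the draw, so that a rewound run can put a fresh scalar in
  -- the same place.
  | .hash _ p, r, h, ρ, c =>
    .random (p.compile snap r (h ++ [snap p r ρ h.length]) (ρ.pushS c) c.pushS)
  | .op o p, r, h, ρ, c => o.compile ρ (p.compile snap r h (o.ren ρ c) (o.bump c))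
  | .test e yes no, r, h, ρ, c =>
    e.compile ρ (yes.compile snap r h ρ c) (no.compile snap r h ρ c)
  | .branch n next, r, h, ρ, c => .branch n fun i => (next i).compile snap r h ρ c
  | .inspect next, r, h, ρ, c =>
    .inspect r fun o => (next o).compile snap r h (ρ.pushMessage c o) (c.pushMessage o)
  | .reply a p, r, h, ρ, c => .reply r (a.rename ρ) (p.compile snap c.r h ρ c.pushR)

/-- The solution of `s₁ + e₁ (x₁ + a) = s₂ + e₂ (x₂ + a)` for `a`. -/
def finish (s₁ e₁ x₁ : ℕ) : Closure q t k := fun s₂ e₂ x₂ c =>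
  -- The seven new registers hold `e₁x₁`, `s₁ + e₁x₁`, `e₂x₂`, `s₂ + e₂x₂`, the difference of the
  -- second sum and the first, `e₁ - e₂`, and the quotient.
  .scalarOp .mul e₁ x₁ <| .scalarOp .add s₁ c.s <| .scalarOp .mul e₂ x₂ <|
  .scalarOp .add s₂ (c.s + 2) <| .scalarOp .sub (c.s + 3) (c.s + 1) <|
  .scalarOp .sub e₁ e₂ <| .scalarOp .div (c.s + 4) (c.s + 5) <| .output (c.s + 6)

/-- The second run, from a `hash` node on with a fresh hash value. -/
def rewind (p : Run q t k) (r : ℕ) (ρ : Ren) (n : ℕ) : Closure q t k := fun s e x c =>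
  -- The map `ρ` and the suspended run `r` come from the `hash` node, the counters `c` from the end
  -- of the first run. The `n` failing closures keep the numbering, so that `finish` sits at index
  -- `n`, the number of the rewound node.
  .random (p.compile (fun _ _ _ _ => failClosure) r
    (List.replicate n failClosure ++ [finish s e x]) (ρ.pushS c) c.pushS)

end Compile

/-! ### Compiled programs succeed at least as often as the tree predicts -/

section Correctness

variable {q t k : ℕ} [Fact q.Prime] {ID M G : Type} [DecidableEq ID] [DecidableEq M]
  [AddCommGroup G] [DecidableEq G]

namespace Machine

def ctr (s : Machine q t k ID M G) : Ctr :=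
  ⟨s.scalars.length, s.points.length, s.ids.length, s.msgs.length, s.runs.length⟩

/-- All registers of `s` are registers of `s'`. -/
structure Le (s s' : Machine q t k ID M G) : Prop where
  scalars : s.scalars <+: s'.scalars
  points : s.points <+: s'.points
  ids : s.ids <+: s'.ids
  msgs : s.msgs <+: s'.msgs
  runs : s.runs <+: s'.runs

theorem Le.refl (s : Machine q t k ID M G) : s.Le s :=
  ⟨List.prefix_rfl, List.prefix_rfl, List.prefix_rfl, List.prefix_rfl, List.prefix_rfl⟩

theorem Le.trans {s s' s'' : Machine q t k ID M G} (h : s.Le s') (h' : s'.Le s'') : s.Le s'' :=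
  ⟨h.1.trans h'.1, h.2.trans h'.2, h.3.trans h'.3, h.4.trans h'.4, h.5.trans h'.5⟩

theorem Le.tick {s s' : Machine q t k ID M G} (h : s.Le s') (n : ℕ) : s.Le (s'.tick n) :=
  ⟨h.1, h.2, h.3, h.4, h.5⟩

theorem Le.pushScalar {s s' : Machine q t k ID M G} (h : s.Le s') (x : ZMod q) :
    s.Le (s'.pushScalar x) :=
  ⟨h.1.trans (List.prefix_append _ _), h.2, h.3, h.4, h.5⟩

theorem Le.pushPt {s s' : Machine q t k ID M G} (h : s.Le s') (x : G) : s.Le (s'.pushPt x) :=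
  ⟨h.1, h.2.trans (List.prefix_append _ _), h.3, h.4, h.5⟩

theorem Le.pushID {s s' : Machine q t k ID M G} (h : s.Le s') (x : ID) : s.Le (s'.pushID x) :=
  ⟨h.1, h.2, h.3.trans (List.prefix_append _ _), h.4, h.5⟩

theorem Le.pushMsg {s s' : Machine q t k ID M G} (h : s.Le s') (x : M) : s.Le (s'.pushMsg x) :=
  ⟨h.1, h.2, h.3, h.4.trans (List.prefix_append _ _), h.5⟩

theorem Le.pushRun {s s' : Machine q t k ID M G} (h : s.Le s') (x : Strategy q t k ID M G) :
    s.Le (s'.pushRun x) :=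
  ⟨h.1, h.2, h.3, h.4, h.5.trans (List.prefix_append _ _)⟩

theorem Le.pushQuery {s s' : Machine q t k ID M G} (h : s.Le s') (c : Query ID M G) :
    s.Le (s'.pushQuery c) := by
  cases c
  · exact (h.pushID _).pushPt _
  · exact (h.pushMsg _).pushPt _
  all_goals first | exact h.pushID _ | exact (h.pushID _).pushMsg _

end Machine

theorem getElem?_of_prefix {α : Type*} {l l' : List α} (h : l <+: l') {i : ℕ} {x : α}
    (hx : l[i]? = some x) : l'[i]? = some x := by
  obtain ⟨l'', rfl⟩ := h
  rw [List.getElem?_append_left (List.getElem?_eq_some_iff.1 hx).1, hx]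

theorem exists_of_map_eq_some {α β : Type} {o : Option α} {f : α → β} {b : β}
    (h : o.map f = some b) : ∃ x, o = some x ∧ f x = b :=
  Option.map_eq_some_iff.1 h

theorem exists_of_bind_map_eq_some {α β γ : Type} {o : Option α} {o' : Option β} {f : α → β → γ}
    {c : γ} (h : (o.bind fun x => o'.map fun y => f x y) = some c) :
    ∃ x y, o = some x ∧ o' = some y ∧ f x y = c := by
  cases o <;> cases o' <;> simp_all

/-- The registers `l` of a `Run` are held by the registers `l'` of a machine. -/
def Embedded {α : Type} (ρ : List ℕ) (l l' : List α) : Prop :=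
  List.Forall₂ (fun i x => l'[i]? = some x) ρ l

theorem Embedded.mono {α : Type} {ρ : List ℕ} {l l' l'' : List α} (h : Embedded ρ l l')
    (h' : l' <+: l'') : Embedded ρ l l'' :=
  List.Forall₂.imp (fun _ _ => getElem?_of_prefix h') h

theorem Embedded.push {α : Type} {ρ : List ℕ} {l l' : List α} (h : Embedded ρ l l') (x : α) :
    Embedded (ρ ++ [l'.length]) (l ++ [x]) (l' ++ [x]) :=
  List.rel_append (h.mono (List.prefix_append _ _)) (by simp)

/-- The register exists by hypothesis, so the default `0` of the renaming is not used. This is why a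
`Run` fails on missing registers, where the machine itself would read a zero. -/
theorem Embedded.get {α : Type} {ρ : List ℕ} {l l' : List α} (h : Embedded ρ l l') {i : ℕ} {x : α}
    (hx : l[i]? = some x) : l'[ρ.getD i 0]? = some x := by
  induction h generalizing i with
  | nil => simp at hx
  | cons h _ ih =>
    cases i with
    | zero => simpa using h.trans (by simpa using hx)
    | succ i => simpa using ih (by simpa using hx)

structure Embeds (ρ : Ren) (s s' : Machine q t k ID M G) : Prop where
  scalars : Embedded ρ.s s.scalars s'.scalars
  points : Embedded ρ.p s.points s'.points
  ids : Embedded ρ.i s.ids s'.ids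
  msgs : Embedded ρ.m s.msgs s'.msgs

namespace Embeds

variable {ρ : Ren} {s s' s'' : Machine q t k ID M G}

theorem mono (h : Embeds ρ s s') (h' : s'.Le s'') : Embeds ρ s s'' :=
  ⟨h.1.mono h'.1, h.2.mono h'.2, h.3.mono h'.3, h.4.mono h'.4⟩

theorem tick (h : Embeds ρ s s') (n : ℕ) : Embeds ρ s (s'.tick n) := ⟨h.1, h.2, h.3, h.4⟩

theorem pushScalar (h : Embeds ρ s s') (x : ZMod q) :
    Embeds (ρ.pushS s'.ctr) (s.pushScalar x) (s'.pushScalar x) :=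
  ⟨h.1.push x, h.2, h.3, h.4⟩

theorem pushPt (h : Embeds ρ s s') (x : G) :
    Embeds (ρ.pushP s'.ctr) (s.pushPt x) (s'.pushPt x) :=
  ⟨h.1, h.2.push x, h.3, h.4⟩

theorem pushID (h : Embeds ρ s s') (x : ID) :
    Embeds (ρ.pushI s'.ctr) (s.pushID x) (s'.pushID x) :=
  ⟨h.1, h.2, h.3.push x, h.4⟩

theorem pushMsg (h : Embeds ρ s s') (x : M) :
    Embeds (ρ.pushM s'.ctr) (s.pushMsg x) (s'.pushMsg x) :=
  ⟨h.1, h.2, h.3, h.4.push x⟩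

theorem pushRun (h : Embeds ρ s s') (x : Strategy q t k ID M G) : Embeds ρ s (s'.pushRun x) :=
  ⟨h.1, h.2, h.3, h.4⟩

theorem scalar (h : Embeds ρ s s') {i : ℕ} {x : ZMod q} (hx : s.scalars[i]? = some x) :
    s'.scalar (ρ.scalar i) = x := by
  rw [Machine.scalar, Ren.scalar, List.getD_eq_getElem?_getD, h.1.get hx, Option.getD_some]

theorem point (h : Embeds ρ s s') {i : ℕ} {x : G} (hx : s.points[i]? = some x) :
    s'.point (ρ.point i) = x := by
  rw [Machine.point, Ren.point, List.getD_eq_getElem?_getD, h.2.get hx, Option.getD_some]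

theorem answer (h : Embeds ρ s s') {c : Query ID M G} {r : Reply t k} {a : c.Answer q t k}
    (ha : s.answer? c r = some a) : s'.answer c (r.rename ρ) = some a := by
  cases c <;> cases r <;>
    simp only [Machine.answer?, Machine.answer, Reply.rename, reduceCtorEq] at ha ⊢
  · exact ha
  · rw [h.scalar ha]
  · obtain ⟨x, y, hx, hy, rfl⟩ := exists_of_bind_map_eq_some ha
    rw [h.point hx, h.point hy]
  · obtain ⟨x, y, hx, hy, rfl⟩ := exists_of_bind_map_eq_some ha
    rw [h.scalar hx, h.point hy]
  · rw [h.scalar ha]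
  · obtain ⟨x, hx, rfl⟩ := exists_of_map_eq_some ha
    rw [h.scalar hx]
  · obtain ⟨x, y, hx, hy, rfl⟩ := exists_of_bind_map_eq_some ha
    rw [h.scalar hx, h.scalar hy]

end Embeds

variable (A : Adversary q t k ID M G)

/-- The probability that a program outputs `a`. -/
def Prog.prob (a : ZMod q) (p : Prog q t k) (s : Machine q t k ID M G) : ℝ≥0∞ :=
  expect (p.exec A s) fun o => if o.1 = some a then 1 else 0

variable {A}

theorem Instr.exec_compile {ρ : Ren} {s s₁ s' : Machine q t k ID M G} (h : Embeds ρ s s')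
    {o : Instr q} (ho : o.step s = some s₁) (p : Prog q t k) :
    ∃ s'', (o.compile ρ p).exec A s' = p.exec A s'' ∧ Embeds (o.ren ρ s'.ctr) s₁ s'' ∧
      s'.Le s'' ∧ s''.ctr = o.bump s'.ctr := by
  cases o with
  | const z =>
    simp only [step, Option.some.injEq] at ho
    subst ho
    exact ⟨_, rfl, (h.tick 1).pushScalar z, ((Machine.Le.refl _).tick 1).pushScalar z,
      by simp [bump, isPt, Machine.ctr, Machine.pushScalar, Machine.tick, Ctr.pushS]⟩
  | scalarOp o i j =>
    simp only [step, Option.bind_eq_some_iff, Option.map_eq_some_iff] at ho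
    obtain ⟨x, hx, y, hy, rfl⟩ := ho
    refine ⟨_, rfl, ?_, ((Machine.Le.refl _).tick 1).pushScalar _,
      by simp [bump, isPt, Machine.ctr, Machine.pushScalar, Machine.tick, Ctr.pushS]⟩
    rw [h.scalar hx, h.scalar hy]
    exact (h.tick 1).pushScalar _
  | addPt i j =>
    simp only [step, Option.bind_eq_some_iff, Option.map_eq_some_iff] at ho
    obtain ⟨x, hx, y, hy, rfl⟩ := ho
    refine ⟨_, rfl, ?_, ((Machine.Le.refl _).tick 1).pushPt _,
      by simp [bump, isPt, Machine.ctr, Machine.pushPt, Machine.tick, Ctr.pushP]⟩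
    rw [h.point hx, h.point hy]
    exact (h.tick 1).pushPt _
  | mulPt i j =>
    simp only [step, Option.bind_eq_some_iff, Option.map_eq_some_iff] at ho
    obtain ⟨x, hx, y, hy, rfl⟩ := ho
    refine ⟨_, rfl, ?_, ((Machine.Le.refl _).tick 1).pushPt _,
      by simp [bump, isPt, Machine.ctr, Machine.pushPt, Machine.tick, Ctr.pushP]⟩
    rw [h.scalar hx, h.point hy]
    exact (h.tick 1).pushPt _

theorem EqTest.exec_compile {ρ : Ren} {s s' : Machine q t k ID M G} (h : Embeds ρ s s')
    {c : EqTest} {b : Bool} (hc : c.eval s = some b) (yes no : Prog q t k) :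
    (c.compile ρ yes no).exec A s' = (if b then yes else no).exec A (s'.tick 1) := by
  cases c with
  | scalar i j =>
    simp only [eval, Option.bind_eq_some_iff, Option.map_eq_some_iff] at hc
    obtain ⟨x, hx, y, hy, rfl⟩ := hc
    simp only [compile, Prog.exec, h.scalar hx, h.scalar hy]
    split_ifs <;> simp_all
  | pt i j =>
    simp only [eval, Option.bind_eq_some_iff, Option.map_eq_some_iff] at hc
    obtain ⟨x, hx, y, hy, rfl⟩ := hc
    simp only [compile, Prog.exec, h.point hx, h.point hy]
    split_ifs <;> simp_all
  | id i j =>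
    simp only [eval, Option.bind_eq_some_iff, Option.map_eq_some_iff] at hc
    obtain ⟨x, hx, y, hy, rfl⟩ := hc
    have h1 := h.ids.get hx
    have h2 := h.ids.get hy
    simp only [compile, Prog.exec, Ren.ident, h1, h2]
    split_ifs <;> simp_all
  | msg i j =>
    simp only [eval, Option.bind_eq_some_iff, Option.map_eq_some_iff] at hc
    obtain ⟨x, hx, y, hy, rfl⟩ := hc
    have h1 := h.msgs.get hx
    have h2 := h.msgs.get hy
    simp only [compile, Prog.exec, Ren.msg, h1, h2]
    split_ifs <;> simp_all

variable (P X : G) (a : ZMod q)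

/-- If a signature as in `Claim` is in registers of a later machine, then `v` is a lower bound for
the success probability of the closure. -/
def Closure.Good (A : Adversary q t k ID M G) (K : Closure q t k) (Y : G) (e : ZMod q) (v : ℝ≥0∞)
    (s : Machine q t k ID M G) : Prop :=
  ∀ s' : Machine q t k ID M G, s.Le s' → ∀ i₁ i₂ i₃ x₁ x₃, s'.scalars[i₁]? = some x₁ →
    s'.scalars[i₂]? = some e → s'.scalars[i₃]? = some x₃ →
    Y = smulPt x₁ P + smulPt e (smulPt x₃ P + X) → v ≤ (K i₁ i₂ i₃ s'.ctr).prob A a s'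

def GoodClosures (A : Adversary q t k ID M G) (l : List (Closure q t k)) (h : List (G × ZMod q))
    (v : ℕ → ℝ≥0∞) (s : Machine q t k ID M G) : Prop :=
  l.length = h.length ∧
    ∀ i Y e, h[i]? = some (Y, e) → (l.getD i failClosure).Good P X a A Y e (v i) s

/-- The values `w` are lower bounds for the success probabilities of the closures that belong to
`hash` nodes. -/
def GoodSnap (n : ℕ) (A : Adversary q t k ID M G)
    (w : (ZMod q → Tree q) → ℕ → ZMod q → ℝ≥0∞)
    (snap : Run q t k → ℕ → Ren → ℕ → Closure q t k) : Prop :=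
  ∀ (p : Run q t k) (s s' : Machine q t k ID M G) (h : List (G × ZMod q))
    (cur : Strategy q t k ID M G) (ρ : Ren) (r : ℕ) (Y : G) (e : ZMod q),
    Embeds ρ s s' → s'.runs[r]? = some cur →
    (snap p r ρ h.length).Good P X a A Y e
      (w (fun e' => p.tree P X n (s.pushScalar e') (h ++ [(Y, e')]) cur) h.length e) s'

variable {P X a}

theorem Closure.Good.mono {K : Closure q t k} {Y : G} {e : ZMod q} {v : ℝ≥0∞}
    {s s' : Machine q t k ID M G} (h : K.Good P X a A Y e v s) (hs : s.Le s') :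
    K.Good P X a A Y e v s' :=
  fun _ h' => h _ (hs.trans h')

/-- With the value `0` nothing is claimed about a closure. This lets the second run, which stores no
useful closures, go through the same comparison as the first. -/
theorem Closure.good_zero (K : Closure q t k) (Y : G) (e : ZMod q) (s : Machine q t k ID M G) :
    K.Good P X a A Y e 0 s := by
  intro s' _ _ _ _ _ _ _ _ _ _
  exact zero_le

theorem GoodClosures.mono {l : List (Closure q t k)} {h : List (G × ZMod q)} {v : ℕ → ℝ≥0∞}
    {s s' : Machine q t k ID M G} (hl : GoodClosures P X a A l h v s) (hs : s.Le s') :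
    GoodClosures P X a A l h v s' :=
  ⟨hl.1, fun i Y e hi => (hl.2 i Y e hi).mono hs⟩

theorem GoodClosures.snoc {l : List (Closure q t k)} {h : List (G × ZMod q)} {v : ℕ → ℝ≥0∞}
    {s : Machine q t k ID M G} (hl : GoodClosures P X a A l h v s) {K : Closure q t k} {Y : G}
    {e : ZMod q} {x : ℝ≥0∞} (hK : K.Good P X a A Y e x s) :
    GoodClosures P X a A (l ++ [K]) (h ++ [(Y, e)]) (Function.update v h.length x) s := by
  refine ⟨by simp [hl.1], fun i Y' e' hi => ?_⟩
  rcases lt_trichotomy i h.length with hlt | rfl | hgt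
  · rw [List.getElem?_append_left hlt] at hi
    rw [Function.update_of_ne hlt.ne, List.getD_append _ _ _ _ (hl.1 ▸ hlt)]
    exact hl.2 i Y' e' hi
  · simp only [List.getElem?_concat_length, Option.some.injEq, Prod.mk.injEq] at hi
    obtain ⟨rfl, rfl⟩ := hi
    rw [Function.update_self, ← hl.1]
    simpa using hK
  · rw [List.getElem?_eq_none (by simp; omega)] at hi
    simp at hi

theorem Machine.ctr_pushQuery (s : Machine q t k ID M G) (c : Query ID M G) :
    (s.pushQuery c).ctr = s.ctr.pushMessage (some c.kind) := by
  cases c <;> simp [Machine.pushQuery, Machine.ctr, Ctr.pushMessage, Query.kind, Ctr.pushI,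
    Ctr.pushM, Ctr.pushP, Machine.pushID, Machine.pushMsg, Machine.pushPt]

theorem Embeds.pushQuery {ρ : Ren} {s s' : Machine q t k ID M G} (h : Embeds ρ s s')
    (c : Query ID M G) :
    Embeds (ρ.pushMessage s'.ctr (some c.kind)) (s.pushQuery c) (s'.pushQuery c) := by
  cases c
  · exact (h.pushID _).pushPt _
  · exact (h.pushMsg _).pushPt _
  all_goals first | exact h.pushID _ | exact (h.pushID _).pushMsg _

/-- A compiled program is at least as successful as the values that are attached to the outcomes of
the run. -/
theorem Run.val_le_prob {n : ℕ} {w : (ZMod q → Tree q) → ℕ → ZMod q → ℝ≥0∞}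
    {snap : Run q t k → ℕ → Ren → ℕ → Closure q t k} (hw : GoodSnap P X a n A w snap)
    (p : Run q t k) (s s' : Machine q t k ID M G) (h : List (G × ZMod q))
    (cur : Strategy q t k ID M G) (ρ : Ren) (r : ℕ) (l : List (Closure q t k)) (v : ℕ → ℝ≥0∞)
    (c : Ctr) (hs : Embeds ρ s s') (hr : s'.runs[r]? = some cur)
    (hl : GoodClosures P X a A l h v s') (hc : c = s'.ctr) :
    (p.tree P X n s h cur).val w v h.length ≤ (p.compile snap r l ρ c).prob A a s' := by
  induction p generalizing s s' h cur ρ r l v c with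
  | fail => simp [tree, Tree.val]
  | done i x y z =>
    simp only [tree]
    split
    · rename_i x' y' z' hx hy hz
      split_ifs with hcl
      · simp only [compile, Tree.val, Option.elim, hc]
        -- `Claim` identifies the recorded commitment with the one computed from the registers, so
        -- the equation that the closure demands holds by `rfl`.
        exact hl.2 i _ _ hcl.1 s' (Machine.Le.refl _) _ _ _ _ _ (hs.1.get hx) (hs.1.get hy)
          (hs.1.get hz) rfl
      · simp [Tree.val]
    · simp [Tree.val]
  | random p ih =>
    simp only [tree, Tree.val, compile, Prog.prob, Prog.exec, expect_bind]
    refine expect_mono fun x => ?_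
    have hle := ((Machine.Le.refl s').tick 1).pushScalar x
    refine ih _ _ _ _ _ _ _ _ _ ?_ (getElem?_of_prefix hle.runs hr) (hl.mono hle) ?_
    · rw [hc]
      exact (hs.tick 1).pushScalar x
    · simp [hc, Machine.ctr, Machine.pushScalar, Machine.tick, Ctr.pushS]
  | hash R p ih =>
    simp only [tree]
    split
    · rename_i Y hY
      simp only [Tree.val, compile, Prog.prob, Prog.exec, expect_bind]
      refine expect_mono fun x => ?_
      have hle := ((Machine.Le.refl s').tick 1).pushScalar x
      have := ih (s.pushScalar x) ((s'.tick 1).pushScalar x) (h ++ [(Y, x)]) cur (ρ.pushS c) r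
        (l ++ [snap p r ρ l.length]) (Function.update v h.length (w
          (fun e' => p.tree P X n (s.pushScalar e') (h ++ [(Y, e')]) cur) h.length x)) c.pushS
        (by rw [hc]; exact (hs.tick 1).pushScalar x) (getElem?_of_prefix hle.runs hr) ?_
        (by simp [hc, Machine.ctr, Machine.pushScalar, Machine.tick, Ctr.pushS])
      · simpa [Prog.prob] using this
      -- The new closure was built from the state before the draw: it is good for `s'`, and goodness
      -- persists on later machines.
      · refine (hl.mono hle).snoc ?_
        rw [hl.1]
        exact (hw p s s' h cur ρ r Y x hs hr).mono hle
    · simp [Tree.val]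
  | op o p ih =>
    simp only [tree]
    split
    · rename_i s₁ ho
      obtain ⟨s'', h1, h2, h3, h4⟩ := Instr.exec_compile (A := A) hs ho
        (p.compile snap r l (o.ren ρ c) (o.bump c))
      rw [compile, Prog.prob, h1]
      exact ih _ _ _ _ _ _ _ _ _ (hc ▸ h2) (getElem?_of_prefix h3.runs hr) (hl.mono h3)
        (by rw [h4, hc])
    · simp [Tree.val]
  | test e yes no ih1 ih2 =>
    have hle := (Machine.Le.refl s').tick 1
    simp only [tree]
    split
    · rename_i he
      rw [compile, Prog.prob, EqTest.exec_compile hs he]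
      exact ih1 _ _ _ _ _ _ _ _ _ (hs.tick 1) hr (hl.mono hle) hc
    · rename_i he
      rw [compile, Prog.prob, EqTest.exec_compile hs he]
      exact ih2 _ _ _ _ _ _ _ _ _ (hs.tick 1) hr (hl.mono hle) hc
    · simp [Tree.val]
  | branch m next ih =>
    simp only [tree, Tree.val, compile, Prog.prob, Prog.exec, expect_bind]
    exact expect_mono fun x => ih x _ _ _ _ _ _ _ _ _ (hs.tick _) hr
      (hl.mono ((Machine.Le.refl s').tick _)) hc
  | inspect next ih =>
    cases cur with
    | forge wk id m σ =>
      simp only [tree, compile, Prog.prob, Prog.exec, hr]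
      refine ih none _ _ _ _ _ _ _ _ _ ?_ hr (hl.mono ?_) ?_
      · rw [hc]
        have := ((((hs.tick 1).pushID id).pushMsg m).pushScalar σ.1).pushScalar σ.2
        convert this using 2
        simp [Ren.pushMessage, Machine.ctr, Machine.pushScalar, Machine.pushID, Machine.pushMsg,
          Machine.tick, Ctr.pushS, Ren.pushS, Ren.pushI, Ren.pushM]
      · exact ((((Machine.Le.refl _).tick 1).pushID _).pushMsg _).pushScalar _ |>.pushScalar _
      · simp [hc, Ctr.pushMessage, Machine.ctr, Machine.pushScalar, Machine.pushID, Machine.pushMsg,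
          Machine.tick, Ctr.pushS, Ctr.pushI, Ctr.pushM]
    | ask wk qu cont =>
      simp only [tree, compile, Prog.prob, Prog.exec, hr]
      have hle := ((Machine.Le.refl s').tick 1).pushQuery qu
      refine ih _ _ _ _ _ _ _ _ _ _ ?_ (getElem?_of_prefix hle.runs hr) (hl.mono hle) ?_
      · rw [hc]
        exact (hs.tick 1).pushQuery qu
      · rw [Machine.ctr_pushQuery, hc]
        rfl
  | reply b p ih =>
    cases cur with
    | forge wk id m σ => simp [tree, Tree.val]
    | ask wk qu cont =>
      simp only [tree]
      split
      · rename_i x hx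
        simp only [compile, Prog.prob, Prog.exec, hr, hs.answer hx]
        refine ih _ _ _ _ _ _ _ _ _ ((hs.tick _).pushRun _) ?_
          (hl.mono (((Machine.Le.refl s').tick _).pushRun _)) ?_
        · simp [hc, Machine.ctr, Machine.pushRun, Machine.tick]
        · simp [hc, Machine.ctr, Machine.pushRun, Machine.tick, Ctr.pushR]
      · simp [Tree.val]

/-- `smulPt` multiplies by the representative below `q`; reduction modulo `q` is harmless since `q`
kills the point. -/
theorem smulPt_add (hX : q • X = 0) (c d : ZMod q) :
    smulPt (c + d) X = smulPt c X + smulPt d X := by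
  have hq : ∀ n : ℕ, (n % q) • X = n • X := fun n => by
    conv_rhs => rw [← Nat.mod_add_div n q, add_smul, mul_smul, smul_comm, hX, smul_zero, add_zero]
  simp only [smulPt, ZMod.val_add, hq, add_smul]

theorem smulPt_mul (hX : q • X = 0) (c d : ZMod q) : smulPt (c * d) X = smulPt c (smulPt d X) := by
  have hq : ∀ n : ℕ, (n % q) • X = n • X := fun n => by
    conv_rhs => rw [← Nat.mod_add_div n q, add_smul, mul_smul, smul_comm, hX, smul_zero, add_zero]
  simp only [smulPt, ZMod.val_mul, hq, mul_smul]

theorem smulPt_zero (X : G) : smulPt (0 : ZMod q) X = 0 := by simp [smulPt]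

theorem smulPt_injective (hP : addOrderOf P = q) :
    Function.Injective fun c : ZMod q => smulPt c P := by
  intro c d h
  have := nsmul_injOn_Iio_addOrderOf (x := P) (by simpa [hP] using c.val_lt)
    (by simpa [hP] using d.val_lt) h
  exact ZMod.val_injective q this

/-- Both commitments are the same point, and `c ↦ cP` is injective because `P` has order `q`. The
resulting linear equation determines `a` as soon as the two hash values differ. Nothing forces `x₁`
and the later known part to agree. -/
theorem finish_good (hP : addOrderOf P = q) (hX : X = smulPt a P) {s : Machine q t k ID M G}
    {i₁ i₂ i₃ : ℕ} {s₁ e₁ x₁ : ZMod q} {Y : G} (h1 : s.scalars[i₁]? = some s₁)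
    (h2 : s.scalars[i₂]? = some e₁) (h3 : s.scalars[i₃]? = some x₁)
    (hY : Y = smulPt s₁ P + smulPt e₁ (smulPt x₁ P + X)) (e : ZMod q) :
    (finish i₁ i₂ i₃ : Closure q t k).Good P X a A Y e (if e = e₁ then 0 else 1) s := by
  intro s' hs j₁ j₂ j₃ s₂ x₂ g1 g2 g3 hY'
  split_ifs with he
  · simp
  have hq : q • P = 0 := hP ▸ addOrderOf_nsmul_eq_zero P
  have hpt : ∀ u v w : ZMod q, smulPt u P + smulPt v (smulPt w P + X) =
      smulPt (u + v * (w + a)) P := fun u v w => by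
    rw [hX, ← smulPt_add hq, ← smulPt_mul hq, ← smulPt_add hq]
  rw [hpt] at hY hY'
  have hlin : s₁ + e₁ * (x₁ + a) = s₂ + e * (x₂ + a) := smulPt_injective hP (hY.symm.trans hY')
  have hval : (s₂ + e * x₂ - (s₁ + e₁ * x₁)) * (e₁ - e)⁻¹ = a := by
    have : e₁ - e ≠ 0 := sub_ne_zero.2 (Ne.symm he)
    rw [← div_eq_mul_inv, div_eq_iff this]
    linear_combination -hlin
  have k1 := getElem?_of_prefix hs.scalars h1
  have k2 := getElem?_of_prefix hs.scalars h2
  have k3 := getElem?_of_prefix hs.scalars h3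
  -- Results are only appended, so all operands remain in place while the intermediate values are
  -- written.
  have old : ∀ {i : ℕ} {z : ZMod q} (l : List (ZMod q)), s'.scalars[i]? = some z →
      (s'.scalars ++ l)[i]? = some z := fun l h => getElem?_of_prefix (List.prefix_append _ _) h
  simp only [finish, Prog.prob, Prog.exec, expect_pure, Machine.scalar, Machine.pushScalar,
    Machine.tick, ScalarOp.eval, List.append_assoc, List.cons_append, List.nil_append,
    List.getD_eq_getElem?_getD, old _ k1, old _ k2, old _ g1, old _ g2, old _ g3, k2, k3, Option.getD_some, Machine.ctr]
  simp [hval]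

theorem GoodClosures.nil (v : ℕ → ℝ≥0∞) (s : Machine q t k ID M G) :
    GoodClosures P X a A ([] : List (Closure q t k)) [] v s :=
  ⟨rfl, by simp⟩

/-- The second run is compared with its tree by `Run.val_le_prob` once more, now with the value `1`
for an outcome at the rewound node, provided the new scalar is different, and `0` for all other
outcomes. The expectation of this value is the definition of `refork`. -/
theorem goodSnap_rewind (hP : addOrderOf P = q) (hX : X = smulPt a P) (n : ℕ) :
    GoodSnap P X a n A Tree.refork (rewind : Run q t k → ℕ → Ren → ℕ → Closure q t k) := by
  intro p s s₀ h cur ρ r Y e hs hr s' hs' i₁ i₂ i₃ x₁ x₃ h1 h2 h3 hY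
  simp only [rewind, Tree.refork, Prog.prob, Prog.exec, expect_bind]
  refine expect_mono fun e' => ?_
  have hle := ((Machine.Le.refl s').tick 1).pushScalar e'
  have hle' := hs'.trans hle
  -- The rewound node has number `h.length`, the number of `hash` nodes before it.
  set v : ℕ → ℝ≥0∞ := Function.update (fun _ => 0) h.length (if e' = e then 0 else 1) with hv
  have key := Run.val_le_prob (P := P) (X := X) (a := a) (A := A) (n := n) (w := fun _ _ _ => 0)
    (snap := fun _ _ _ _ => failClosure) (fun _ _ _ _ _ _ _ _ _ _ _ => Closure.good_zero _ _ _ _) p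
    (s.pushScalar e') ((s'.tick 1).pushScalar e') (h ++ [(Y, e')]) cur (ρ.pushS s'.ctr) r
    (List.replicate h.length failClosure ++ [finish i₁ i₂ i₃]) v s'.ctr.pushS
    (((hs.mono hs').tick 1).pushScalar e') (getElem?_of_prefix hle'.runs hr)
    (GoodClosures.snoc ⟨by simp, fun i Y e _ => Closure.good_zero _ _ _ _⟩
      (finish_good hP hX (getElem?_of_prefix hle.scalars h1) (getElem?_of_prefix hle.scalars h2)
        (getElem?_of_prefix hle.scalars h3) hY e'))
    (by simp [Machine.ctr, Machine.pushScalar, Machine.tick, Ctr.pushS])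
  rw [Tree.val_zero] at key
  · refine le_trans ?_ key
    split_ifs with he
    · simp
    · refine Tree.leafE_mono (fun o => ?_) _
      cases o with
      | none => simp
      | some i =>
        by_cases hi : i = h.length
        · simp [hv, hi, he]
        · simp [hi]
  · intro i hi
    simp only [List.length_append, List.length_singleton] at hi
    rw [hv, Function.update_of_ne (by omega)]

end Correctness

/-! ## Running time -/

namespace Strategy

variable {q t k : ℕ} {ID M G : Type}

/-- The time that remains after the current message has been produced. -/
def RestIn : Strategy q t k ID M G → ℕ → Prop
  | .forge _ _ _ _, _ => True
  | .ask _ _ next, T => ∀ r, (next r).RunsIn T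

theorem RunsIn.mono {σ : Strategy q t k ID M G} {T T' : ℕ} (h : σ.RunsIn T) (hT : T ≤ T') :
    σ.RunsIn T' := by
  cases σ with
  | forge => exact le_trans h hT
  | ask w c next =>
    obtain ⟨T₁, h1, h2⟩ := h
    exact ⟨T₁, h1.trans hT, h2⟩

theorem RestIn.mono {σ : Strategy q t k ID M G} {T T' : ℕ} (h : σ.RestIn T) (hT : T ≤ T') :
    σ.RestIn T' := by
  cases σ with
  | forge => trivial
  | ask w c next => exact fun r => (h r).mono hT

theorem RunsIn.exists_restIn {σ : Strategy q t k ID M G} {T : ℕ} (h : σ.RunsIn T) :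
    ∃ T', σ.work + T' ≤ T ∧ σ.RestIn T' := by
  cases σ with
  | forge w => exact ⟨0, h, trivial⟩
  | ask w c next => exact h

end Strategy

/-- The instructions on every path of the program cost at most the given number. -/
def Run.CostLE {q t k : ℕ} : Run q t k → ℕ → Prop
  | .fail, _ => True
  | .done _ _ _ _, _ => True
  | .random p, n => ∃ m, p.CostLE m ∧ m + 1 ≤ n
  | .hash _ p, n => ∃ m, p.CostLE m ∧ m + 1 ≤ n
  | .op _ p, n => ∃ m, p.CostLE m ∧ m + 1 ≤ n
  | .test _ yes no, n => ∃ m, yes.CostLE m ∧ no.CostLE m ∧ m + 1 ≤ n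
  | .branch b next, n => ∃ m, (∀ i, (next i).CostLE m) ∧ m + (b + 1) ≤ n
  | .inspect next, n => ∃ m, (∀ o, (next o).CostLE m) ∧ m + 1 ≤ n
  | .reply _ p, n => ∃ m, p.CostLE m ∧ m + (k + 1) ≤ n

theorem Run.CostLE.mono {q t k : ℕ} {p : Run q t k} {m n : ℕ} (h : p.CostLE m) (hmn : m ≤ n) :
    p.CostLE n := by
  cases p with
  | fail => trivial
  | done => trivial
  | test c yes no =>
    obtain ⟨l, h1, h2, h3⟩ := h
    exact ⟨l, h1, h2, h3.trans hmn⟩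
  | _ =>
    obtain ⟨l, h1, h2⟩ := h
    exact ⟨l, h1, h2.trans hmn⟩

section Time

variable {q t k : ℕ} [Fact q.Prime] {ID M G : Type} [DecidableEq ID] [DecidableEq M]
  [AddCommGroup G] [DecidableEq G] (A : Adversary q t k ID M G)

/-- On `s`, the program takes at most `D` units of time. -/
def Prog.TimeLE (p : Prog q t k) (s : Machine q t k ID M G) (D : ℕ) : Prop :=
  ∀ o ∈ (p.exec A s).support, o.2 ≤ s.clock + D

/-- The programs of the closure take at most `D` units of time on all later machines. -/
def Closure.TimeLE (K : Closure q t k) (s : Machine q t k ID M G) (D : ℕ) : Prop :=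
  ∀ s' : Machine q t k ID M G, s.Le s' → ∀ i₁ i₂ i₃, (K i₁ i₂ i₃ s'.ctr).TimeLE A s' D

variable {A}

theorem Prog.TimeLE.mono {p : Prog q t k} {s : Machine q t k ID M G} {D D' : ℕ}
    (h : p.TimeLE A s D) (hD : D ≤ D') : p.TimeLE A s D' :=
  fun o ho => (h o ho).trans (by omega)

theorem Closure.TimeLE.mono {K : Closure q t k} {s s' : Machine q t k ID M G} {D : ℕ}
    (h : K.TimeLE A s D) (hs : s.Le s') : K.TimeLE A s' D :=
  fun _ h' => h _ (hs.trans h')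

theorem Prog.timeLE_pure {s : Machine q t k ID M G} {D : ℕ} {r : Option (ZMod q)} {n : ℕ}
    (h : n ≤ s.clock + D) : ∀ o ∈ (PMF.pure (r, n)).support, o.2 ≤ s.clock + D := by
  simpa using h

theorem failClosure_timeLE (s : Machine q t k ID M G) (D : ℕ) :
    (failClosure : Closure q t k).TimeLE A s D :=
  fun _ _ _ _ _ => Prog.timeLE_pure (by simp)

theorem EqTest.timeLE (c : EqTest) {ρ : Ren} {yes no : Prog q t k} {s : Machine q t k ID M G}
    {D : ℕ} (h1 : yes.TimeLE A (s.tick 1) D) (h2 : no.TimeLE A (s.tick 1) D) :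
    (c.compile ρ yes no).TimeLE A s (D + 1) := by
  intro o ho
  have h1' : ∀ o ∈ (yes.exec A (s.tick 1)).support, o.2 ≤ s.clock + (D + 1) := fun o ho =>
    (h1 o ho).trans (by simp [Machine.tick]; omega)
  have h2' : ∀ o ∈ (no.exec A (s.tick 1)).support, o.2 ≤ s.clock + (D + 1) := fun o ho =>
    (h2 o ho).trans (by simp [Machine.tick]; omega)
  cases c <;> simp only [compile, Prog.exec] at ho
  · split_ifs at ho
    exacts [h1' o ho, h2' o ho]
  · split_ifs at ho
    exacts [h1' o ho, h2' o ho]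
  all_goals
    split at ho
    · split_ifs at ho
      exacts [h1' o ho, h2' o ho]
    · exact Prog.timeLE_pure (by omega) o ho

theorem Instr.timeLE (o : Instr q) {ρ : Ren} {p : Prog q t k} {s : Machine q t k ID M G} {D : ℕ}
    (h : ∀ s' : Machine q t k ID M G, s.Le s' → s'.ctr = o.bump s.ctr → s'.clock = s.clock + 1 →
      p.TimeLE A s' D) :
    (o.compile ρ p).TimeLE A s (D + 1) := by
  intro x hx
  have h1 : ∀ z, ∀ o ∈ (p.exec A ((s.tick 1).pushScalar z)).support,
      s.ctr.pushS = Instr.bump s.ctr ‹Instr q› → o.2 ≤ s.clock + (D + 1) := fun z x hx hb =>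
    (h _ (((Machine.Le.refl s).tick 1).pushScalar z) (by
      rw [← hb]
      simp [Machine.ctr, Machine.pushScalar, Machine.tick, Ctr.pushS]) rfl x hx).trans
      (by simp [Machine.tick, Machine.pushScalar]; omega)
  have h2 : ∀ z, ∀ o ∈ (p.exec A ((s.tick 1).pushPt z)).support,
      s.ctr.pushP = Instr.bump s.ctr ‹Instr q› → o.2 ≤ s.clock + (D + 1) := fun z x hx hb =>
    (h _ (((Machine.Le.refl s).tick 1).pushPt z) (by
      rw [← hb]
      simp [Machine.ctr, Machine.pushPt, Machine.tick, Ctr.pushP]) rfl x hx).trans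
      (by simp [Machine.tick, Machine.pushPt]; omega)
  cases o
  · exact h1 _ x hx rfl
  · exact h1 _ x hx rfl
  · exact h2 _ x hx rfl
  · exact h2 _ x hx rfl

theorem Machine.clock_pushQuery (s : Machine q t k ID M G) (c : Query ID M G) :
    (s.pushQuery c).clock = s.clock := by
  cases c <;> rfl

/-- The running time of a compiled program: its own cost, the time of the adversary, and the time
of a closure. -/
theorem Run.timeLE_compile {N T D : ℕ} {snap : Run q t k → ℕ → Ren → ℕ → Closure q t k}
    (hsnap : ∀ (p : Run q t k) (r : ℕ) (ρ : Ren) (n : ℕ) (s : Machine q t k ID M G) cur,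
      p.CostLE N → s.runs[r]? = some cur → cur.RestIn T → (snap p r ρ n).TimeLE A s D)
    (p : Run q t k) {n T' : ℕ} (hp : p.CostLE n) (hn : n ≤ N) (hT : T' ≤ T)
    {s : Machine q t k ID M G} {r : ℕ} {l : List (Closure q t k)} {ρ : Ren} {c : Ctr}
    {cur : Strategy q t k ID M G} (hr : s.runs[r]? = some cur) (hcur : cur.RestIn T')
    (hl : ∀ K ∈ l, K.TimeLE A s D) (hc : c = s.ctr) :
    (p.compile snap r l ρ c).TimeLE A s (n + T' + D) := by
  induction p generalizing n T' s r l ρ c cur with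
  | fail => exact Prog.timeLE_pure (by omega)
  | done i x y z =>
    have hK : (l.getD i failClosure).TimeLE A s D := by
      rw [List.getD_eq_getElem?_getD]
      cases hi : l[i]? with
      | none => exact failClosure_timeLE s D
      | some K => exact hl K (List.mem_of_getElem? hi)
    rw [compile, hc]
    exact (hK s (Machine.Le.refl _) _ _ _).mono (by omega)
  | random p ih =>
    obtain ⟨m, hm, hmn⟩ := hp
    intro o ho
    simp only [compile, Prog.exec, PMF.mem_support_bind_iff] at ho
    obtain ⟨x, -, ho⟩ := ho
    have hle := ((Machine.Le.refl s).tick 1).pushScalar x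
    have := ih hm (by omega) hT (getElem?_of_prefix hle.runs hr) hcur
      (fun K hK => (hl K hK).mono hle)
      (by simp [hc, Machine.ctr, Machine.pushScalar, Machine.tick, Ctr.pushS]) o ho
    simp only [Machine.pushScalar, Machine.tick] at this
    omega
  | hash R p ih =>
    obtain ⟨m, hm, hmn⟩ := hp
    intro o ho
    simp only [compile, Prog.exec, PMF.mem_support_bind_iff] at ho
    obtain ⟨x, -, ho⟩ := ho
    have hle := ((Machine.Le.refl s).tick 1).pushScalar x
    have := ih (l := l ++ [snap p r ρ l.length]) hm (by omega) hT
      (getElem?_of_prefix hle.runs hr) hcur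
      (fun K hK => by
        rcases List.mem_append.1 hK with hK | hK
        · exact (hl K hK).mono hle
        · rw [List.mem_singleton.1 hK]
          exact (hsnap p r ρ l.length s cur (hm.mono (by omega)) hr (hcur.mono hT)).mono hle)
      (by simp [hc, Machine.ctr, Machine.pushScalar, Machine.tick, Ctr.pushS]) o ho
    simp only [Machine.pushScalar, Machine.tick] at this
    omega
  | op o p ih =>
    obtain ⟨m, hm, hmn⟩ := hp
    refine (Instr.timeLE o (D := m + T' + D) fun s' hs' hb _ => ?_).mono (by omega)
    exact ih hm (by omega) hT (getElem?_of_prefix hs'.runs hr) hcur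
      (fun K hK => (hl K hK).mono hs') (by rw [hc, hb])
  | test e yes no ih1 ih2 =>
    obtain ⟨m, hm1, hm2, hmn⟩ := hp
    have hle := (Machine.Le.refl s).tick 1
    refine (EqTest.timeLE e (D := m + T' + D) ?_ ?_).mono (by omega)
    · exact ih1 hm1 (by omega) hT (getElem?_of_prefix hle.runs hr) hcur
        (fun K hK => (hl K hK).mono hle) hc
    · exact ih2 hm2 (by omega) hT (getElem?_of_prefix hle.runs hr) hcur
        (fun K hK => (hl K hK).mono hle) hc
  | branch b next ih =>
    obtain ⟨m, hm, hmn⟩ := hp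
    intro o ho
    simp only [compile, Prog.exec, PMF.mem_support_bind_iff] at ho
    obtain ⟨x, -, ho⟩ := ho
    have hle := (Machine.Le.refl s).tick (b + 1)
    have := ih x (hm x) (by omega) hT (getElem?_of_prefix hle.runs hr) hcur
      (fun K hK => (hl K hK).mono hle) hc o ho
    simp only [Machine.tick] at this
    omega
  | inspect next ih =>
    obtain ⟨m, hm, hmn⟩ := hp
    intro o ho
    simp only [compile, Prog.exec, hr] at ho
    cases cur with
    | forge w id m' σ =>
      have hle : s.Le (((((s.tick 1).pushID id).pushMsg m').pushScalar σ.1).pushScalar σ.2) :=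
        ((((Machine.Le.refl s).tick 1).pushID id).pushMsg m').pushScalar σ.1 |>.pushScalar σ.2
      have := ih none (hm none) (by omega) hT (getElem?_of_prefix hle.runs hr) hcur
        (fun K hK => (hl K hK).mono hle)
        (by simp [hc, Ctr.pushMessage, Machine.ctr, Machine.pushScalar, Machine.pushID,
          Machine.pushMsg, Machine.tick, Ctr.pushS, Ctr.pushI, Ctr.pushM]) o ho
      simp only [Machine.pushScalar, Machine.tick, Machine.pushID, Machine.pushMsg] at this
      omega
    | ask w qu cont =>
      have hle := ((Machine.Le.refl s).tick 1).pushQuery qu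
      have := ih (some qu.kind) (hm _) (by omega) hT (getElem?_of_prefix hle.runs hr) hcur
        (fun K hK => (hl K hK).mono hle)
        (by rw [Machine.ctr_pushQuery, hc]; rfl) o ho
      simp only [Machine.clock_pushQuery, Machine.tick] at this
      omega
  | reply b p ih =>
    obtain ⟨m, hm, hmn⟩ := hp
    intro o ho
    simp only [compile, Prog.exec, hr] at ho
    cases cur with
    | forge w id m' σ => exact Prog.timeLE_pure (by omega) o ho
    | ask w qu cont =>
      simp only at ho
      split at ho
      · rename_i x _
        -- Resuming the adversary charges the work of its next message at once; `T₁` is what remains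
        -- for the messages after it.
        obtain ⟨T₁, hT₁, hrest⟩ := (hcur x).exists_restIn
        have hle := ((Machine.Le.refl s).tick (k + 1)).pushRun (cont x)
        have := ih hm (by omega) (T' := T₁) (by omega) (r := c.r) (cur := cont x)
          (by simp [hc, Machine.ctr, Machine.pushRun, Machine.tick]) hrest
          (fun K hK => (hl K hK).mono hle)
          (by simp [hc, Machine.ctr, Machine.pushRun, Machine.tick, Ctr.pushR]) o ho
        simp only [Machine.pushRun, Machine.tick] at this
        omega
      · exact Prog.timeLE_pure (by omega) o ho

theorem finish_timeLE (i₁ i₂ i₃ : ℕ) (s : Machine q t k ID M G) :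
    (finish i₁ i₂ i₃ : Closure q t k).TimeLE A s 8 := by
  intro s' _ j₁ j₂ j₃ o ho
  simp only [finish, Prog.exec, Machine.pushScalar, Machine.tick] at ho
  simp only [PMF.support_pure, Set.mem_singleton_iff] at ho
  rw [ho]

/-- One unit for the fresh scalar, `N` for the instructions, `T` for the adversary and `8` for
`finish`. A second run stores no closure that could rewind again. -/
theorem rewind_timeLE {N T : ℕ} (p : Run q t k) (r : ℕ) (ρ : Ren) (n : ℕ)
    (s : Machine q t k ID M G) (cur : Strategy q t k ID M G) (hp : p.CostLE N)
    (hr : s.runs[r]? = some cur) (hT : cur.RestIn T) :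
    (rewind p r ρ n).TimeLE A s (N + T + 9) := by
  intro s' hs' i₁ i₂ i₃ o ho
  simp only [rewind, Prog.exec, PMF.mem_support_bind_iff] at ho
  obtain ⟨x, -, ho⟩ := ho
  have hle := hs'.trans (((Machine.Le.refl s').tick 1).pushScalar x)
  have := Run.timeLE_compile (A := A) (N := N) (T := T) (D := 8)
    (snap := fun _ _ _ _ => failClosure)
    (fun _ _ _ _ s _ _ _ _ => failClosure_timeLE s _) p hp le_rfl le_rfl
    (s := (s'.tick 1).pushScalar x) (r := r) (ρ := ρ.pushS s'.ctr) (c := s'.ctr.pushS)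
    (l := List.replicate n failClosure ++ [finish i₁ i₂ i₃])
    (getElem?_of_prefix hle.runs hr) hT
    (fun K hK => by
      rcases List.mem_append.1 hK with hK | hK
      · rw [List.eq_of_mem_replicate hK]
        exact failClosure_timeLE _ _
      · rw [List.mem_singleton.1 hK]
        exact finish_timeLE _ _ _ _)
    (by simp [Machine.ctr, Machine.pushScalar, Machine.tick, Ctr.pushS]) o ho
  simp only [Machine.pushScalar, Machine.tick] at this
  omega

/-- The running time of a program with rewinding. -/
theorem Run.timeLE_compile_rewind {N T : ℕ} (p : Run q t k) (hp : p.CostLE N)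
    {s : Machine q t k ID M G} {r : ℕ} {ρ : Ren} {c : Ctr} {cur : Strategy q t k ID M G}
    (hr : s.runs[r]? = some cur) {T' : ℕ} (hT : T' ≤ T) (hcur : cur.RestIn T') (hc : c = s.ctr) :
    (p.compile rewind r [] ρ c).TimeLE A s (N + T' + (N + T + 9)) :=
  Run.timeLE_compile (fun p r ρ n s cur => rewind_timeLE p r ρ n s cur) p hp le_rfl hT hr hcur
    (by simp) hc

end Time

/-! ## The experiment with a guessed target -/

/-! ### Expectations and invariants of stateful random computations -/

section Wp

variable {q t k : ℕ} {ID M G : Type} {α β : Type}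

/-- The expectation of a function of the result and of the final state. -/
def wp (m : Game q t k ID M G α) (st : GameState q t k ID M G)
    (f : α → GameState q t k ID M G → ℝ≥0∞) : ℝ≥0∞ :=
  expect (m.run st) fun x => f x.1 x.2

/-- All possible results and final states satisfy `R`. -/
def Post (m : Game q t k ID M G α) (st : GameState q t k ID M G)
    (R : α → GameState q t k ID M G → Prop) : Prop :=
  ∀ x ∈ (m.run st).support, R x.1 x.2

variable {st : GameState q t k ID M G} {f f' : α → GameState q t k ID M G → ℝ≥0∞}

@[simp] theorem wp_pure (a : α) : wp (pure a) st f = f a st := by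
  simp only [wp, StateT.run_pure]
  exact expect_pure _ _

@[simp] theorem wp_bind (m : Game q t k ID M G β) (r : β → Game q t k ID M G α) :
    wp (m >>= r) st f = wp m st fun a st' => wp (r a) st' f := by
  simp only [wp, StateT.run_bind]
  exact expect_bind _ _ _

@[simp] theorem wp_map (m : Game q t k ID M G β) (r : β → α) :
    wp (r <$> m) st f = wp m st fun a => f (r a) := by
  rw [map_eq_pure_bind, wp_bind]
  simp only [wp_pure]

@[simp] theorem wp_get (f : GameState q t k ID M G → GameState q t k ID M G → ℝ≥0∞) :
    wp get st f = f st st := by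
  simp only [wp, StateT.run_get]
  exact expect_pure _ _

@[simp] theorem wp_set (st' : GameState q t k ID M G)
    (f : PUnit → GameState q t k ID M G → ℝ≥0∞) : wp (set st') st f = f ⟨⟩ st' := by
  simp only [wp, StateT.run_set]
  exact expect_pure _ _

@[simp] theorem wp_modify (h : GameState q t k ID M G → GameState q t k ID M G)
    (f : PUnit → GameState q t k ID M G → ℝ≥0∞) :
    wp (modify h : Game q t k ID M G PUnit) st f = f ⟨⟩ (h st) := by
  simp only [wp, StateT.run_modify]
  exact expect_pure _ _

theorem wp_lift (p : PMF α) : wp (StateT.lift p) st f = expect p fun a => f a st := by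
  have : (StateT.lift p : Game q t k ID M G α).run st = p.bind fun a => PMF.pure (a, st) := rfl
  simp [wp, this, expect_bind]

@[simp] theorem wp_sample (S : Type) [Fintype S] [Nonempty S]
    (f : S → GameState q t k ID M G → ℝ≥0∞) :
    wp (sample S) st f = expect (PMF.uniformOfFintype S) fun a => f a st :=
  wp_lift _

theorem wp_mono_post {m : Game q t k ID M G α} {R : α → GameState q t k ID M G → Prop}
    (hm : Post m st R) (h : ∀ a st', R a st' → f a st' ≤ f' a st') : wp m st f ≤ wp m st f' :=
  expect_mono_support fun x hx => h _ _ (hm x hx)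

theorem wp_congr_post {m : Game q t k ID M G α} {R : α → GameState q t k ID M G → Prop}
    (hm : Post m st R) (h : ∀ a st', R a st' → f a st' = f' a st') : wp m st f = wp m st f' :=
  expect_congr_support fun x hx => h _ _ (hm x hx)

theorem wp_mono {m : Game q t k ID M G α} (h : ∀ a st', f a st' ≤ f' a st') :
    wp m st f ≤ wp m st f' :=
  expect_mono fun _ => h _ _

theorem wp_sum {ι : Type} (s : Finset ι) (m : Game q t k ID M G α)
    (f : ι → α → GameState q t k ID M G → ℝ≥0∞) :
    wp m st (fun a st' => ∑ i ∈ s, f i a st') = ∑ i ∈ s, wp m st (f i) :=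
  expect_sum s (m.run st) fun i (x : α × GameState q t k ID M G) => f i x.1 x.2

theorem expect_wp (p : PMF β) (m : Game q t k ID M G α)
    (f : β → α → GameState q t k ID M G → ℝ≥0∞) :
    (expect p fun b => wp m st (f b)) = wp m st fun a st' => expect p fun b => f b a st' :=
  expect_comm _ _ _

theorem wp_le_one {m : Game q t k ID M G α} (h : ∀ a st', f a st' ≤ 1) : wp m st f ≤ 1 :=
  expect_le_one fun _ => h _ _

theorem Post.mono {m : Game q t k ID M G α} {R R' : α → GameState q t k ID M G → Prop}
    (hm : Post m st R) (h : ∀ a st', R a st' → R' a st') : Post m st R' :=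
  fun x hx => h _ _ (hm x hx)

theorem Post.pure {a : α} {R : α → GameState q t k ID M G → Prop} (h : R a st) :
    Post (Pure.pure a) st R := by
  intro x hx
  rw [StateT.run_pure] at hx
  rw [(PMF.mem_support_pure_iff _ _).1 hx]
  exact h

theorem Post.bind {m : Game q t k ID M G β} {r : β → Game q t k ID M G α}
    {R : α → GameState q t k ID M G → Prop}
    (h : Post m st fun b st' => Post (r b) st' R) : Post (m >>= r) st R := by
  intro x hx
  rw [StateT.run_bind] at hx
  obtain ⟨y, hy, hx⟩ := (PMF.mem_support_bind_iff _ _ _).1 hx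
  exact h y hy x hx

theorem Post.get {R : GameState q t k ID M G → GameState q t k ID M G → Prop} (h : R st st) :
    Post MonadState.get st R := by
  intro x hx
  rw [StateT.run_get] at hx
  rw [(PMF.mem_support_pure_iff _ _).1 hx]
  exact h

theorem Post.set {st' : GameState q t k ID M G}
    {R : PUnit → GameState q t k ID M G → Prop} (h : R ⟨⟩ st') :
    Post (MonadStateOf.set st' : Game q t k ID M G PUnit) st R := by
  intro x hx
  rw [StateT.run_set] at hx
  rw [(PMF.mem_support_pure_iff _ _).1 hx]
  exact h

theorem Post.modify {r : GameState q t k ID M G → GameState q t k ID M G}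
    {R : PUnit → GameState q t k ID M G → Prop} (h : R ⟨⟩ (r st)) :
    Post (_root_.modify r : Game q t k ID M G PUnit) st R := by
  intro x hx
  rw [StateT.run_modify] at hx
  rw [(PMF.mem_support_pure_iff _ _).1 hx]
  exact h

theorem Post.sample {S : Type} [Fintype S] [Nonempty S]
    {R : S → GameState q t k ID M G → Prop} (h : ∀ a, R a st) : Post (SchnorrCL.sample S) st R := by
  intro x hx
  obtain ⟨y, -, hx⟩ := (PMF.mem_support_bind_iff _ _ _).1 hx
  rw [(PMF.mem_support_pure_iff _ _).1 hx]
  exact h y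

end Wp

/-! ### From the experiment to a fixed target with prescribed `β` -/

section Hybrid

variable {q t k : ℕ} [Fact q.Prime] [NeZero t] {ID M G : Type} [DecidableEq ID] [DecidableEq M]
  [AddCommGroup G] [DecidableEq G]

def GameState.setH1 (st : GameState q t k ID M G) (id : ID) (Q : G) (j : Fin k → Fin t) :
    GameState q t k ID M G :=
  { st with
    tableH1 := Function.update st.tableH1 id (Function.update (st.tableH1 id) Q (some j)) }

def GameState.setH5 (st : GameState q t k ID M G) (m : M) (R : G) (e : ZMod q) :
    GameState q t k ID M G :=
  { st with
    tableH5 := Function.update st.tableH5 m (Function.update (st.tableH5 m) R (some e)) }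

def GameState.addUser (st : GameState q t k ID M G) (id : ID) (u : User q G) :
    GameState q t k ID M G :=
  { st with users := Function.update st.users id (some u) }

theorem wp_hash1 (id : ID) (Q : G) (st : GameState q t k ID M G)
    (f : (Fin k → Fin t) → GameState q t k ID M G → ℝ≥0∞) :
    wp (hash1 id Q) st f = match st.tableH1 id Q with
      | some j => f j st
      | none => expect (PMF.uniformOfFintype (Fin k → Fin t)) fun j => f j (st.setH1 id Q j) := by
  simp only [hash1, wp_bind, wp_get]
  cases st.tableH1 id Q <;> simp [GameState.setH1]

theorem wp_hash5 (m : M) (R : G) (st : GameState q t k ID M G)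
    (f : ZMod q → GameState q t k ID M G → ℝ≥0∞) :
    wp (hash5 m R) st f = match st.tableH5 m R with
      | some e => f e st
      | none => expect (PMF.uniformOfFintype (ZMod q)) fun e => f e (st.setH5 m R e) := by
  simp only [hash5, wp_bind, wp_get]
  cases st.tableH5 m R <;> simp [GameState.setH5]

theorem post_hash1 (id : ID) (Q : G) (st : GameState q t k ID M G) :
    Post (hash1 id Q) st fun _ st' => ∃ T, st' = { st with tableH1 := T } := by
  refine Post.bind (Post.get ?_)
  split
  · exact Post.pure ⟨_, rfl⟩
  · exact Post.bind (Post.sample fun j => Post.bind (Post.set (Post.pure ⟨_, rfl⟩)))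

theorem post_hash5 (m : M) (R : G) (st : GameState q t k ID M G) :
    Post (hash5 m R) st fun _ st' => ∃ T, st' = { st with tableH5 := T } := by
  refine Post.bind (Post.get ?_)
  split
  · exact Post.pure ⟨_, rfl⟩
  · exact Post.bind (Post.sample fun j => Post.bind (Post.set (Post.pure ⟨_, rfl⟩)))

/-- The secret value of a user. -/
def secretLaw (S : Scheme) : PMF (ZMod q) :=
  match S with
  | .certificateless => PMF.uniformOfFintype (ZMod q)
  | .identityBased => PMF.pure 0

/-- The law of the scalar `β` of a user, unless it is prescribed. -/
def betaLaw (o : Option (ZMod q)) : PMF (ZMod q) :=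
  match o with
  | some a => PMF.pure a
  | none => PMF.uniformOfFintype (ZMod q)

/-- The keys of both schemes in a uniform description. -/
def honestUser (P : G) (v : Fin t → ZMod q) (α β : ZMod q) (j : Fin k → Fin t) : User q G where
  α := α
  U := smulPt α P
  w := ∑ i, v (j i) + β
  Q := smulPt α P + smulPt β P
  x := some (∑ i, v (j i) + β + α)

/-- The keys of `id`, where the scalar `β` may be prescribed. -/
def userWith (S : Scheme) (P : G) (v : Fin t → ZMod q) (o : Option (ZMod q)) (id : ID) :
    Game q t k ID M G (User q G) := do
  let st ← get
  match st.users id with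
  | some u => pure u
  | none =>
    let α ← StateT.lift (secretLaw S)
    let β ← StateT.lift (betaLaw o)
    let j ← hash1 id (smulPt α P + smulPt β P)
    modify fun st' => st'.addUser id (honestUser P v α β j)
    pure (honestUser P v α β j)

theorem wp_userWith (S : Scheme) (P : G) (v : Fin t → ZMod q) (o : Option (ZMod q)) (id : ID)
    (st : GameState q t k ID M G) (f : User q G → GameState q t k ID M G → ℝ≥0∞) :
    wp (userWith S P v o id) st f = match st.users id with
      | some u => f u st
      | none => expect (secretLaw S) fun α => expect (betaLaw o) fun β =>
          wp (hash1 id (smulPt α P + smulPt β P)) st fun j st' =>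
            f (honestUser P v α β j) (st'.addUser id (honestUser P v α β j)) := by
  simp only [userWith, wp_bind, wp_get]
  cases st.users id <;> simp [wp_lift]

theorem post_userWith (S : Scheme) (P : G) (v : Fin t → ZMod q) (o : Option (ZMod q)) (id : ID)
    (st : GameState q t k ID M G) :
    Post (userWith S P v o id) st fun u st' =>
      ∃ T, st' = { st with tableH1 := T, users := Function.update st.users id (some u) } := by
  refine Post.bind (Post.get ?_)
  split
  · rename_i u hu
    refine Post.pure ⟨st.tableH1, ?_⟩
    rw [← hu, Function.update_eq_self]
  · refine Post.bind ?_
    intro x hx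
    obtain ⟨y, -, hx⟩ := (PMF.mem_support_bind_iff _ _ _).1 hx
    rw [(PMF.mem_support_pure_iff _ _).1 hx]
    refine Post.bind ?_
    intro x hx
    obtain ⟨y, -, hx⟩ := (PMF.mem_support_bind_iff _ _ _).1 hx
    rw [(PMF.mem_support_pure_iff _ _).1 hx]
    refine Post.bind ((post_hash1 _ _ _).mono ?_)
    rintro j _ ⟨T, rfl⟩
    exact Post.bind (Post.modify (Post.pure ⟨T, rfl⟩))

theorem smulPt_sum {X : G} (hX : q • X = 0) {ι : Type} (s : Finset ι) (c : ι → ZMod q) :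
    smulPt (∑ i ∈ s, c i) X = ∑ i ∈ s, smulPt (c i) X := by
  classical
  induction s using Finset.induction_on with
  | empty => simp [smulPt_zero]
  | insert i s hi ih => rw [Finset.sum_insert hi, Finset.sum_insert hi, smulPt_add hX, ih]

/-- The identity-based scheme is the case `α = 0`. In the certificateless scheme the check of the
partial key always succeeds, because `Q - U = βP = wP - Y`, so no honest private key is `⊥`. -/
theorem wp_userKeys {P : G} (hP : q • P = 0) (S : Scheme) (v : Fin t → ZMod q) (id : ID)
    (st : GameState q t k ID M G) (f : User q G → GameState q t k ID M G → ℝ≥0∞) :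
    wp (userKeys P v id S) st f =
      expect (secretLaw S) fun α => expect (betaLaw none) fun β =>
        wp (hash1 id (smulPt α P + smulPt β P)) st fun j st' => f (honestUser P v α β j) st' := by
  cases S with
  | identityBased =>
    simp [userKeys, extract, secretLaw, betaLaw, honestUser, smulPt_zero]
  | certificateless =>
    simp only [userKeys, userSetup, partKeyGen, userKeyGen, wp_bind, wp_sample, wp_pure, secretLaw,
      betaLaw]
    congr 1
    funext α
    congr 1
    funext β
    have hcheck : ∀ j : Fin k → Fin t, smulPt α P + smulPt β P - smulPt α P =
        smulPt (∑ i, v (j i) + β) P - ∑ i, masterPublicKey P v (j i) := fun j => by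
      simp only [masterPublicKey, ← smulPt_sum hP, smulPt_add hP]
      abel
    rw [wp_hash1, wp_hash1]
    cases h : st.tableH1 id (smulPt α P + smulPt β P) with
    | some j =>
      simp only [wp_hash1, h, ← hcheck, if_true, wp_pure]
      rfl
    | none =>
      simp only [wp_hash1]
      congr 1
      funext j
      -- The user hashes the same pair as the key centre and finds the entry that was just made.
      have h' : (st.setH1 id (smulPt α P + smulPt β P) j).tableH1 id (smulPt α P + smulPt β P) =
        some j := by simp [GameState.setH1]
      simp only [h', ← hcheck, if_true, wp_pure]
      rfl

theorem wp_user {P : G} (hP : q • P = 0) (S : Scheme) (v : Fin t → ZMod q) (id : ID)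
    (st : GameState q t k ID M G) (f : User q G → GameState q t k ID M G → ℝ≥0∞) :
    wp (user S P v id) st f = wp (userWith S P v none id) st f := by
  rw [wp_userWith]
  simp only [user, wp_bind, wp_get]
  cases st.users id with
  | some u => simp
  | none =>
    simp only [wp_bind, wp_userKeys hP, wp_modify, wp_pure]
    rfl

/-- The oracles of the adversary, where the scalar `β` of a new user may be prescribed. -/
def oracleWith (S : Scheme) (P : G) (v : Fin t → ZMod q) (o : Option (ZMod q)) :
    (c : Query ID M G) → Game q t k ID M G (c.Answer q t k)
  | .h1 id Q => hash1 id Q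
  | .h5 m R => hash5 m R
  | .pubKey id => do
    let u ← userWith S P v o id
    pure (u.U, u.Q)
  | .partKey id => do
    let u ← userWith S P v o id
    modify fun st => { st with partKeyed := id :: st.partKeyed }
    pure (u.w, u.Q)
  | .secKey id => do
    let u ← userWith S P v o id
    pure u.α
  | .corrupt id => do
    let u ← userWith S P v o id
    modify fun st => { st with corrupted := id :: st.corrupted }
    pure u.x
  | .sign id m => do
    let u ← userWith S P v o id
    modify fun st => { st with signed := (id, m) :: st.signed }
    match u.x with
    | some x => do
      let σ ← sign P m x
      pure (some σ)
    | none => pure none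

/-- The end of the experiment. -/
def finale (S : Scheme) (P : G) (v : Fin t → ZMod q) (o : Option (ZMod q)) (id : ID) (m : M)
    (σ : ZMod q × ZMod q) : Game q t k ID M G Bool := do
  let u ← userWith S P v o id
  let valid ← verify P (masterPublicKey P v) m id u.Q σ
  let st ← get
  pure (valid && decide (id ∉ st.corrupted) && decide (id ∉ st.partKeyed)
    && decide ((id, m) ∉ st.signed))

theorem wp_oracle {P : G} (hP : q • P = 0) (S : Scheme) (v : Fin t → ZMod q) (c : Query ID M G)
    (st : GameState q t k ID M G) (f : c.Answer q t k → GameState q t k ID M G → ℝ≥0∞) :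
    wp (oracle S P v c) st f = wp (oracleWith S P v none c) st f := by
  cases c
  · rfl
  · rfl
  all_goals
    rw [oracle, oracleWith, wp_bind, wp_user hP, wp_bind]
    try rfl

/-- The identity whose keys a query needs. -/
def Query.ident : Query ID M G → Option ID
  | .h1 _ _ => none
  | .h5 _ _ => none
  | .pubKey id => some id
  | .partKey id => some id
  | .secKey id => some id
  | .corrupt id => some id
  | .sign id _ => some id

/-- The identities of the users in the order of their creation, after the keys of an identity have
been needed. -/
def created (st : GameState q t k ID M G) (ord : List ID) : Option ID → List ID
  | some id => if st.users id = none then ord ++ [id] else ord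
  | none => ord

/-- The probability that the rest of the experiment is won with the user number `g` as the target,
where the scalar `β` of this user may be prescribed. -/
def winWith (S : Scheme) (P : G) (v : Fin t → ZMod q) (g : ℕ) (o : Option (ZMod q)) :
    Strategy q t k ID M G → GameState q t k ID M G → List ID → ℝ≥0∞
  | .forge _ id m σ, st, ord =>
    wp (finale S P v (if ord.length = g then o else none) id m σ) st fun b _ =>
      if b ∧ (created st ord (some id))[g]? = some id then 1 else 0
  | .ask _ c next, st, ord =>
    wp (oracleWith S P v (if ord.length = g then o else none) c) st fun r st' =>
      winWith S P v g o (next r) st' (created st ord c.ident)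

theorem winWith_le_one (S : Scheme) (P : G) (v : Fin t → ZMod q) (g : ℕ) (o : Option (ZMod q))
    (σ : Strategy q t k ID M G) (st : GameState q t k ID M G) (ord : List ID) :
    winWith S P v g o σ st ord ≤ 1 := by
  induction σ generalizing st ord with
  | forge =>
    refine wp_le_one fun _ _ => ?_
    split_ifs <;> simp
  | ask w c next ih => exact wp_le_one fun r st' => ih r st' _

/-- These are the only facts about arbitrary oracle calls that the hybrid argument needs: a new user
is always the one that the query names, and the two forbidden lists only grow. -/
theorem post_oracleWith (S : Scheme) (P : G) (v : Fin t → ZMod q) (o : Option (ZMod q))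
    (c : Query ID M G) (st : GameState q t k ID M G) :
    Post (oracleWith S P v o c) st fun _ st' =>
      (∀ id, st'.users id ≠ none → st.users id ≠ none ∨ c.ident = some id) ∧
      (∀ id ∈ st.corrupted, id ∈ st'.corrupted) ∧ (∀ id ∈ st.partKeyed, id ∈ st'.partKeyed) := by
  have hu : ∀ (id : ID) (u : User q G), ∀ i, Function.update st.users id (some u) i ≠ none →
      st.users i ≠ none ∨ some id = some i := fun id u i hi => by
    by_cases h : i = id
    · exact Or.inr (by rw [h])
    · rw [Function.update_of_ne h] at hi
      exact Or.inl hi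
  cases c with
  | h1 id Q =>
    refine (post_hash1 _ _ _).mono ?_
    rintro j _ ⟨T, rfl⟩
    exact ⟨fun _ h => Or.inl h, fun _ h => h, fun _ h => h⟩
  | h5 m R =>
    refine (post_hash5 _ _ _).mono ?_
    rintro j _ ⟨T, rfl⟩
    exact ⟨fun _ h => Or.inl h, fun _ h => h, fun _ h => h⟩
  | sign id m =>
    refine Post.bind ((post_userWith _ _ _ _ _ _).mono ?_)
    rintro u _ ⟨T, rfl⟩
    refine Post.bind (Post.modify ?_)
    split
    · refine Post.bind (Post.bind (Post.sample fun r => Post.bind ((post_hash5 _ _ _).mono ?_)))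
      rintro e _ ⟨T', rfl⟩
      exact Post.pure (Post.pure ⟨hu id u, fun _ h => h, fun _ h => h⟩)
    · exact Post.pure ⟨hu id u, fun _ h => h, fun _ h => h⟩
  | pubKey id =>
    refine Post.bind ((post_userWith _ _ _ _ _ _).mono ?_)
    rintro u _ ⟨T, rfl⟩
    exact Post.pure ⟨hu id u, fun _ h => h, fun _ h => h⟩
  | secKey id =>
    refine Post.bind ((post_userWith _ _ _ _ _ _).mono ?_)
    rintro u _ ⟨T, rfl⟩
    exact Post.pure ⟨hu id u, fun _ h => h, fun _ h => h⟩
  | partKey id =>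
    refine Post.bind ((post_userWith _ _ _ _ _ _).mono ?_)
    rintro u _ ⟨T, rfl⟩
    exact Post.bind (Post.modify (Post.pure
      ⟨hu id u, fun _ h => h, fun _ h => List.mem_cons_of_mem _ h⟩))
  | corrupt id =>
    refine Post.bind ((post_userWith _ _ _ _ _ _).mono ?_)
    rintro u _ ⟨T, rfl⟩
    exact Post.bind (Post.modify (Post.pure
      ⟨hu id u, fun _ h => List.mem_cons_of_mem _ h, fun _ h => h⟩))

theorem getElem?_created {st : GameState q t k ID M G} {ord : List ID} {i : Option ID} {g : ℕ}
    {id : ID} (h : ord[g]? = some id) : (created st ord i)[g]? = some id := by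
  cases i with
  | none => exact h
  | some i =>
    simp only [created]
    split_ifs
    · exact getElem?_of_prefix (List.prefix_append _ _) h
    · exact h

/-- The experiment is lost after the private key of the target has been delivered. -/
theorem winWith_eq_zero (S : Scheme) (P : G) (v : Fin t → ZMod q) {g : ℕ} (o : Option (ZMod q))
    {id : ID} (σ : Strategy q t k ID M G) (st : GameState q t k ID M G) (ord : List ID)
    (h : ord[g]? = some id) (hid : id ∈ st.corrupted ∨ id ∈ st.partKeyed) :
    winWith S P v g o σ st ord = 0 := by
  induction σ generalizing st ord with
  | forge w i m σ =>
    rw [winWith, getElem?_created h]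
    simp only [finale, wp_bind]
    -- Key generation touches only the table of `H₁` and the users, and verification only the two
    -- tables. The forbidden lists at the final test are therefore those of `st`.
    have : ∀ (f f' : User q G → GameState q t k ID M G → ℝ≥0∞) o', (∀ u T U,
        f u { st with tableH1 := T, users := U } = f' u { st with tableH1 := T, users := U }) →
        wp (userWith S P v o' i) st f = wp (userWith S P v o' i) st f' := by
      intro f f' o' hf
      refine wp_congr_post (post_userWith S P v o' i st) ?_
      rintro u _ ⟨T, rfl⟩
      exact hf _ _ _
    rw [this _ (fun _ _ => 0)]
    · simp [wp]
    · intro u T₀ U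
      have h0 : ∀ T T' U b, wp (pure (b && decide (i ∉ st.corrupted) && decide (i ∉ st.partKeyed)
          && decide ((i, m) ∉ st.signed)) : Game q t k ID M G Bool)
          { st with tableH1 := T, tableH5 := T', users := U }
          (fun b _ => if b = true ∧ some id = some i then (1 : ℝ≥0∞) else 0) = 0 := by
        intro T T' U b
        rw [wp_pure, if_neg]
        rintro ⟨hb, hi⟩
        cases hi
        simp only [Bool.and_eq_true, decide_eq_true_eq] at hb
        rcases hid with hid | hid
        · exact hb.1.1.2 hid
        · exact hb.1.2 hid
      simp only [verify, wp_bind]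
      rw [wp_congr_post (f' := fun _ _ => 0) (post_hash1 _ _ _)]
      · simp [wp]
      · rintro j _ ⟨T, rfl⟩
        rw [wp_congr_post (f' := fun _ _ => 0) (post_hash5 _ _ _)]
        · simp [wp]
        · rintro e _ ⟨T', rfl⟩
          simp only [wp_pure, wp_get]
          simpa only [wp_pure] using h0 T T' U _
  | ask w c next ih =>
    rw [winWith, wp_congr_post (f' := fun _ _ => 0) (post_oracleWith _ _ _ _ _ _)]
    · simp [wp]
    · rintro r st' ⟨-, h1, h2⟩
      exact ih r st' _ (getElem?_created h) (hid.imp (h1 id) (h2 id))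

/-- The probability that the rest of the experiment is won. -/
def win (S : Scheme) (P : G) (v : Fin t → ZMod q) (σ : Strategy q t k ID M G)
    (st : GameState q t k ID M G) : ℝ≥0∞ :=
  wp (play S P v σ) st fun y st' =>
    wp (finale S P v none y.1 y.2.1 y.2.2) st' fun b _ => if b then 1 else 0

/-- The guess of the target. -/
theorem win_le_sum {P : G} (hP : q • P = 0) (S : Scheme) (v : Fin t → ZMod q) (N : ℕ)
    (σ : Strategy q t k ID M G) (st : GameState q t k ID M G) (ord : List ID) (B : OracleKind → ℕ)
    (hB : σ.QueriesWithin B) (hord : ∀ id, st.users id ≠ none → id ∈ ord)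
    (hN : ord.length + identityBound B ≤ N) :
    win S P v σ st ≤ ∑ g ∈ Finset.range N, winWith S P v g none σ st ord := by
  induction σ generalizing st ord B with
  | forge w id m σ =>
    simp only [win, play, wp_pure, winWith, ite_self]
    rw [← wp_sum]
    refine wp_mono fun b st' => ?_
    -- The identity of the forgery has been created by the end of the experiment, so it has a
    -- number, and the guess of this number gives a winning summand.
    have hmem : id ∈ created st ord (some id) := by
      simp only [created]
      split_ifs with h
      · simp
      · exact hord id h
    obtain ⟨g, hg⟩ := List.mem_iff_getElem?.1 hmem
    have hgN : g < N := by
      have h1 := (List.getElem?_eq_some_iff.1 hg).1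
      have h2 : (created st ord (some id)).length ≤ ord.length + 1 := by
        simp only [created]
        split_ifs <;> simp
      simp only [identityBound] at hN
      omega
    refine le_trans ?_ (Finset.single_le_sum (f := fun g =>
      if b = true ∧ (created st ord (some id))[g]? = some id then (1 : ℝ≥0∞) else 0)
      (fun _ _ => zero_le) (Finset.mem_range.2 hgN))
    simp [hg]
  | ask w c next ih =>
    simp only [win, play, wp_bind, wp_oracle hP, winWith, ite_self] at ih ⊢
    rw [← wp_sum]
    refine wp_mono_post (post_oracleWith _ _ _ _ _ _) ?_
    rintro r st' ⟨h1, -, -⟩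
    refine ih r st' _ _ (hB.2 r) ?_ ?_
    · intro id hid
      rcases h1 id hid with h | h
      · have := hord id h
        cases c.ident with
        | none => exact this
        | some i =>
          simp only [created]
          split_ifs <;> simp [this]
      · rw [h]
        simp only [created]
        split_ifs with h'
        · simp
        · exact hord id h'
    · have h0 := hB.1
      refine le_trans ?_ hN
      have hlen : ∀ i, (created st ord i).length ≤ ord.length + 1 := fun i => by
        cases i with
        | none => simp [created]
        | some i =>
          simp only [created]
          split_ifs <;> simp
      have := hlen c.ident
      -- A query that may create a user uses up one unit of `identityBound`; the hash queries change
      -- neither side.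
      cases c <;> simp [identityBound, Query.kind, Query.ident, created] at h0 this ⊢ <;> omega

/-- The prescribed scalar is used only while exactly `g` users exist, and their number never
decreases. -/
theorem winWith_of_lt (S : Scheme) (P : G) (v : Fin t → ZMod q) {g : ℕ} (o : Option (ZMod q))
    (σ : Strategy q t k ID M G) (st : GameState q t k ID M G) (ord : List ID)
    (h : g < ord.length) : winWith S P v g o σ st ord = winWith S P v g none σ st ord := by
  induction σ generalizing st ord with
  | forge w i m σ => simp only [winWith, h.ne', if_false]
  | ask w c next ih =>
    simp only [winWith, h.ne', if_false]
    congr 1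
    funext r st'
    refine ih r st' _ (h.trans_le ?_)
    cases c.ident with
    | none => exact le_rfl
    | some i =>
      simp only [created]
      split_ifs <;> simp

theorem wp_userWith_of_some (S : Scheme) (P : G) (v : Fin t → ZMod q) (o : Option (ZMod q))
    {id : ID} {st : GameState q t k ID M G} (h : st.users id ≠ none)
    (f : User q G → GameState q t k ID M G → ℝ≥0∞) :
    wp (userWith S P v o id) st f = wp (userWith S P v none id) st f := by
  rw [wp_userWith, wp_userWith]
  cases hu : st.users id with
  | none => exact absurd hu h
  | some u => rfl

/-- A uniform prescribed scalar is the honest draw of `β`; only the order relative to the draw of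
`α` changes. -/
theorem expect_wp_userWith (S : Scheme) (P : G) (v : Fin t → ZMod q)
    {id : ID} {st : GameState q t k ID M G} (h : st.users id = none)
    (f : User q G → GameState q t k ID M G → ℝ≥0∞) :
    (expect (PMF.uniformOfFintype (ZMod q)) fun a => wp (userWith S P v (some a) id) st f) =
      wp (userWith S P v none id) st f := by
  simp only [wp_userWith, h, betaLaw, expect_pure]
  rw [expect_comm]

theorem wp_oracleWith_of_some (S : Scheme) (P : G) (v : Fin t → ZMod q) (o : Option (ZMod q))
    {c : Query ID M G} {st : GameState q t k ID M G} (h : ∀ id, c.ident = some id → st.users id ≠ none)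
    (f : c.Answer q t k → GameState q t k ID M G → ℝ≥0∞) :
    wp (oracleWith S P v o c) st f = wp (oracleWith S P v none c) st f := by
  cases c
  · rfl
  · rfl
  all_goals
    rw [oracleWith, oracleWith, wp_bind, wp_bind, wp_userWith_of_some S P v o (h _ rfl)]

theorem expect_wp_oracleWith (S : Scheme) (P : G) (v : Fin t → ZMod q)
    {c : Query ID M G} {st : GameState q t k ID M G} {id : ID} (hc : c.ident = some id)
    (h : st.users id = none) (f : c.Answer q t k → GameState q t k ID M G → ℝ≥0∞) :
    (expect (PMF.uniformOfFintype (ZMod q)) fun a => wp (oracleWith S P v (some a) c) st f) =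
      wp (oracleWith S P v none c) st f := by
  cases c <;> cases hc
  all_goals
    simp only [oracleWith, wp_bind (userWith S P v _ id)]
    rw [expect_wp_userWith S P v h]

/-- The scalar `β` of the target may be drawn at the beginning. -/
theorem expect_winWith (S : Scheme) (P : G) (v : Fin t → ZMod q) {g : ℕ}
    (σ : Strategy q t k ID M G) (st : GameState q t k ID M G) (ord : List ID)
    (h : ord.length ≤ g) :
    (expect (PMF.uniformOfFintype (ZMod q)) fun a => winWith S P v g (some a) σ st ord) =
      winWith S P v g none σ st ord := by
  induction σ generalizing st ord with
  | forge w id m σ =>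
    simp only [winWith, ite_self]
    split_ifs with hg
    · simp only [finale, wp_bind (userWith S P v _ id)]
      cases hu : st.users id with
      | none => rw [expect_wp_userWith S P v hu]
      | some u => simp [wp_userWith, hu]
    · simp
  | ask w c next ih =>
    simp only [winWith, ite_self]
    -- An oracle call that does not use the prescribed scalar commutes with its draw.
    have step : ∀ o, (created st ord c.ident).length ≤ g →
        (expect (PMF.uniformOfFintype (ZMod q)) fun a => wp (oracleWith S P v o c) st fun r st' =>
          winWith S P v g (some a) (next r) st' (created st ord c.ident)) =
        wp (oracleWith S P v o c) st fun r st' =>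
          winWith S P v g none (next r) st' (created st ord c.ident) := by
      intro o hlen
      rw [expect_wp]
      congr 1
      funext r st'
      exact ih r st' _ hlen
    by_cases hnew : ∃ id, c.ident = some id ∧ st.users id = none
    · obtain ⟨id, hc, hu⟩ := hnew
      have hlen : (created st ord c.ident).length = ord.length + 1 := by
        rw [hc]
        simp [created, hu]
      split_ifs with hg
      -- This query creates the target. The prescribed scalar is used here and nowhere later, so
      -- averaging over it restores the honest oracle.
      · simp only [winWith_of_lt S P v (some _) (next _) _ (created st ord c.ident)
          (show g < _ by omega)]
        exact expect_wp_oracleWith S P v hc hu _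
      · exact step none (by omega)
    · have hold : ∀ id, c.ident = some id → st.users id ≠ none := fun id h1 h2 =>
        hnew ⟨id, h1, h2⟩
      have hlen : (created st ord c.ident).length ≤ g := by
        cases hc : c.ident with
        | none => exact h
        | some id => simpa [created, hold id hc] using h
      simp only [wp_oracleWith_of_some S P v (if _ then _ else _) hold]
      exact step none hlen

end Hybrid

/-! ## The simulator -/

/-- The registers with the keys of a user. For the target (`tgt`), the instance of the discrete
logarithm problem is part of the public key, and `w`, `x` are the parts of the private keys that are
known. -/
structure UserRegs where
  id : ℕ
  α : ℕ
  U : ℕ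
  w : ℕ
  Q : ℕ
  x : ℕ
  tgt : Bool

/-- State of the simulator: the tables of the random oracles and the users, in terms of the numbers
of registers. An entry of the table of `H₅` that comes from a `hash` node contains its number, the
other entries come from simulated signatures of the target. -/
structure SimState (t k : ℕ) where
  c : Ctr
  h1 : List (ℕ × ℕ × (Fin k → Fin t))
  h5 : List (ℕ × ℕ × ℕ × Option ℕ)
  users : List UserRegs
  d : ℕ

namespace SimState

variable {t k : ℕ}

def pushS (y : SimState t k) : SimState t k := { y with c := y.c.pushS }
def pushP (y : SimState t k) : SimState t k := { y with c := y.c.pushP }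
def pushMessage (y : SimState t k) (o : Option OracleKind) : SimState t k :=
  { y with c := y.c.pushMessage o }

end SimState

section Simulator

variable {q t k : ℕ} [NeZero t]

/-- Search for the first list element that passes a test. -/
def Run.scan {α : Type} (test : α → Run q t k → Run q t k → Run q t k) :
    List α → (α → Run q t k) → Run q t k → Run q t k
  | [], _, no => no
  | x :: l, yes, no => test x (yes x) (Run.scan test l yes no)

/-- Uniform choice of a vector. -/
def Run.branchVec : (n : ℕ) → ((Fin n → Fin t) → Run q t k) → Run q t k
  | 0, K => K Fin.elim0
  | n + 1, K => .branch (t - 1) fun i => Run.branchVec n fun f =>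
      K (Fin.cons (Fin.cast (Nat.sub_add_cancel NeZero.one_le) i) f)

/-- Add the scalars in some registers to the scalar in register `r`. -/
def simSum : List ℕ → ℕ → SimState t k → (SimState t k → ℕ → Run q t k) → Run q t k
  | [], r, y, K => K y r
  | i :: l, r, y, K => .op (.scalarOp .add r i) (simSum l y.c.s y.pushS K)

/-- Fresh values of `H₁` are ordinary coins: the fork concerns `H₅` only, and a second run may draw
other values of `H₁`. -/
def simH1 (y : SimState t k) (id Q : ℕ) (K : SimState t k → (Fin k → Fin t) → Run q t k) :
    Run q t k :=
  Run.scan (fun e yes no => .test (.id e.1 id) (.test (.pt e.2.1 Q) yes no) no) y.h1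
    (fun e => K y e.2.2) (Run.branchVec k fun j => K { y with h1 := (id, Q, j) :: y.h1 } j)

def simSearchH5 (y : SimState t k) (m R : ℕ) (yes : ℕ × ℕ × ℕ × Option ℕ → Run q t k)
    (no : Run q t k) : Run q t k :=
  Run.scan (fun e yes no => .test (.msg e.1 m) (.test (.pt e.2.1 R) yes no) no) y.h5 yes no

/-- Only an unrecorded input opens a `hash` node. Its number is stored with the entry, so that a
forgery resting on the entry can name the node to rewind. -/
def simHash (y : SimState t k) (m R : ℕ) (K : SimState t k → ℕ → Option ℕ → Run q t k) :
    Run q t k :=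
  simSearchH5 y m R (fun e => K y e.2.2.1 e.2.2.2)
    (.hash R (K { y.pushS with h5 := (m, R, y.c.s, some y.d) :: y.h5, d := y.d + 1 }
      y.c.s (some y.d)))

/-- Draw or set the secret value of a user. -/
def simSecret (S : Scheme) (y : SimState t k) (K : SimState t k → ℕ → Run q t k) : Run q t k :=
  match S with
  | .certificateless => .random (K y.pushS y.c.s)
  | .identityBased => .op (.const 0) (K y.pushS y.c.s)

/-- The known part of `β` and the point `βP`. -/
def simBeta (tgt : Bool) (y : SimState t k) (K : SimState t k → ℕ → ℕ → Run q t k) : Run q t k :=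
  if tgt then .op (.const 0) (K y.pushS y.c.s 1)
  else .random (.op (.mulPt y.c.s 0) (K y.pushS.pushP y.c.s y.c.p))

/-- Users are numbered from `0`, so the number of the new one is the present length of the list. For
the target the two last sums lack the unknown summand `a`, since the register of `β` holds `0` while
the point `W` is the challenge. -/
def simNewUser (g : ℕ) (S : Scheme) (y : SimState t k) (id : ℕ)
    (K : SimState t k → UserRegs → Run q t k) : Run q t k :=
  simSecret S y fun y α => .op (.mulPt α 0) <|
  simBeta (decide (y.users.length = g)) y.pushP fun y' β W => .op (.addPt y.c.p W) <|
  simH1 y'.pushP id y'.c.p fun y'' j => .op (.const 0) <|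
  simSum (List.ofFn fun i => (j i : ℕ)) y''.c.s y''.pushS fun z r =>
  .op (.scalarOp .add r β) <| .op (.scalarOp .add z.c.s α) <|
  let u : UserRegs :=
    ⟨id, α, y.c.p, z.c.s, y'.c.p, z.c.s + 1, decide (y.users.length = g)⟩
  K { z.pushS.pushS with users := u :: y.users } u

def simUser (g : ℕ) (S : Scheme) (y : SimState t k) (id : ℕ)
    (K : SimState t k → UserRegs → Run q t k) : Run q t k :=
  Run.scan (fun u yes no => .test (.id u.id id) yes no) y.users (fun u => K y u)
    (simNewUser g S y id K)

/-- The commitment `sP + e (xP + X)`. -/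
def simCommit (y : SimState t k) (s e x : ℕ) (K : SimState t k → ℕ → Run q t k) : Run q t k :=
  .op (.mulPt x 0) <| .op (.addPt y.c.p 1) <| .op (.mulPt s 0) <| .op (.mulPt e (y.c.p + 1)) <|
  .op (.addPt (y.c.p + 2) (y.c.p + 3)) <| K y.pushP.pushP.pushP.pushP.pushP (y.c.p + 4)

/-- The target's private key is unknown: the signature is drawn first, and its commitment receives
an entry without a node number. A collision with an existing entry makes the run fail. Other users
sign honestly. -/
def simSign (y : SimState t k) (u : UserRegs) (m : ℕ)
    (K : SimState t k → ℕ → ℕ → Run q t k) : Run q t k :=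
  if u.tgt then
    .random <| .random <| simCommit y.pushS.pushS y.c.s (y.c.s + 1) u.x fun y' R =>
    simSearchH5 y' m R (fun _ => .fail)
      (K { y' with h5 := (m, R, y.c.s + 1, none) :: y'.h5 } y.c.s (y.c.s + 1))
  else
    .random <| .op (.mulPt y.c.s 0) <| simHash y.pushS.pushP m y.c.p fun y' e _ =>
    .op (.scalarOp .mul e u.x) <| .op (.scalarOp .sub y.c.s y'.c.s) <|
    K y'.pushS.pushS (y'.c.s + 1) e

/-- The check of the forgery against the answer of the oracle. -/
def simCheck (s e x e' : ℕ) : Option ℕ → Run q t k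
  | some i => .test (.scalar e e') (.done i s e x) .fail
  | none => .fail

/-- The verification of the forgery of the adversary. -/
def simForge (y : SimState t k) (u : UserRegs) (m s e : ℕ) : Run q t k :=
  if u.tgt then
    simCommit y s e u.x fun y R => simHash y m R fun _ e' i => simCheck s e u.x e' i
  else .fail

/-- The simulation of the experiment, with the user number `g` as the target. -/
def simRun (g : ℕ) (S : Scheme) : ℕ → SimState t k → Run q t k
  | 0, _ => .fail
  | n + 1, y => .inspect fun o =>
    let z := y.pushMessage o
    match o with
    | none => simUser g S z y.c.i fun y' u => simForge y' u y.c.m y.c.s (y.c.s + 1)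
    | some .h1 => simH1 z y.c.i y.c.p fun y' j => .reply (.h1 j) (simRun g S n y')
    | some .h5 => simHash z y.c.m y.c.p fun y' e _ => .reply (.h5 e) (simRun g S n y')
    | some .pubKey =>
      simUser g S z y.c.i fun y' u => .reply (.pubKey u.U u.Q) (simRun g S n y')
    | some .partKey => simUser g S z y.c.i fun y' u =>
      -- The key of the target cannot be given away, and by `winWith_eq_zero` the run is already
      -- lost for this target.
      if u.tgt then .fail else .reply (.partKey u.w u.Q) (simRun g S n y')
    | some .secKey => simUser g S z y.c.i fun y' u => .reply (.secKey u.α) (simRun g S n y')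
    | some .corrupt => simUser g S z y.c.i fun y' u =>
      if u.tgt then .fail else .reply (.corrupt u.x) (simRun g S n y')
    | some .sign => simUser g S z y.c.i fun y' u => simSign y' u y.c.m fun y'' s e =>
      .reply (.sign s e) (simRun g S n y'')

end Simulator

/-! ## Correctness of the simulation -/

section Simulation

variable {q t k : ℕ} [Fact q.Prime] [NeZero t] {ID M G : Type} [DecidableEq ID] [DecidableEq M]
  [AddCommGroup G] [DecidableEq G]

/-- The counters fit the machine. -/
structure Counts (c : Ctr) (s : Machine q t k ID M G) : Prop where
  scalars : c.s = s.scalars.length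
  points : c.p = s.points.length
  ids : c.i = s.ids.length
  msgs : c.m = s.msgs.length

namespace Counts

variable {c : Ctr} {s : Machine q t k ID M G}

theorem pushS (h : Counts c s) (x : ZMod q) : Counts c.pushS (s.pushScalar x) :=
  ⟨by simp [Ctr.pushS, Machine.pushScalar, h.scalars], h.points, h.ids, h.msgs⟩

theorem pushP (h : Counts c s) (x : G) : Counts c.pushP (s.pushPt x) :=
  ⟨h.scalars, by simp [Ctr.pushP, Machine.pushPt, h.points], h.ids, h.msgs⟩

theorem pushI (h : Counts c s) (x : ID) : Counts c.pushI (s.pushID x) :=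
  ⟨h.scalars, h.points, by simp [Ctr.pushI, Machine.pushID, h.ids], h.msgs⟩

theorem pushM (h : Counts c s) (x : M) : Counts c.pushM (s.pushMsg x) :=
  ⟨h.scalars, h.points, h.ids, by simp [Ctr.pushM, Machine.pushMsg, h.msgs]⟩

theorem pushQuery (h : Counts c s) (r : Query ID M G) :
    Counts (c.pushMessage (some r.kind)) (s.pushQuery r) := by
  cases r
  · exact (h.pushI _).pushP _
  · exact (h.pushM _).pushP _
  all_goals first | exact h.pushI _ | exact (h.pushI _).pushM _

theorem scalar (h : Counts c s) (x : ZMod q) : (s.pushScalar x).scalars[c.s]? = some x := by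
  simp [Machine.pushScalar, h.scalars]

theorem point (h : Counts c s) (x : G) : (s.pushPt x).points[c.p]? = some x := by
  simp [Machine.pushPt, h.points]

end Counts

/-- The tables of the simulator with the content of the registers. A user is stored with her keys in
the experiment. -/
structure Tables (q t k : ℕ) (ID M G : Type) where
  h1 : List (ID × G × (Fin k → Fin t))
  h5 : List (M × G × ZMod q × Option ℕ)
  users : List (ID × User q G × Bool)

def H1Regs (s : Machine q t k ID M G) (e : ℕ × ℕ × (Fin k → Fin t))
    (c : ID × G × (Fin k → Fin t)) : Prop :=
  s.ids[e.1]? = some c.1 ∧ s.points[e.2.1]? = some c.2.1 ∧ e.2.2 = c.2.2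

def H5Regs (s : Machine q t k ID M G) (e : ℕ × ℕ × ℕ × Option ℕ)
    (c : M × G × ZMod q × Option ℕ) : Prop :=
  s.msgs[e.1]? = some c.1 ∧ s.points[e.2.1]? = some c.2.1 ∧ s.scalars[e.2.2.1]? = some c.2.2.1 ∧
    e.2.2.2 = c.2.2.2

structure UserRep (a : ZMod q) (s : Machine q t k ID M G) (r : UserRegs)
    (c : ID × User q G × Bool) : Prop where
  id : s.ids[r.id]? = some c.1
  α : s.scalars[r.α]? = some c.2.1.α
  U : s.points[r.U]? = some c.2.1.U
  w : s.scalars[r.w]? = some (c.2.1.w - if c.2.2 then a else 0)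
  Q : s.points[r.Q]? = some c.2.1.Q
  x : ∃ x, c.2.1.x = some x ∧ s.scalars[r.x]? = some (x - if c.2.2 then a else 0)
  tgt : r.tgt = c.2.2

/-- The state of the simulator and the machine represent a state of the experiment. -/
structure Sim (P : G) (v : Fin t → ZMod q) (a : ZMod q) (g : ℕ) (y : SimState t k)
    (C : Tables q t k ID M G) (s : Machine q t k ID M G) (h : List (G × ZMod q))
    (st : GameState q t k ID M G) (ord : List ID) : Prop where
  counts : Counts y.c s
  master : ∀ i : Fin t, s.scalars[(i : ℕ)]? = some (v i)
  base : s.points[0]? = some P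
  inst : s.points[1]? = some (smulPt a P)
  h1 : List.Forall₂ (H1Regs s) y.h1 C.h1
  h5 : List.Forall₂ (H5Regs s) y.h5 C.h5
  users : List.Forall₂ (UserRep a s) y.users C.users
  d : y.d = h.length
  d_le : y.d ≤ y.h5.length
  tableH1 : ∀ id Q, st.tableH1 id Q =
    (C.h1.find? fun c => decide (c.1 = id ∧ c.2.1 = Q)).map fun c => c.2.2
  tableH5 : ∀ m R, st.tableH5 m R =
    (C.h5.find? fun c => decide (c.1 = m ∧ c.2.1 = R)).map fun c => c.2.2.1
  tableUsers : ∀ id, st.users id = (C.users.find? fun c => decide (c.1 = id)).map fun c => c.2.1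
  ord_length : ord.length = C.users.length
  ord_mem : ∀ id ∈ ord, st.users id ≠ none
  tgt : ∀ c ∈ C.users, c.2.2 = true ↔ ord[g]? = some c.1
  key : ∀ c ∈ C.users, ∃ x j, c.2.1.x = some x ∧ st.tableH1 c.1 c.2.1.Q = some j ∧
    ∑ i, masterPublicKey P v (j i) + c.2.1.Q = smulPt x P
  hist : ∀ c ∈ C.h5, ∀ i, c.2.2.2 = some i → h[i]? = some (c.2.1, c.2.2.1)
  programmed : ∀ c ∈ C.h5, c.2.2.2 = none → ∃ id, ord[g]? = some id ∧ (id, c.1) ∈ st.signed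

theorem H1Regs.mono {s s' : Machine q t k ID M G} {e : ℕ × ℕ × (Fin k → Fin t)}
    {c : ID × G × (Fin k → Fin t)} (h : H1Regs s e c) (hs : s.Le s') : H1Regs s' e c :=
  ⟨getElem?_of_prefix hs.ids h.1, getElem?_of_prefix hs.points h.2.1, h.2.2⟩

theorem H5Regs.mono {s s' : Machine q t k ID M G} {e : ℕ × ℕ × ℕ × Option ℕ}
    {c : M × G × ZMod q × Option ℕ} (h : H5Regs s e c) (hs : s.Le s') : H5Regs s' e c :=
  ⟨getElem?_of_prefix hs.msgs h.1, getElem?_of_prefix hs.points h.2.1,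
    getElem?_of_prefix hs.scalars h.2.2.1, h.2.2.2⟩

theorem UserRep.mono {a : ZMod q} {s s' : Machine q t k ID M G} {r : UserRegs}
    {c : ID × User q G × Bool} (h : UserRep a s r c) (hs : s.Le s') : UserRep a s' r c := by
  obtain ⟨x, h1, h2⟩ := h.x
  exact ⟨getElem?_of_prefix hs.ids h.id, getElem?_of_prefix hs.scalars h.α,
    getElem?_of_prefix hs.points h.U, getElem?_of_prefix hs.scalars h.w,
    getElem?_of_prefix hs.points h.Q, ⟨x, h1, getElem?_of_prefix hs.scalars h2⟩, h.tgt⟩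

/-- The second machine has more registers, and the state of the simulator has been adapted. -/
structure Ext (y y' : SimState t k) (s s' : Machine q t k ID M G) : Prop where
  le : s.Le s'
  counts : Counts y'.c s'
  h1 : y'.h1 = y.h1
  h5 : y'.h5 = y.h5
  users : y'.users = y.users
  d : y'.d = y.d

namespace Ext

variable {y y' y'' : SimState t k} {s s' s'' : Machine q t k ID M G}

theorem trans (h : Ext y y' s s') (h' : Ext y' y'' s' s'') : Ext y y'' s s'' :=
  ⟨h.le.trans h'.le, h'.counts, h'.h1.trans h.h1, h'.h5.trans h.h5, h'.users.trans h.users,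
    h'.d.trans h.d⟩

theorem refl (h : Counts y.c s) : Ext y y s s := ⟨Machine.Le.refl s, h, rfl, rfl, rfl, rfl⟩

theorem pushS (h : Ext y y' s s') (x : ZMod q) : Ext y y'.pushS s (s'.pushScalar x) :=
  ⟨h.le.pushScalar x, h.counts.pushS x, h.h1, h.h5, h.users, h.d⟩

theorem pushP (h : Ext y y' s s') (x : G) : Ext y y'.pushP s (s'.pushPt x) :=
  ⟨h.le.pushPt x, h.counts.pushP x, h.h1, h.h5, h.users, h.d⟩

theorem pushQuery (h : Ext y y' s s') (c : Query ID M G) :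
    Ext y (y'.pushMessage (some c.kind)) s (s'.pushQuery c) :=
  ⟨h.le.pushQuery c, h.counts.pushQuery c, h.h1, h.h5, h.users, h.d⟩

theorem pushForgery (h : Ext y y' s s') (id : ID) (m : M) (σ : ZMod q × ZMod q) :
    Ext y (y'.pushMessage none) s
      ((((s'.pushID id).pushMsg m).pushScalar σ.1).pushScalar σ.2) :=
  ⟨(((h.le.pushID id).pushMsg m).pushScalar σ.1).pushScalar σ.2,
    (((h.counts.pushI id).pushM m).pushS σ.1).pushS σ.2, h.h1, h.h5, h.users, h.d⟩

end Ext

section SimLemmas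

variable {P : G} {v : Fin t → ZMod q} {a : ZMod q} {g : ℕ} {y y' : SimState t k}
  {C : Tables q t k ID M G} {s s' : Machine q t k ID M G} {h : List (G × ZMod q)}
  {st : GameState q t k ID M G} {ord : List ID} {cur : Strategy q t k ID M G} {n : ℕ}

theorem Sim.ext (hs : Sim P v a g y C s h st ord) (he : Ext y y' s s') :
    Sim P v a g y' C s' h st ord where
  counts := he.counts
  master i := getElem?_of_prefix he.le.scalars (hs.master i)
  base := getElem?_of_prefix he.le.points hs.base
  inst := getElem?_of_prefix he.le.points hs.inst
  h1 := he.h1 ▸ hs.h1.imp fun _ _ h => h.mono he.le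
  h5 := he.h5 ▸ hs.h5.imp fun _ _ h => h.mono he.le
  users := he.users ▸ hs.users.imp fun _ _ h => h.mono he.le
  d := he.d ▸ hs.d
  d_le := he.d ▸ he.h5 ▸ hs.d_le
  tableH1 := hs.tableH1
  tableH5 := hs.tableH5
  tableUsers := hs.tableUsers
  ord_length := hs.ord_length
  ord_mem := hs.ord_mem
  tgt := hs.tgt
  key := hs.key
  hist := hs.hist
  programmed := hs.programmed

/-- The acceptance probability of a run. -/
def Run.accept (P X : G) (n : ℕ) (p : Run q t k) (s : Machine q t k ID M G)
    (h : List (G × ZMod q)) (cur : Strategy q t k ID M G) : ℝ≥0∞ :=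
  (p.tree P X n s h cur).acc

theorem Run.accept_random (P X : G) (p : Run q t k) :
    (Run.random p).accept P X n s h cur =
      expect (PMF.uniformOfFintype (ZMod q)) fun x => p.accept P X n (s.pushScalar x) h cur := rfl

theorem Run.accept_hash (P X : G) {R : ℕ} {Y : G} (hR : s.points[R]? = some Y) (p : Run q t k) :
    (Run.hash R p).accept P X n s h cur =
      expect (PMF.uniformOfFintype (ZMod q)) fun x =>
        p.accept P X n (s.pushScalar x) (h ++ [(Y, x)]) cur := by
  simp only [accept, tree, hR]
  rfl

theorem Run.accept_const (P X : G) (z : ZMod q) (p : Run q t k) :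
    (Run.op (.const z) p).accept P X n s h cur = p.accept P X n (s.pushScalar z) h cur := rfl

theorem Run.accept_scalarOp (P X : G) {o : ScalarOp} {i j : ℕ} {x z : ZMod q}
    (hi : s.scalars[i]? = some x) (hj : s.scalars[j]? = some z) (p : Run q t k) :
    (Run.op (.scalarOp o i j) p).accept P X n s h cur =
      p.accept P X n (s.pushScalar (o.eval x z)) h cur := by
  simp [accept, tree, Instr.step, hi, hj]

theorem Run.accept_addPt (P X : G) {i j : ℕ} {x z : G}
    (hi : s.points[i]? = some x) (hj : s.points[j]? = some z) (p : Run q t k) :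
    (Run.op (.addPt i j) p).accept P X n s h cur = p.accept P X n (s.pushPt (x + z)) h cur := by
  simp [accept, tree, Instr.step, hi, hj]

theorem Run.accept_mulPt (P X : G) {i j : ℕ} {x : ZMod q} {z : G}
    (hi : s.scalars[i]? = some x) (hj : s.points[j]? = some z) (p : Run q t k) :
    (Run.op (.mulPt i j) p).accept P X n s h cur =
      p.accept P X n (s.pushPt (smulPt x z)) h cur := by
  simp [accept, tree, Instr.step, hi, hj]

theorem Run.accept_test (P X : G) {c : EqTest} {b : Bool} (hc : c.eval s = some b)
    (yes no : Run q t k) :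
    (Run.test c yes no).accept P X n s h cur = (if b then yes else no).accept P X n s h cur := by
  cases b <;> simp [accept, tree, hc]

/-- A scan of registers is a `find?` on their contents, once each test is known to decide the
condition. -/
theorem Run.accept_scan (P X : G) {α β : Type} {l : List α} {L : List β} {R : α → β → Prop}
    (hR : List.Forall₂ R l L) (cond : β → Bool) {test : α → Run q t k → Run q t k → Run q t k}
    (htest : ∀ x z, R x z → ∀ yes no : Run q t k, (test x yes no).accept P X n s h cur =
      (if cond z then yes else no).accept P X n s h cur) (yes : α → Run q t k) (no : Run q t k) :
    (∃ x z, R x z ∧ L.find? cond = some z ∧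
      (Run.scan test l yes no).accept P X n s h cur = (yes x).accept P X n s h cur) ∨
    (L.find? cond = none ∧
      (Run.scan test l yes no).accept P X n s h cur = no.accept P X n s h cur) := by
  induction hR with
  | nil => exact Or.inr ⟨rfl, rfl⟩
  | @cons x z l L hx hl ih =>
    simp only [Run.scan, htest x z hx, List.find?_cons]
    cases hc : cond z with
    | true => exact Or.inl ⟨x, z, hx, by simp, by simp⟩
    | false => simpa using ih

theorem Run.accept_branchVec (P X : G) (m : ℕ) (K : (Fin m → Fin t) → Run q t k) :
    (Run.branchVec m K).accept P X n s h cur =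
      expect (PMF.uniformOfFintype (Fin m → Fin t)) fun j => (K j).accept P X n s h cur := by
  induction m with
  | zero =>
    rw [expect_uniform]
    simp only [Run.branchVec, Finset.univ_unique, Finset.sum_singleton, Fintype.card_unique,
      Nat.cast_one, div_one]
    congr
  | succ m ih =>
    rw [expect_uniform_succ, ← expect_uniform_equiv (finCongr (Nat.sub_add_cancel NeZero.one_le))]
    have : (Run.branchVec (m + 1) K).accept P X n s h cur =
      expect (PMF.uniformOfFintype (Fin (t - 1 + 1))) fun i =>
        (Run.branchVec m fun f => K (Fin.cons (Fin.cast (Nat.sub_add_cancel NeZero.one_le) i)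
          f)).accept P X n s h cur := rfl
    rw [this]
    congr 1
    funext i
    rw [ih]
    rfl

theorem accept_simSum (P X : G) (l : List ℕ) (L : List (ZMod q)) {r : ℕ} {x : ZMod q}
    (hl : Embedded l L s.scalars) (hr : s.scalars[r]? = some x)
    (hc : Counts y.c s) (K : SimState t k → ℕ → Run q t k) :
    ∃ y' s' r', (simSum l r y K).accept P X n s h cur = (K y' r').accept P X n s' h cur ∧
      Ext y y' s s' ∧ s'.scalars[r']? = some (x + L.sum) := by
  induction l generalizing y s r x L with
  | nil =>
    cases hl
    exact ⟨y, s, r, rfl, Ext.refl hc, by simpa using hr⟩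
  | cons i l ih =>
    obtain _ | @⟨_, z, _, L, hi, hl⟩ := hl
    obtain ⟨y', s', r', h1, h2, h3⟩ := ih (y := y.pushS) (s := s.pushScalar (x + z))
      (r := y.c.s) (x := x + z) L
      (Embedded.mono hl (List.prefix_append _ _))
      (hc.scalar _) (hc.pushS _)
    refine ⟨y', s', r', ?_, ((Ext.refl hc).pushS _).trans h2, ?_⟩
    · rw [simSum, Run.accept_scalarOp P X hr hi]
      exact h1
    · rw [h3, List.sum_cons, add_assoc]

theorem expect_le_add {α : Type} {p : PMF α} {f f' : α → ℝ≥0∞} {c : ℝ≥0∞}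
    (h : ∀ x, f x ≤ f' x + c) : expect p f ≤ expect p f' + c := by
  rw [← expect_const p c, ← expect_add]
  exact expect_mono fun x => by simpa using h x

/-- A new entry at the head shadows every older one with the same arguments, which is what
`Function.update` does. -/
theorem find?_update {α β γ : Type} [DecidableEq α] [DecidableEq β] {l : List (α × β × γ)}
    {δ : Type} (f : γ → δ) {T : α → β → Option δ}
    (hT : ∀ x z, T x z = (l.find? fun c => decide (c.1 = x ∧ c.2.1 = z)).map fun c => f c.2.2)
    (x₀ : α) (z₀ : β) (w : γ) (x : α) (z : β) :
    Function.update T x₀ (Function.update (T x₀) z₀ (some (f w))) x z =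
      (((x₀, z₀, w) :: l).find? fun c => decide (c.1 = x ∧ c.2.1 = z)).map fun c => f c.2.2 := by
  rw [List.find?_cons]
  by_cases hx : x = x₀
  · subst hx
    by_cases hz : z = z₀
    · subst hz
      simp
    · rw [Function.update_self, Function.update_of_ne hz, hT]
      simp [Ne.symm hz]
  · rw [Function.update_of_ne hx, hT]
    simp [Ne.symm hx]

theorem Sim.setH1 (hs : Sim P v a g y C s h st ord) {i r : ℕ} {id : ID} {Q : G}
    (hi : s.ids[i]? = some id) (hr : s.points[r]? = some Q) (hnew : st.tableH1 id Q = none)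
    (j : Fin k → Fin t) :
    Sim P v a g { y with h1 := (i, r, j) :: y.h1 } { C with h1 := (id, Q, j) :: C.h1 } s h
      (st.setH1 id Q j) ord where
  counts := hs.counts
  master := hs.master
  base := hs.base
  inst := hs.inst
  h1 := List.Forall₂.cons ⟨hi, hr, rfl⟩ hs.h1
  h5 := hs.h5
  users := hs.users
  d := hs.d
  d_le := hs.d_le
  tableH1 := find?_update (fun j => j) hs.tableH1 id Q j
  tableH5 := hs.tableH5
  tableUsers := hs.tableUsers
  ord_length := hs.ord_length
  ord_mem := hs.ord_mem
  tgt := hs.tgt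
  key c hc := by
    -- Freshness of `(id, Q)` ensures that no value of `H₁` used in an earlier key is overwritten.
    obtain ⟨x, j', h1, h2, h3⟩ := hs.key c hc
    refine ⟨x, j', h1, ?_, h3⟩
    simp only [GameState.setH1]
    by_cases e1 : c.1 = id
    · by_cases e2 : c.2.1.Q = Q
      · rw [e1, e2, hnew] at h2
        simp at h2
      · rw [e1] at h2 ⊢
        rw [Function.update_self, Function.update_of_ne e2, h2]
    · rw [Function.update_of_ne e1, h2]
  hist := hs.hist
  programmed := hs.programmed

/-- This and the following bounds are in continuation form: if the rest of the experiment is bounded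
by the rest of the simulation up to a slack `c`, so is the whole with this step in front. The two
sides draw the same random values. -/
theorem wp_hash1_le (X : G) (hs : Sim P v a g y C s h st ord) {i r : ℕ} {id : ID} {Q : G}
    (hi : s.ids[i]? = some id) (hr : s.points[r]? = some Q)
    {F : (Fin k → Fin t) → GameState q t k ID M G → ℝ≥0∞} {c : ℝ≥0∞}
    {K : SimState t k → (Fin k → Fin t) → Run q t k}
    (hK : ∀ y' C' st' j, Sim P v a g y' C' s h st' ord → y'.c = y.c → y'.h5 = y.h5 →
      C'.users = C.users → y'.users = y.users → st'.users = st.users → st'.tableH1 id Q = some j →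
      F j st' ≤ (K y' j).accept P X n s h cur + c) :
    wp (hash1 id Q) st F ≤ (simH1 y i r K).accept P X n s h cur + c := by
  rw [wp_hash1, hs.tableH1]
  have := Run.accept_scan (s := s) (h := h) (cur := cur) (n := n) P X hs.h1
    (fun c => decide (c.1 = id ∧ c.2.1 = Q))
    (test := fun e yes no => .test (.id e.1 i) (.test (.pt e.2.1 r) yes no) no)
    (by
      rintro e z ⟨h1, h2, -⟩ yes no
      rw [Run.accept_test P X (b := decide (z.1 = id)) (by simp [EqTest.eval, h1, hi])]
      by_cases hz : z.1 = id
      · rw [if_pos (by simpa using hz), Run.accept_test P X (b := decide (z.2.1 = Q))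
          (by simp [EqTest.eval, h2, hr])]
        simp [hz]
      · simp [hz])
    (fun e => K y e.2.2) (Run.branchVec k fun j => K { y with h1 := (i, r, j) :: y.h1 } j)
  rcases this with ⟨e, z, hez, hf, hacc⟩ | ⟨hf, hacc⟩
  · rw [simH1, hacc, hf, hez.2.2]
    refine hK _ _ _ _ hs rfl rfl rfl rfl rfl ?_
    rw [hs.tableH1, hf]
    rfl
  · rw [simH1, hacc, hf, Run.accept_branchVec]
    have hnew : st.tableH1 id Q = none := by rw [hs.tableH1, hf]; rfl
    exact expect_le_add fun j => hK _ _ _ _ (hs.setH1 hi hr hnew j) rfl rfl rfl rfl rfl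
      (by simp [GameState.setH1])

/-- A new entry in the table of `H₅`. -/
theorem Sim.setH5 (hs : Sim P v a g y C s h st ord) {i r e : ℕ} {m : M} {R : G} {x : ZMod q}
    {l : Option ℕ} {h' : List (G × ZMod q)} {d : ℕ} (hi : s.msgs[i]? = some m)
    (hr : s.points[r]? = some R) (he : s.scalars[e]? = some x) (hh : h <+: h')
    (hd : d = h'.length) (hd' : d ≤ y.h5.length + 1)
    (hl : ∀ j, l = some j → h'[j]? = some (R, x))
    (hl' : l = none → ∃ id, ord[g]? = some id ∧ (id, m) ∈ st.signed) :
    Sim P v a g { y with h5 := (i, r, e, l) :: y.h5, d := d }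
      { C with h5 := (m, R, x, l) :: C.h5 } s h' (st.setH5 m R x) ord where
  counts := hs.counts
  master := hs.master
  base := hs.base
  inst := hs.inst
  h1 := hs.h1
  h5 := List.Forall₂.cons ⟨hi, hr, he, rfl⟩ hs.h5
  users := hs.users
  d := hd
  d_le := hd'
  tableH1 := hs.tableH1
  tableH5 := find?_update (fun w : ZMod q × Option ℕ => w.1) hs.tableH5 m R (x, l)
  tableUsers := hs.tableUsers
  ord_length := hs.ord_length
  ord_mem := hs.ord_mem
  tgt := hs.tgt
  key := hs.key
  hist c hc j hj := by
    rcases List.mem_cons.1 hc with rfl | hc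
    · exact hl j hj
    · exact getElem?_of_prefix hh (hs.hist c hc j hj)
  programmed c hc hn := by
    rcases List.mem_cons.1 hc with rfl | hc
    · exact hl' hn
    · exact hs.programmed c hc hn

theorem accept_simSearchH5 (X : G) (hs : Sim P v a g y C s h st ord) {i r : ℕ} {m : M} {R : G}
    (hi : s.msgs[i]? = some m) (hr : s.points[r]? = some R)
    (yes : ℕ × ℕ × ℕ × Option ℕ → Run q t k) (no : Run q t k) :
    (∃ e z, H5Regs s e z ∧ z ∈ C.h5 ∧ z.1 = m ∧ z.2.1 = R ∧ st.tableH5 m R = some z.2.2.1 ∧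
      (simSearchH5 y i r yes no).accept P X n s h cur = (yes e).accept P X n s h cur) ∨
    (st.tableH5 m R = none ∧
      (simSearchH5 y i r yes no).accept P X n s h cur = no.accept P X n s h cur) := by
  have := Run.accept_scan (s := s) (h := h) (cur := cur) (n := n) P X hs.h5
    (fun c => decide (c.1 = m ∧ c.2.1 = R))
    (test := fun e yes no => .test (.msg e.1 i) (.test (.pt e.2.1 r) yes no) no)
    (by
      rintro e z ⟨h1, h2, -⟩ yes no
      rw [Run.accept_test P X (b := decide (z.1 = m)) (by simp [EqTest.eval, h1, hi])]
      by_cases hz : z.1 = m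
      · rw [if_pos (by simpa using hz), Run.accept_test P X (b := decide (z.2.1 = R))
          (by simp [EqTest.eval, h2, hr])]
        simp [hz]
      · simp [hz])
    yes no
  rw [hs.tableH5]
  rcases this with ⟨e, z, hez, hf, hacc⟩ | ⟨hf, hacc⟩
  · have hp := List.find?_some hf
    simp only [decide_eq_true_eq] at hp
    exact Or.inl ⟨e, z, hez, List.mem_of_find?_eq_some hf, hp.1, hp.2, by rw [hf]; rfl, hacc⟩
  · exact Or.inr ⟨by rw [hf]; rfl, hacc⟩

/-- The continuation also learns the origin `l` of the entry and that a node number does not exceed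
the earlier size of the table. The final check needs both. -/
theorem wp_hash5_le (X : G) (hs : Sim P v a g y C s h st ord) {i r : ℕ} {m : M} {R : G}
    (hi : s.msgs[i]? = some m) (hr : s.points[r]? = some R)
    {F : ZMod q → GameState q t k ID M G → ℝ≥0∞} {c : ℝ≥0∞}
    {K : SimState t k → ℕ → Option ℕ → Run q t k}
    (hK : ∀ y' C' s' h' st' e x l, Sim P v a g y' C' s' h' st' ord → s.Le s' →
      y'.h5.length ≤ y.h5.length + 1 → st'.signed = st.signed → s'.scalars[e]? = some x →
      (m, R, x, l) ∈ C'.h5 → (∀ j, l = some j → j ≤ y.h5.length) →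
      F x st' ≤ (K y' e l).accept P X n s' h' cur + c) :
    wp (hash5 m R) st F ≤ (simHash y i r K).accept P X n s h cur + c := by
  rw [wp_hash5, simHash]
  rcases accept_simSearchH5 (n := n) (cur := cur) X hs hi hr (fun e => K y e.2.2.1 e.2.2.2)
    (.hash r (K { y.pushS with h5 := (i, r, y.c.s, some y.d) :: y.h5, d := y.d + 1 }
      y.c.s (some y.d))) with ⟨e, z, hez, hmem, hz1, hz2, hT, hacc⟩ | ⟨hT, hacc⟩
  · rw [hacc, hT, hez.2.2.2]
    subst hz1 hz2
    refine hK _ _ _ _ _ _ _ _ hs (Machine.Le.refl s) (by omega) rfl hez.2.2.1 hmem fun j hj => ?_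
    -- An old entry points to an old `hash` node, and each `hash` node has put at least one entry
    -- into the table.
    have h1 := (List.getElem?_eq_some_iff.1 (hs.hist z hmem j hj)).1
    have h2 := hs.d
    have h3 := hs.d_le
    omega
  · rw [hacc, hT, Run.accept_hash P X hr]
    refine expect_le_add fun x => ?_
    have he := (Ext.refl hs.counts).pushS x
    have hs' := hs.ext he
    refine hK _ _ _ _ _ _ _ _ (hs'.setH5 (l := some y.d) (getElem?_of_prefix he.le.msgs hi)
      (getElem?_of_prefix he.le.points hr) (hs.counts.scalar x) (List.prefix_append _ _)
      (by simp [hs.d]) (Nat.succ_le_succ hs.d_le) ?_ (by simp)) he.le (by simp) rfl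
      (hs.counts.scalar x) (by simp) ?_
    · intro j hj
      cases hj
      simp [hs.d]
    · intro j hj
      cases hj
      exact hs.d_le

end SimLemmas

end Simulation

/-! ### The simulator reproduces the experiment up to collisions of commitments -/

section Reduction

variable {q t k : ℕ} [Fact q.Prime] [NeZero t] {ID M G : Type} [DecidableEq ID] [DecidableEq M]
  [AddCommGroup G] [DecidableEq G]
variable {P : G} {v : Fin t → ZMod q} {a : ZMod q} {g : ℕ} {y y' : SimState t k}
  {C : Tables q t k ID M G} {s s' : Machine q t k ID M G} {h : List (G × ZMod q)}
  {st : GameState q t k ID M G} {ord : List ID} {cur : Strategy q t k ID M G} {n : ℕ}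

theorem expect_secretLaw_le (X : G) (S : Scheme) {F : ZMod q → ℝ≥0∞} {c : ℝ≥0∞}
    {K : SimState t k → ℕ → Run q t k}
    (hK : ∀ α, F α ≤ (K y.pushS y.c.s).accept P X n (s.pushScalar α) h cur + c) :
    expect (secretLaw S) F ≤ (simSecret S y K).accept P X n s h cur + c := by
  cases S with
  | certificateless =>
    rw [simSecret, Run.accept_random]
    exact expect_le_add hK
  | identityBased =>
    rw [simSecret, Run.accept_const, secretLaw, expect_pure]
    exact hK 0

/-- For the target `β` is `a`: the known part `a - a` is the constant `0`, and `βP` is the challenge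
in point register `1`. -/
theorem expect_betaLaw_le (X : G) (hs : Sim P v a g y C s h st ord) {b : Bool} {F : ZMod q → ℝ≥0∞}
    {c : ℝ≥0∞} {K : SimState t k → ℕ → ℕ → Run q t k}
    (hK : ∀ y' s' r W β, Ext y y' s s' → s'.scalars[r]? = some (β - if b then a else 0) →
      s'.points[W]? = some (smulPt β P) → F β ≤ (K y' r W).accept P X n s' h cur + c) :
    expect (betaLaw (if b then some a else none)) F ≤
      (simBeta b y K).accept P X n s h cur + c := by
  cases b with
  | true =>
    simp only [simBeta, if_true, Run.accept_const, betaLaw, expect_pure]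
    have he := (Ext.refl hs.counts).pushS 0
    exact hK _ _ _ _ _ he (by simpa using hs.counts.scalar 0) (hs.ext he).inst
  | false =>
    simp only [simBeta, Bool.false_eq_true, if_false, Run.accept_random, betaLaw]
    refine expect_le_add fun β => ?_
    have he := (Ext.refl hs.counts).pushS β
    rw [Run.accept_mulPt P X (hs.counts.scalar β) (hs.ext he).base]
    exact hK _ _ _ _ _ (he.pushP _)
      (getElem?_of_prefix ((Machine.Le.refl _).pushPt _).scalars (by simpa using hs.counts.scalar β))
      (he.counts.point _)

theorem Sim.addUser (hs : Sim P v a g y C s h st ord) {id : ID} {u : User q G} {b : Bool}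
    {r : UserRegs} (hnew : st.users id = none) (hr : UserRep a s r (id, u, b))
    (hb : b = decide (ord.length = g))
    (hkey : ∃ x j, u.x = some x ∧ st.tableH1 id u.Q = some j ∧
      ∑ i, masterPublicKey P v (j i) + u.Q = smulPt x P) :
    Sim P v a g { y with users := r :: y.users } { C with users := (id, u, b) :: C.users } s h
      (st.addUser id u) (ord ++ [id]) where
  counts := hs.counts
  master := hs.master
  base := hs.base
  inst := hs.inst
  h1 := hs.h1
  h5 := hs.h5
  users := List.Forall₂.cons hr hs.users
  d := hs.d
  d_le := hs.d_le
  tableH1 := hs.tableH1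
  tableH5 := hs.tableH5
  tableUsers i := by
    simp only [GameState.addUser, List.find?_cons]
    by_cases hi : i = id
    · subst hi
      simp
    · rw [Function.update_of_ne hi, hs.tableUsers]
      simp [Ne.symm hi]
  ord_length := by simp [hs.ord_length]
  ord_mem i hi := by
    simp only [GameState.addUser]
    by_cases h' : i = id
    · simp [h']
    · rw [Function.update_of_ne h']
      exact hs.ord_mem i (by simpa [h'] using hi)
  tgt c hc := by
    rcases List.mem_cons.1 hc with rfl | hc
    · simp only [hb, decide_eq_true_eq]
      constructor
      · rintro rfl
        simp
      · intro h1
        by_contra h2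
        rcases lt_or_gt_of_ne h2 with h3 | h3
        · rw [List.getElem?_eq_none (by simp; omega)] at h1
          simp at h1
        · rw [List.getElem?_append_left h3] at h1
          exact hs.ord_mem id (List.mem_of_getElem? h1) hnew
    · rw [hs.tgt c hc]
      constructor
      · exact getElem?_of_prefix (List.prefix_append _ _)
      · intro h1
        rcases lt_trichotomy g ord.length with h3 | h3 | h3
        · rwa [List.getElem?_append_left h3] at h1
        · subst h3
          -- An older user cannot occupy the new position: the user would carry the identity `id`,
          -- which had no keys before.
          simp only [List.getElem?_concat_length, Option.some.injEq] at h1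
          have h2 := hs.tableUsers id
          rw [hnew, h1] at h2
          have := List.find?_eq_none.1 (Option.map_eq_none_iff.1 h2.symm) c hc
          simp at this
        · rw [List.getElem?_eq_none (by simp; omega)] at h1
          simp at h1
  key c hc := by
    rcases List.mem_cons.1 hc with rfl | hc
    · exact hkey
    · exact hs.key c hc
  hist := hs.hist
  programmed c hc hn := by
    obtain ⟨i, h1, h2⟩ := hs.programmed c hc hn
    exact ⟨i, getElem?_of_prefix (List.prefix_append _ _) h1, h2⟩

/-- For an existing user the scan finds the registers. For a new one the program is followed
instruction by instruction; what is stored for `w` and `x` differs from the true keys by exactly the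
part of `β` that is unknown. -/
theorem wp_userWith_le (hP : q • P = 0) (X : G) (hs : Sim P v a g y C s h st ord) (S : Scheme)
    {i : ℕ} {id : ID} (hi : s.ids[i]? = some id)
    {F : User q G → GameState q t k ID M G → ℝ≥0∞} {c : ℝ≥0∞}
    {K : SimState t k → UserRegs → Run q t k}
    (hK : ∀ y' C' s' st' r u b, Sim P v a g y' C' s' h st' (created st ord (some id)) → s.Le s' →
      y'.h5 = y.h5 → UserRep a s' r (id, u, b) → (id, u, b) ∈ C'.users →
      F u st' ≤ (K y' r).accept P X n s' h cur + c) :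
    wp (userWith S P v (if ord.length = g then some a else none) id) st F ≤
      (simUser g S y i K).accept P X n s h cur + c := by
  rw [wp_userWith, simUser, hs.tableUsers]
  rcases Run.accept_scan (s := s) (h := h) (cur := cur) (n := n) P X hs.users
    (fun c => decide (c.1 = id)) (test := fun u yes no => .test (.id u.id i) yes no)
    (by
      intro e z hz yes no
      rw [Run.accept_test P X (b := decide (z.1 = id)) (by simp [EqTest.eval, hz.id, hi])])
    (fun u => K y u) (simNewUser g S y i K) with ⟨r, ⟨id', u, b⟩, hr, hf, hacc⟩ | ⟨hf, hacc⟩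
  · have h1 := List.find?_some hf
    simp only [decide_eq_true_eq] at h1
    subst h1
    have hu : st.users id' ≠ none := by simp [hs.tableUsers, hf]
    rw [hacc, hf]
    refine hK y C s st r u b ?_ (Machine.Le.refl s) rfl hr (List.mem_of_find?_eq_some hf)
    simpa [created, hu] using hs
  · have hu : st.users id = none := by simp [hs.tableUsers, hf]
    rw [hacc, hf]
    simp only [created, hu, if_true] at hK
    simp only [Option.map_none]
    refine expect_secretLaw_le X S fun α => ?_
    have e1 := (Ext.refl hs.counts).pushS α
    have a1 := hs.counts.scalar α
    rw [Run.accept_mulPt P X a1 (hs.ext e1).base]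
    have e2 := e1.pushP (smulPt α P)
    -- The experiment recognizes the target by the length of `ord`, the simulator by the length of
    -- its list of users; the two lengths agree.
    have hb : ∀ {α : Type} (x z : α), (if ord.length = g then x else z) =
        if decide (y.pushS.users.length = g) then x else z := fun x z => by
      rw [hs.ord_length, ← hs.users.length_eq]
      by_cases hc : y.users.length = g <;> simp [SimState.pushS, hc]
    rw [hb]
    refine expect_betaLaw_le X (hs.ext e2) fun y₃ s₃ rβ W β e3 b3 W3 => ?_
    have U3 := getElem?_of_prefix e3.le.points (e1.counts.point (smulPt α P))
    have a3 := getElem?_of_prefix (((Machine.Le.refl _).pushPt _).trans e3.le).scalars a1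
    have i3 := getElem?_of_prefix (e2.trans e3).le.ids hi
    rw [Run.accept_addPt P X U3 W3]
    have e4 := (e2.trans e3).pushP (smulPt α P + smulPt β P)
    have Q4 := e3.counts.point (smulPt α P + smulPt β P)
    refine wp_hash1_le X (hs.ext e4) (getElem?_of_prefix ((Machine.Le.refl s₃).pushPt _).ids i3) Q4 fun y₅ C₅ st₅ j hs5 hc5 h55 hC5 hu5 hst5 hj => ?_
    rw [Run.accept_const]
    have e6 := (Ext.refl hs5.counts).pushS (0 : ZMod q)
    obtain ⟨z, s₇, r₇, hacc7, e7, v7⟩ := accept_simSum (n := n) (h := h) (cur := cur) P X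
      (List.ofFn fun i => ((j i : Fin t) : ℕ)) (List.ofFn fun i => v (j i))
      (by
        have hm := (hs5.ext e6).master
        exact List.forall₂_iff_get.2 ⟨by simp, fun i h1 h2 => by simpa using hm _⟩)
      (hs5.counts.scalar 0) e6.counts
      (fun z r => .op (.scalarOp .add r rβ) <| .op (.scalarOp .add z.c.s y.c.s) <|
        K { z.pushS.pushS with users := ⟨i, y.c.s, y.pushS.c.p, z.c.s, y₃.c.p, z.c.s + 1,
            decide (y.pushS.users.length = g)⟩ :: y.pushS.users }
          ⟨i, y.c.s, y.pushS.c.p, z.c.s, y₃.c.p, z.c.s + 1, decide (y.pushS.users.length = g)⟩)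
    rw [hacc7]
    have l47 := ((Machine.Le.refl _).pushScalar (0 : ZMod q)).trans e7.le
    have l37 := ((Machine.Le.refl s₃).pushPt (smulPt α P + smulPt β P)).trans l47
    have b7 := getElem?_of_prefix l37.scalars b3
    rw [Run.accept_scalarOp P X v7 b7]
    have e8 := (e6.trans e7).pushS
      (0 + (List.ofFn fun i => v (j i)).sum +
        (β - if decide (y.pushS.users.length = g) = true then a else 0))
    have w8 := e7.counts.scalar
      (0 + (List.ofFn fun i => v (j i)).sum +
        (β - if decide (y.pushS.users.length = g) = true then a else 0))
    have l8 := l37.pushScalar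
      (0 + (List.ofFn fun i => v (j i)).sum +
        (β - if decide (y.pushS.users.length = g) = true then a else 0))
    have a8 := getElem?_of_prefix l8.scalars a3
    simp only [ScalarOp.eval] at w8 ⊢
    rw [Run.accept_scalarOp P X w8 a8]
    simp only [ScalarOp.eval]
    have e9 := e8.pushS (0 + (List.ofFn fun i => v (j i)).sum +
        (β - if decide (y.pushS.users.length = g) = true then a else 0) + α)
    have x9 := e8.counts.scalar (0 + (List.ofFn fun i => v (j i)).sum +
        (β - if decide (y.pushS.users.length = g) = true then a else 0) + α)
    have l9 := l8.pushScalar (0 + (List.ofFn fun i => v (j i)).sum +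
        (β - if decide (y.pushS.users.length = g) = true then a else 0) + α)
    have hs9 := hs5.ext e9
    -- The program extends the list of users as it was before the `H₁` query; nothing in between has
    -- changed it.
    have husers : y.pushS.users = z.pushS.pushS.users := by
      have h1 := e9.users
      rw [h1, hu5]
      exact ((e2.trans e3).users).symm
    have hrep : UserRep a _ (⟨i, y.c.s, y.pushS.c.p, z.c.s, y₃.c.p, z.c.s + 1,
        decide (y.pushS.users.length = g)⟩ : UserRegs) (id, honestUser P v α β j,
        decide (y.pushS.users.length = g)) :=
      { id := getElem?_of_prefix l9.ids i3
        α := getElem?_of_prefix l9.scalars a3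
        U := getElem?_of_prefix l9.points U3
        w := by
          refine (getElem?_of_prefix ((Machine.Le.refl _).pushScalar _).scalars w8).trans ?_
          simp only [honestUser, List.sum_ofFn]
          congr 1
          ring
        Q := getElem?_of_prefix
          (((l47.pushScalar _).pushScalar _).points) Q4
        x := by
          refine ⟨_, rfl, x9.trans ?_⟩
          simp only [List.sum_ofFn]
          congr 1
          ring
        tgt := rfl }
    have hnew5 : st₅.users id = none := by rw [hst5, hu]
    have hfin := hs9.addUser hnew5 hrep
      (by rw [hs.ord_length, ← hs.users.length_eq]; rfl)
      ⟨_, j, rfl, hj, by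
        simp only [honestUser, masterPublicKey, ← smulPt_sum hP, smulPt_add hP]
        abel⟩
    rw [husers] at hfin l9 hrep ⊢
    refine hK _ _ _ _ _ _ _ hfin ((e2.trans e3).le.trans l9) ?_ hrep
      (List.mem_cons_self ..)
    have h1 := e9.h5
    exact h1.trans (h55.trans (e2.trans e3).h5)

theorem accept_simCommit (hs : Sim P v a g y C s h st ord) (X : G) {i j l : ℕ} {x e z : ZMod q}
    (hi : s.scalars[i]? = some x) (hj : s.scalars[j]? = some e) (hl : s.scalars[l]? = some z)
    (K : SimState t k → ℕ → Run q t k) :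
    ∃ y' s' r, (simCommit y i j l K).accept P X n s h cur = (K y' r).accept P X n s' h cur ∧
      Ext y y' s s' ∧
      s'.points[r]? = some (smulPt x P + smulPt e (smulPt z P + smulPt a P)) := by
  have e0 := Ext.refl hs.counts
  have e1 := e0.pushP (smulPt z P)
  have p1 : (s.pushPt (smulPt z P)).points[y.c.p]? = _ := e0.counts.point (smulPt z P)
  have e2 := e1.pushP (smulPt z P + smulPt a P)
  have p2 : ((s.pushPt _).pushPt _).points[y.c.p + 1]? = _ := e1.counts.point (smulPt z P + smulPt a P)
  have e3 := e2.pushP (smulPt x P)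
  have p3 : (((s.pushPt _).pushPt _).pushPt _).points[y.c.p + 2]? = _ := e2.counts.point (smulPt x P)
  have e4 := e3.pushP (smulPt e (smulPt z P + smulPt a P))
  have p4 : ((((s.pushPt _).pushPt _).pushPt _).pushPt _).points[y.c.p + 3]? = _ := e3.counts.point (smulPt e (smulPt z P + smulPt a P))
  refine ⟨_, _, _, ?_, e4.pushP (smulPt x P + smulPt e (smulPt z P + smulPt a P)),
    e4.counts.point _⟩
  rw [simCommit, Run.accept_mulPt P X hl hs.base, Run.accept_addPt P X p1 (hs.ext e1).inst,
    Run.accept_mulPt P X (s := (s.pushPt _).pushPt _) hi (hs.ext e2).base,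
    Run.accept_mulPt P X (s := ((s.pushPt _).pushPt _).pushPt _) hj
      (getElem?_of_prefix ((Machine.Le.refl _).pushPt _).points p2),
    Run.accept_addPt P X (getElem?_of_prefix ((Machine.Le.refl _).pushPt _).points p3) p4]
  rfl

/-- Since `c ↦ cP` is injective, distinct scalars with an entry have distinct points in the table.
-/
theorem Sim.card_le (hq : addOrderOf P = q) (hs : Sim P v a g y C s h st ord) (m : M) :
    (Finset.univ.filter fun r : ZMod q => st.tableH5 m (smulPt r P) ≠ none).card ≤
      y.h5.length := by
  classical
  rw [hs.h5.length_eq, ← List.length_map (f := fun c => c.2.1) (as := C.h5)]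
  refine le_trans (Finset.card_le_card_of_injOn (fun r : ZMod q => smulPt r P)
    (t := (C.h5.map fun c => c.2.1).toFinset) ?_ ((smulPt_injective hq).injOn))
    (List.toFinset_card_le _)
  intro r hr
  simp only [Finset.coe_filter, Finset.mem_univ, true_and, Set.mem_ofPred_eq] at hr
  rw [hs.tableH5] at hr
  cases hf : C.h5.find? fun c => decide (c.1 = m ∧ c.2.1 = smulPt r P) with
  | none =>
    rw [hf] at hr
    simp at hr
  | some z =>
    have h1 := List.find?_some hf
    simp only [decide_eq_true_eq] at h1
    simp only [List.coe_toFinset, List.mem_map, Set.mem_ofPred_eq]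
    exact ⟨z, List.mem_of_find?_eq_some hf, h1.2⟩

/-- For a user other than the target both sides compute the same thing. For the target, honest and
simulated signatures agree in law off the event that the commitment is already in the table. This
event has probability at most `y.h5.length / q`, since an honest commitment comes from a uniform
scalar. -/
theorem wp_sign_le (hq : addOrderOf P = q) (hs : Sim P v a g y C s h st ord)
    {r : UserRegs} {id : ID} {u : User q G} {b : Bool} {x : ZMod q} {i : ℕ} {m : M}
    (hr : UserRep a s r (id, u, b)) (hu : (id, u, b) ∈ C.users) (hx : u.x = some x)
    (hi : s.msgs[i]? = some m) (hm : (id, m) ∈ st.signed)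
    {F : ZMod q × ZMod q → GameState q t k ID M G → ℝ≥0∞} {c : ℝ≥0∞}
    {K : SimState t k → ℕ → ℕ → Run q t k} (hF : ∀ σ st', F σ st' ≤ 1)
    (hK : ∀ y' C' s' h' st' j l σ, Sim P v a g y' C' s' h' st' ord →
      y'.h5.length ≤ y.h5.length + 1 → s'.scalars[j]? = some σ.1 → s'.scalars[l]? = some σ.2 →
      F σ st' ≤ (K y' j l).accept P (smulPt a P) n s' h' cur + c) :
    wp (sign P m x) st F ≤
      (simSign y r i K).accept P (smulPt a P) n s h cur + (c + y.h5.length / q) := by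
  have hP : q • P = 0 := hq ▸ addOrderOf_nsmul_eq_zero P
  obtain ⟨x', hx', hxr⟩ := hr.x
  obtain rfl : x' = x := Option.some_injective _ (hx'.symm.trans hx)
  simp only [sign, wp_bind, wp_sample, wp_pure, simSign, hr.tgt]
  cases b with
  | false =>
    simp only [Bool.false_eq_true, if_false, sub_zero] at hxr ⊢
    refine le_trans ?_ (add_le_add_right le_self_add _)
    rw [Run.accept_random]
    refine expect_le_add fun ρ => ?_
    have e1 := (Ext.refl hs.counts).pushS ρ
    have r1 := hs.counts.scalar ρ
    rw [Run.accept_mulPt P _ r1 (hs.ext e1).base]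
    have e2 := e1.pushP (smulPt ρ P)
    refine wp_hash5_le _ (hs.ext e2) (getElem?_of_prefix e2.le.msgs hi)
      (e1.counts.point (smulPt ρ P)) fun y' C' s' h' st' e z l hs' hle hlen hsig he _ _ => ?_
    have hxr' := getElem?_of_prefix (e2.le.trans hle).scalars hxr
    have r1' := getElem?_of_prefix (((Machine.Le.refl _).pushPt _).trans hle).scalars r1
    have e3 := (Ext.refl hs'.counts).pushS (z * x')
    have m3 := hs'.counts.scalar (z * x')
    have e4 := e3.pushS (ρ - z * x')
    have m4 := e3.counts.scalar (ρ - z * x')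
    rw [Run.accept_scalarOp P _ he hxr', ScalarOp.eval,
      Run.accept_scalarOp P _ (getElem?_of_prefix e3.le.scalars r1') m3, ScalarOp.eval]
    exact hK _ _ _ _ _ _ _ (ρ - z * x', z) (hs'.ext e4) hlen m4
      (getElem?_of_prefix e4.le.scalars he)
  | true =>
    simp only [if_true] at hxr ⊢
    have hg : ord[g]? = some id := (hs.tgt _ hu).1 rfl
    set T : ZMod q → Prop := fun ρ => st.tableH5 m (smulPt ρ P) ≠ none with hT
    classical
    -- The honest continuation, put to zero on the event of a collision; `step1` pays for this event
    -- once.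
    set H : ZMod q → ZMod q → ℝ≥0∞ := fun ρ e =>
      if T ρ then 0 else F (ρ - e * x', e) (st.setH5 m (smulPt ρ P) e) with hH
    have step1 : ∀ ρ, wp (hash5 m (smulPt ρ P)) st (fun e st' => F (ρ - e * x', e) st') ≤
        (expect (PMF.uniformOfFintype (ZMod q)) fun e => H ρ e) + if T ρ then 1 else 0 := by
      intro ρ
      rw [wp_hash5]
      by_cases hρ : T ρ
      · obtain ⟨e, he⟩ := Option.ne_none_iff_exists'.1 hρ
        rw [if_pos hρ, he]
        exact (hF _ _).trans le_add_self
      · have he : st.tableH5 m (smulPt ρ P) = none := not_not.1 hρ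
        simp only [hH, if_neg hρ, he, add_zero]
        exact le_rfl
    -- For fixed `e` the substitution `ρ = σ + e x'` permutes the scalars: drawing the nonce or the
    -- first part of the signature amounts to the same.
    have step2 : (expect (PMF.uniformOfFintype (ZMod q)) fun ρ =>
        expect (PMF.uniformOfFintype (ZMod q)) fun e => H ρ e) =
        expect (PMF.uniformOfFintype (ZMod q)) fun σ =>
          expect (PMF.uniformOfFintype (ZMod q)) fun e => H (σ + e * x') e := by
      rw [expect_comm]
      conv_rhs => rw [expect_comm]
      congr 1
      funext e
      exact (expect_uniform_equiv (Equiv.addRight (e * x')) fun ρ => H ρ e).symm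
    have step3 : (expect (PMF.uniformOfFintype (ZMod q)) fun ρ => if T ρ then (1 : ℝ≥0∞) else 0) ≤
        y.h5.length / q := by
      have := expect_uniform_le (Finset.univ.filter T)
      simp only [Finset.mem_filter, Finset.mem_univ, true_and, ZMod.card] at this
      rw [this]
      gcongr
      exact hs.card_le hq m
    have step4 : (expect (PMF.uniformOfFintype (ZMod q)) fun σ =>
          expect (PMF.uniformOfFintype (ZMod q)) fun e => H (σ + e * x') e) ≤
        (Run.random <| .random <| simCommit y.pushS.pushS y.c.s (y.c.s + 1) r.x fun y' R =>
          simSearchH5 y' i R (fun _ => .fail)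
            (K { y' with h5 := (i, R, y.c.s + 1, none) :: y'.h5 } y.c.s (y.c.s + 1))).accept
          P (smulPt a P) n s h cur + c := by
      rw [Run.accept_random]
      refine expect_le_add fun σ => ?_
      rw [Run.accept_random]
      refine expect_le_add fun e => ?_
      have e1 := (Ext.refl hs.counts).pushS σ
      have s1 := hs.counts.scalar σ
      have e2 := e1.pushS e
      have s2 : ((s.pushScalar σ).pushScalar e).scalars[y.c.s + 1]? = some e := e1.counts.scalar e
      have s1' := getElem?_of_prefix ((Machine.Le.refl (s.pushScalar σ)).pushScalar e).scalars s1
      obtain ⟨y₃, s₃, R, hacc, e3, p3⟩ := accept_simCommit (n := n) (cur := cur) (hs.ext e2)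
        (smulPt a P) s1' s2 (getElem?_of_prefix e2.le.scalars hxr)
        (fun y' R => simSearchH5 y' i R (fun _ => .fail)
            (K { y' with h5 := (i, R, y.c.s + 1, none) :: y'.h5 } y.c.s (y.c.s + 1)))
      have hpt : smulPt σ P + smulPt e (smulPt (x' - a) P + smulPt a P) =
          smulPt (σ + e * x') P := by
        rw [← smulPt_add hP, sub_add_cancel, ← smulPt_mul hP, ← smulPt_add hP]
      rw [hpt] at p3
      have e23 := e2.trans e3
      have hs3 := hs.ext e23
      change H (σ + e * x') e ≤ (simCommit y.pushS.pushS y.c.s (y.c.s + 1) r.x _).accept _ _ _ _ _ _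
        + c
      rw [hacc]
      rcases accept_simSearchH5 (n := n) (cur := cur) (smulPt a P) hs3
        (getElem?_of_prefix e23.le.msgs hi) p3 (fun _ => .fail)
        (K { y₃ with h5 := (i, R, y.c.s + 1, none) :: y₃.h5 } y.c.s (y.c.s + 1)) with
        ⟨_, z, _, _, _, _, hz, _⟩ | ⟨hz, hacc'⟩
      -- Here the simulator fails, but `H` vanishes at a collision, so there is nothing to compare.
      · simp [hH, hT, hz]
      · rw [hacc']
        have hH' : H (σ + e * x') e = F (σ, e) (st.setH5 m (smulPt (σ + e * x') P) e) := by
          simp [hH, hT, hz]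
        rw [hH']
        refine hK _ _ _ _ _ _ _ (σ, e) (hs3.setH5 (getElem?_of_prefix e23.le.msgs hi) p3
          (getElem?_of_prefix e3.le.scalars s2) List.prefix_rfl hs3.d
          (hs3.d_le.trans (Nat.le_succ _)) (by simp) fun _ => ⟨id, hg, hm⟩) ?_
          (getElem?_of_prefix e3.le.scalars s1') (getElem?_of_prefix e3.le.scalars s2)
        simp [e23.h5]
    calc _ ≤ expect (PMF.uniformOfFintype (ZMod q)) fun ρ =>
          (expect (PMF.uniformOfFintype (ZMod q)) fun e => H ρ e) + if T ρ then 1 else 0 :=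
          expect_mono step1
      _ ≤ _ := by
          rw [expect_add, step2, ← add_assoc]
          exact add_le_add step4 step3

/-- Off the target the left side is zero. On the target the simulator recomputes the commitment of
the verification from the known part `x - a`, and an accepted forgery is a `Claim` about the `hash`
node behind its entry. -/
theorem wp_finale_le (hq : addOrderOf P = q) (hs : Sim P v a g y C s h st ord)
    {r : UserRegs} {id : ID} {u : User q G} {b : Bool} {i j l : ℕ} {m : M} {σ : ZMod q × ZMod q}
    (hr : UserRep a s r (id, u, b)) (hu : (id, u, b) ∈ C.users)
    (hi : s.msgs[i]? = some m) (hj : s.scalars[j]? = some σ.1) (hl : s.scalars[l]? = some σ.2)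
    (hn : y.h5.length < n) :
    (wp (verify P (masterPublicKey P v) m id u.Q σ) st fun valid st' =>
      if (valid && decide (id ∉ st'.corrupted) && decide (id ∉ st'.partKeyed)
        && decide ((id, m) ∉ st'.signed)) = true ∧ ord[g]? = some id then 1 else 0) ≤
      (simForge y r i j l).accept P (smulPt a P) n s h cur := by
  have hP : q • P = 0 := hq ▸ addOrderOf_nsmul_eq_zero P
  cases b with
  | false =>
    have hg : ord[g]? ≠ some id := fun h' => by simpa using (hs.tgt _ hu).2 h'
    simp [hg, wp]
  | true =>
    have hg : ord[g]? = some id := (hs.tgt _ hu).1 rfl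
    obtain ⟨x, h1, h2⟩ := hr.x
    obtain ⟨x', f, h3, h4, h5⟩ := hs.key _ hu
    obtain rfl : x = x' := Option.some_injective _ (h1.symm.trans h3)
    simp only [if_true] at h2 h4 h5
    simp only [verify, wp_bind, wp_pure, wp_hash1, h4, h5, simForge, hr.tgt, if_true]
    obtain ⟨y₁, s₁, R, hacc, e1, p1⟩ := accept_simCommit (n := n) (cur := cur) hs (smulPt a P)
      hj hl h2 (fun y R => simHash y i R fun _ e' o => simCheck j l r.x e' o)
    have hpt : smulPt (x - a) P + smulPt a P = smulPt x P := by
      rw [← smulPt_add hP, sub_add_cancel]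
    rw [hacc, ← add_zero (Run.accept ..)]
    rw [hpt] at p1
    refine wp_hash5_le _ (hs.ext e1) (getElem?_of_prefix e1.le.msgs hi) p1
      fun y₂ C₂ s₂ h' st₂ e z o hs2 hle hlen hsig he hmem hlt => ?_
    rw [add_zero]
    cases o with
    | none =>
      -- The entry was made for a simulated signature, so this message was signed for the target and
      -- the forgery does not count.
      obtain ⟨id', hg', hsg⟩ := hs2.programmed _ hmem rfl
      obtain rfl : id = id' := Option.some_injective _ (hg.symm.trans hg')
      simp [hsg]
    | some o =>
      have hl2 := getElem?_of_prefix (e1.le.trans hle).scalars hl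
      have hj2 := getElem?_of_prefix (e1.le.trans hle).scalars hj
      have hx2 := getElem?_of_prefix (e1.le.trans hle).scalars h2
      have hev : (EqTest.scalar l e).eval s₂ = some (decide (σ.2 = z)) := by
        simp [EqTest.eval, hl2, he]
      simp only [simCheck]
      rw [Run.accept_test P _ hev]
      by_cases hz : σ.2 = z
      · subst hz
        have hcl : Claim P (smulPt a P) h' o (σ.1, σ.2) (x - a) := by
          rw [Claim, hs2.hist _ hmem o rfl, hpt]
        -- The verification may itself open the last node; its number is still at most the size of
        -- the table before, which is less than `n`.
        have hon : o < n := (hlt o rfl).trans_lt (by rw [e1.h5]; exact hn)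
        have : (Run.done o j l r.x : Run q t k).accept P (smulPt a P) n s₂ h' cur = 1 := by
          simp only [Run.accept, Run.tree, hj2, hl2, hx2]
          rw [if_pos ⟨hcl, hon⟩]
          rfl
        rw [decide_eq_true rfl, if_pos rfl, this]
        split_ifs <;> simp
      · simp [hz]

theorem Run.accept_inspect_ask (P X : G) (w : ℕ) (c : Query ID M G)
    (next : c.Answer q t k → Strategy q t k ID M G) (p : Option OracleKind → Run q t k) :
    (Run.inspect p).accept P X n s h (.ask w c next) =
      (p (some c.kind)).accept P X n (s.pushQuery c) h (.ask w c next) := rfl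

theorem Run.le_accept_reply {X : G} {w : ℕ} {c : Query ID M G}
    {next : c.Answer q t k → Strategy q t k ID M G} {r : Reply t k} {x : c.Answer q t k}
    {p : Run q t k} {W b : ℝ≥0∞} (hr : s.answer? c r = some x)
    (hW : W ≤ p.accept P X n s h (next x) + b) :
    W ≤ (Run.reply r p).accept P X n s h (.ask w c next) + b := by
  simpa [accept, tree, hr] using hW

/-- The representation says nothing about the two forbidden lists and refers to the signed pairs
only by membership, so these may only grow. -/
theorem Sim.setLists (hs : Sim P v a g y C s h st ord) (l₁ l₂ : List ID) {l₃ : List (ID × M)}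
    (hl : ∀ z ∈ st.signed, z ∈ l₃) :
    Sim P v a g y C s h { st with corrupted := l₁, partKeyed := l₂, signed := l₃ } ord :=
  { hs with
    programmed := fun c hc hn => by
      obtain ⟨i, h1, h2⟩ := hs.programmed c hc hn
      exact ⟨i, h1, hl _ h2⟩ }

theorem totalQueries_update {B : OracleKind → ℕ} {o : OracleKind} (h : 0 < B o) :
    totalQueries (Function.update B o (B o - 1)) + 1 = totalQueries B := by
  cases o <;> simp [totalQueries] <;> omega

section Oracles

variable (S : Scheme) (o : Option (ZMod q)) (id : ID) (m : M)

theorem wp_oracleWith_pubKey (f : G × G → GameState q t k ID M G → ℝ≥0∞) :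
    wp (oracleWith S P v o (.pubKey id)) st f =
      wp (userWith S P v o id) st fun u st' => f (u.U, u.Q) st' := by
  refine (wp_bind _ _).trans ?_
  congr 1
  funext u st'
  exact wp_pure _

theorem wp_oracleWith_partKey (f : ZMod q × G → GameState q t k ID M G → ℝ≥0∞) :
    wp (oracleWith S P v o (.partKey id)) st f = wp (userWith S P v o id) st fun u st' =>
      f (u.w, u.Q) { st' with partKeyed := id :: st'.partKeyed } := by
  refine (wp_bind _ _).trans ?_
  congr 1
  funext u st'
  refine (wp_bind _ _).trans ?_
  rw [wp_modify]
  exact wp_pure _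

theorem wp_oracleWith_secKey (f : ZMod q → GameState q t k ID M G → ℝ≥0∞) :
    wp (oracleWith S P v o (.secKey id)) st f =
      wp (userWith S P v o id) st fun u st' => f u.α st' := by
  refine (wp_bind _ _).trans ?_
  congr 1
  funext u st'
  exact wp_pure _

theorem wp_oracleWith_corrupt (f : Option (ZMod q) → GameState q t k ID M G → ℝ≥0∞) :
    wp (oracleWith S P v o (.corrupt id)) st f = wp (userWith S P v o id) st fun u st' =>
      f u.x { st' with corrupted := id :: st'.corrupted } := by
  refine (wp_bind _ _).trans ?_
  congr 1
  funext u st'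
  refine (wp_bind _ _).trans ?_
  rw [wp_modify]
  exact wp_pure _

theorem wp_oracleWith_sign (f : Option (ZMod q × ZMod q) → GameState q t k ID M G → ℝ≥0∞) :
    wp (oracleWith S P v o (.sign id m)) st f = wp (userWith S P v o id) st fun u st' =>
      match u.x with
      | some x => wp (sign P m x) { st' with signed := (id, m) :: st'.signed } fun σ => f (some σ)
      | none => f none { st' with signed := (id, m) :: st'.signed } := by
  refine (wp_bind _ _).trans ?_
  congr 1
  funext u st'
  refine (wp_bind _ _).trans ?_
  rw [wp_modify]
  cases u.x with
  | none => exact wp_pure _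
  | some x =>
    refine (wp_bind _ _).trans ?_
    congr 1
    funext σ st''
    exact wp_pure _

end Oracles

/-- The experiment with the target number `g` is won with at most the probability that the
simulation succeeds, plus the probability that the simulation of a signature fails. -/
theorem winWith_le_accept (hq : addOrderOf P = q) (S : Scheme) {H : ℕ} (hn : H < n)
    (σ : Strategy q t k ID M G) (f : ℕ) (B : OracleKind → ℕ) (y : SimState t k)
    (C : Tables q t k ID M G) (s : Machine q t k ID M G) (h : List (G × ZMod q))
    (st : GameState q t k ID M G) (ord : List ID) (hs : Sim P v a g y C s h st ord)
    (hB : σ.QueriesWithin B) (hH : y.h5.length + B .h5 + B .sign ≤ H) (hf : totalQueries B < f) :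
    winWith S P v g (some a) σ st ord ≤
      (simRun g S f y).accept P (smulPt a P) n s h σ + B .sign * (H / q) := by
  have hP : q • P = 0 := hq ▸ addOrderOf_nsmul_eq_zero P
  induction σ generalizing f B y C s h st ord with
  | forge w id m σ =>
    -- The fuel `f` exceeds the number of remaining queries: one unit is left for the forgery.
    obtain _ | f := f
    · omega
    rw [winWith]
    refine le_trans ?_ le_self_add
    have he := (Ext.refl hs.counts).pushForgery id m σ
    have hi := hs.counts.pushI id
    have hs' := hs.ext he
    have : ∀ p : Option OracleKind → Run q t k,
        (Run.inspect p).accept P (smulPt a P) n s h (.forge w id m σ) = (p none).accept P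
          (smulPt a P) n ((((s.pushID id).pushMsg m).pushScalar σ.1).pushScalar σ.2) h
          (.forge w id m σ) := fun _ => rfl
    rw [simRun, this, ← add_zero (Run.accept ..)]
    simp only [finale, wp_bind (userWith S P v _ id)]
    refine wp_userWith_le hP _ hs' S (i := y.c.i) (by simp [Machine.pushID, Machine.pushScalar,
      Machine.pushMsg, hs.counts.ids]) fun y' C' s' st' r u b hs'' hle h5 hr hu => ?_
    rw [add_zero]
    simp only [wp_bind, wp_pure, wp_get]
    refine wp_finale_le hq hs'' hr hu (getElem?_of_prefix hle.msgs ?_)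
      (getElem?_of_prefix hle.scalars ?_) (getElem?_of_prefix hle.scalars ?_) ?_
    · simp [Machine.pushID, Machine.pushScalar, Machine.pushMsg, hs.counts.msgs]
    · simp [Machine.pushID, Machine.pushScalar, Machine.pushMsg, hs.counts.scalars]
    · simp [Machine.pushID, Machine.pushScalar, Machine.pushMsg, hs.counts.scalars]
    · rw [h5]
      simp only [SimState.pushMessage]
      omega
  | ask w c next ih =>
    obtain _ | f := f
    · omega
    have hpos := hB.1
    have hnext := hB.2
    have htot := totalQueries_update hpos
    rw [winWith, simRun, Run.accept_inspect_ask]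
    have he := (Ext.refl hs.counts).pushQuery c
    have hs' := hs.ext he
    have hid : ∀ i, c.ident = some i → (s.pushQuery c).ids[y.c.i]? = some i := by
      intro i hc
      cases c <;> cases hc <;> simp [Machine.pushQuery, Machine.pushID, Machine.pushMsg,
        hs.counts.ids]
    have hh5 : (y.pushMessage (some c.kind)).h5 = y.h5 := rfl
    have hlt : totalQueries (Function.update B c.kind (B c.kind - 1)) < f := by omega
    cases c with
    | h1 id Q =>
      refine wp_hash1_le _ hs' (i := y.c.i) (r := y.c.p)
        (by simp [Machine.pushQuery, Machine.pushID, Machine.pushPt, hs.counts.ids])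
        (by simp [Machine.pushQuery, Machine.pushID, Machine.pushPt, hs.counts.points])
        fun y' C' st' j hs'' _ h5 _ _ _ _ => ?_
      refine Run.le_accept_reply (c := .h1 id Q) (x := j) rfl ?_
      exact ih j f (Function.update B .h1 (B .h1 - 1)) y' C' _ h st' ord hs'' (hnext j)
        (by rw [h5, hh5]; exact hH) hlt
    | h5 m R =>
      refine wp_hash5_le _ hs' (i := y.c.m) (r := y.c.p)
        (by simp [Machine.pushQuery, Machine.pushMsg, Machine.pushPt, hs.counts.msgs])
        (by simp [Machine.pushQuery, Machine.pushMsg, Machine.pushPt, hs.counts.points])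
        fun y' C' s' h' st' e x l hs'' _ hlen _ hx _ _ => ?_
      refine Run.le_accept_reply (c := .h5 m R) (x := x) hx ?_
      rw [hh5] at hlen
      exact ih x f (Function.update B .h5 (B .h5 - 1)) y' C' s' h' st' ord hs'' (hnext x)
        (by simp [Query.kind] at hpos ⊢; omega) hlt
    | pubKey id =>
      refine (wp_oracleWith_pubKey S _ id _).le.trans ?_
      refine wp_userWith_le hP _ hs' S (hid id rfl) fun y' C' s' st' r u b hs'' _ h5 hr _ => ?_
      have ha : s'.answer? (.pubKey id) (.pubKey r.U r.Q) = some (u.U, u.Q) := by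
        rw [Machine.answer?, hr.U, hr.Q]
        rfl
      exact Run.le_accept_reply ha (ih _ f (Function.update B .pubKey (B .pubKey - 1)) y' C' s' h st' _ hs'' (hnext _)
        (by rw [h5, hh5]; exact hH) hlt)
    | secKey id =>
      refine (wp_oracleWith_secKey S _ id _).le.trans ?_
      refine wp_userWith_le hP _ hs' S (hid id rfl) fun y' C' s' st' r u b hs'' _ h5 hr _ => ?_
      have ha : s'.answer? (.secKey id) (.secKey r.α) = some u.α := hr.α
      exact Run.le_accept_reply ha (ih _ f (Function.update B .secKey (B .secKey - 1)) y' C' s' h st' _ hs'' (hnext _)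
        (by rw [h5, hh5]; exact hH) hlt)
    | partKey id =>
      refine (wp_oracleWith_partKey S _ id _).le.trans ?_
      refine wp_userWith_le hP _ hs' S (hid id rfl) fun y' C' s' st' r u b hs'' _ h5 hr hu => ?_
      rw [hr.tgt]
      cases b with
      | true =>
        -- The simulator stops here; the experiment with this target can no longer be won, so the
        -- left side is zero.
        have h0 : ∀ σ : Strategy q t k ID M G, winWith S P v g (some a) σ
            { st' with partKeyed := id :: st'.partKeyed } (created st ord (some id)) = 0 :=
          fun σ => winWith_eq_zero S P v _ σ _ _ ((hs''.tgt _ hu).1 rfl)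
            (Or.inr (List.mem_cons_self ..))
        exact (h0 _).trans_le zero_le
      | false =>
        have hw := hr.w
        simp only [Bool.false_eq_true, if_false, sub_zero] at hw
        have ha : s'.answer? (.partKey id) (.partKey r.w r.Q) = some (u.w, u.Q) := by
          rw [Machine.answer?, hw, hr.Q]
          rfl
        exact Run.le_accept_reply ha (ih _ f (Function.update B .partKey (B .partKey - 1)) y' C' s' h _ _
          (hs''.setLists st'.corrupted (id :: st'.partKeyed) (fun _ h => h)) (hnext _)
          (by rw [h5, hh5]; exact hH) hlt)
    | corrupt id =>
      refine (wp_oracleWith_corrupt S _ id _).le.trans ?_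
      refine wp_userWith_le hP _ hs' S (hid id rfl) fun y' C' s' st' r u b hs'' _ h5 hr hu => ?_
      rw [hr.tgt]
      cases b with
      | true =>
        have h0 : ∀ σ : Strategy q t k ID M G, winWith S P v g (some a) σ
            { st' with corrupted := id :: st'.corrupted } (created st ord (some id)) = 0 :=
          fun σ => winWith_eq_zero S P v _ σ _ _ ((hs''.tgt _ hu).1 rfl)
            (Or.inl (List.mem_cons_self ..))
        exact (h0 _).trans_le zero_le
      | false =>
        obtain ⟨x, hx, hxr⟩ := hr.x
        simp only [Bool.false_eq_true, if_false, sub_zero] at hx hxr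
        have ha : s'.answer? (.corrupt id) (.corrupt r.x) = some u.x := by
          rw [Machine.answer?, hxr, hx]
          rfl
        exact Run.le_accept_reply ha (ih _ f (Function.update B .corrupt (B .corrupt - 1)) y' C' s' h _ _
          (hs''.setLists (id :: st'.corrupted) st'.partKeyed (fun _ h => h)) (hnext _)
          (by rw [h5, hh5]; exact hH) hlt)
    | sign id m =>
      refine (wp_oracleWith_sign S _ id m _).le.trans ?_
      refine wp_userWith_le hP _ hs' S (hid id rfl) fun y' C' s' st' r u b hs'' hle h5 hr hu => ?_
      obtain ⟨x, hx, -⟩ := hr.x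
      simp only [] at hx
      rw [hx]
      dsimp only
      simp only [Query.kind] at hpos hnext htot
      obtain ⟨B', hB'⟩ : ∃ B', B .sign = B' + 1 := ⟨B .sign - 1, by omega⟩
      have hmsg : s'.msgs[y.c.m]? = some m := getElem?_of_prefix hle.msgs
        (by simp [Machine.pushQuery, Machine.pushID, Machine.pushMsg, hs.counts.msgs])
      rw [hh5] at h5
      refine (wp_sign_le (n := n) (cur := .ask w (.sign id m) next) (c := B' * (H / q)) hq (hs''.setLists st'.corrupted st'.partKeyed
        (l₃ := (id, m) :: st'.signed) (fun _ h => List.mem_cons_of_mem _ h)) hr hu hx hmsg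
        (List.mem_cons_self ..) (K := fun y'' s e => .reply (.sign s e) (simRun g S f y''))
        (fun _ _ => winWith_le_one _ _ _ _ _ _ _ _) ?_).trans ?_
      · intro y₂ C₂ s₂ h₂ st₂ j l σ hs₂ hlen hj hl
        have ha : s₂.answer? (.sign id m) (.sign j l) = some (some σ) := by
          rw [Machine.answer?, hj, hl]
          rfl
        have hBs : Function.update B .sign (B .sign - 1) .sign = B' := by simp [hB']
        refine Run.le_accept_reply ha ?_
        have := ih (some σ) f _ y₂ C₂ s₂ h₂ st₂ _ hs₂ (hnext _)
          (by rw [h5] at hlen; simp; omega) (by omega)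
        rwa [hBs] at this
      · rw [hB']
        -- The remaining signatures account for `B' * (H / q)`. The present one adds its collision
        -- bound, in which the size of the table is replaced by the final bound `H`.
        have : (y'.h5.length : ℝ≥0∞) / q ≤ H / q := by
          gcongr
          rw [h5]
          omega
        push_cast
        rw [add_mul, one_mul]
        gcongr

end Reduction

/-! ## Running time of the simulation -/

section Cost

variable {q t k : ℕ} [NeZero t]

/-- The tables of the simulator have at most `n` entries. -/
structure SimState.Size (y : SimState t k) (n : ℕ) : Prop where
  h1 : y.h1.length ≤ n
  h5 : y.h5.length ≤ n
  users : y.users.length ≤ n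

variable {y : SimState t k} {n m : ℕ}

theorem SimState.Size.succ (h : y.Size n) : y.Size (n + 1) :=
  ⟨h.h1.trans n.le_succ, h.h5.trans n.le_succ, h.users.trans n.le_succ⟩

theorem Run.CostLE.op {p : Run q t k} (h : p.CostLE m) (o : Instr q) :
    (Run.op o p).CostLE (m + 1) := ⟨m, h, le_rfl⟩

theorem Run.CostLE.random {p : Run q t k} (h : p.CostLE m) : (Run.random p).CostLE (m + 1) :=
  ⟨m, h, le_rfl⟩

theorem Run.CostLE.hash {p : Run q t k} (h : p.CostLE m) (R : ℕ) :
    (Run.hash R p).CostLE (m + 1) := ⟨m, h, le_rfl⟩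

theorem Run.CostLE.test {yes no : Run q t k} (h : yes.CostLE m) (h' : no.CostLE m) (c : EqTest) :
    (Run.test c yes no).CostLE (m + 1) := ⟨m, h, h', le_rfl⟩

theorem Run.CostLE.reply {p : Run q t k} (h : p.CostLE m) (r : Reply t k) :
    (Run.reply r p).CostLE (m + (k + 1)) := ⟨m, h, le_rfl⟩

theorem Run.CostLE.scan {α : Type} {test : α → Run q t k → Run q t k → Run q t k} {w : ℕ}
    (htest : ∀ x yes no m, yes.CostLE m → no.CostLE m → (test x yes no).CostLE (m + w))
    {yes : α → Run q t k} {no : Run q t k} (hyes : ∀ x, (yes x).CostLE m) (hno : no.CostLE m)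
    (l : List α) : (Run.scan test l yes no).CostLE (m + w * l.length) := by
  induction l with
  | nil => exact hno
  | cons x l ih =>
    rw [List.length_cons, mul_add, mul_one, ← add_assoc]
    exact htest x _ _ _ ((hyes x).mono (by omega)) ih

theorem Run.CostLE.branchVec (l : ℕ) {K : (Fin l → Fin t) → Run q t k}
    (hK : ∀ j, (K j).CostLE m) : (Run.branchVec l K).CostLE (m + l * t) := by
  induction l generalizing m with
  | zero => exact (hK _).mono (by omega)
  | succ l ih =>
    refine ⟨m + l * t, fun i => ih fun f => hK _, ?_⟩
    rw [Nat.sub_add_cancel NeZero.one_le, add_mul, one_mul, add_assoc]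

theorem costLE_simSum (l : List ℕ) (r : ℕ) {K : SimState t k → ℕ → Run q t k} (hy : y.Size n)
    (hK : ∀ y' r, y'.Size n → (K y' r).CostLE m) :
    (simSum l r y K).CostLE (m + l.length) := by
  induction l generalizing r y with
  | nil => exact hK y r hy
  | cons i l ih => exact (ih _ (y := y.pushS) ⟨hy.h1, hy.h5, hy.users⟩).op _

theorem costLE_simH1 (id Q : ℕ) {K : SimState t k → (Fin k → Fin t) → Run q t k} (hy : y.Size n)
    (hK : ∀ y' j, y'.Size (n + 1) → (K y' j).CostLE m) :
    (simH1 y id Q K).CostLE (m + (k * t + 2 * n)) := by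
  have := Run.CostLE.scan (m := m + k * t) (w := 2)
    (test := fun (e : ℕ × ℕ × (Fin k → Fin t)) (yes no : Run q t k) =>
      .test (.id e.1 id) (.test (.pt e.2.1 Q) yes no) no)
    (fun x yes no m h1 h2 => (h1.test h2 _).test (h2.mono m.le_succ) _)
    (yes := fun e => K y e.2.2) (fun x => (hK y _ hy.succ).mono (by omega))
    (Run.CostLE.branchVec k (K := fun j => K { y with h1 := (id, Q, j) :: y.h1 } j) fun j => hK _ j
      ⟨Nat.succ_le_succ hy.h1, hy.h5.trans n.le_succ, hy.users.trans n.le_succ⟩) y.h1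
  refine this.mono ?_
  have := hy.h1
  omega

theorem costLE_simSearchH5 (i R : ℕ) {yes : ℕ × ℕ × ℕ × Option ℕ → Run q t k} {no : Run q t k}
    (hy : y.Size n) (hyes : ∀ x, (yes x).CostLE m) (hno : no.CostLE m) :
    (simSearchH5 y i R yes no).CostLE (m + 2 * n) := by
  refine (Run.CostLE.scan (m := m) (w := 2)
    (fun x yes no m h1 h2 => (h1.test h2 _).test (h2.mono m.le_succ) _) hyes hno y.h5).mono ?_
  have := hy.h5
  omega

theorem costLE_simHash (i R : ℕ) {K : SimState t k → ℕ → Option ℕ → Run q t k} (hy : y.Size n)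
    (hK : ∀ y' e o, y'.Size (n + 1) → (K y' e o).CostLE m) :
    (simHash y i R K).CostLE (m + (2 * n + 1)) := by
  refine (costLE_simSearchH5 (m := m + 1) i R hy (fun x => (hK y _ _ hy.succ).mono m.le_succ)
    ((hK _ _ _ ?_).hash R)).mono (by omega)
  exact ⟨hy.h1.trans n.le_succ, Nat.succ_le_succ hy.h5, hy.users.trans n.le_succ⟩

/-- Scanning the users costs `n`, the query to `H₁` costs `k * t + 2 * n`, and the sum of master
scalars costs `k`. The `8` is one for `α`, one for `U`, two for `β`, one for `Q`, one for the
initial zero and two for the last additions. -/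
theorem costLE_simUser (g : ℕ) (S : Scheme) (id : ℕ) {K : SimState t k → UserRegs → Run q t k}
    (hy : y.Size n) (hK : ∀ y' u, y'.Size (n + 2) → (K y' u).CostLE m) :
    (simUser g S y id K).CostLE (m + (k * t + k + 3 * n + 8)) := by
  have hsec : ∀ (m : ℕ) (K : SimState t k → ℕ → Run q t k), (K y.pushS y.c.s).CostLE m →
      (simSecret S y K).CostLE (m + 1) := by
    intro m K h
    cases S
    exacts [h.random, h.op _]
  have hbeta : ∀ (m : ℕ) (b : Bool) (z : SimState t k) (K : SimState t k → ℕ → ℕ → Run q t k),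
      z.Size n → (∀ y' r W, y'.Size n → (K y' r W).CostLE m) →
      (simBeta b z K).CostLE (m + 2) := by
    intro m b z K hz h
    have hz' : z.pushS.Size n := ⟨hz.h1, hz.h5, hz.users⟩
    unfold simBeta
    cases b
    · exact Run.CostLE.random (Run.CostLE.op (h z.pushS.pushP _ _ ⟨hz.h1, hz.h5, hz.users⟩) _)
    · exact Run.CostLE.mono (Run.CostLE.op (h _ _ _ hz') _) (by omega)
  have hnew : (simNewUser g S y id K).CostLE (m + (k * t + k + 2 * n + 8)) := by
    unfold simNewUser
    refine Run.CostLE.mono (hsec (m + 2 + k + 1 + (k * t + 2 * n) + 1 + 2 + 1) _ (Run.CostLE.op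
      (hbeta (m + 2 + k + 1 + (k * t + 2 * n) + 1) _ _ _ ?_ fun y' β W hy' => Run.CostLE.op
      (costLE_simH1 (m := m + 2 + k + 1) _ _ (y := y'.pushP) ⟨hy'.h1, hy'.h5, hy'.users⟩
        fun y'' j hy'' => Run.CostLE.op (m := m + 2 + k) ?_ _) _) _)) (by omega)
    · exact ⟨hy.h1, hy.h5, hy.users⟩
    refine (costLE_simSum (m := m + 2) _ _ (y := y''.pushS) ⟨hy''.h1, hy''.h5, hy''.users⟩
      fun z r hz => ((hK _ _ ?_).op _).op _).mono (by simp)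
    exact ⟨hz.h1.trans (by omega), hz.h5.trans (by omega),
      Nat.succ_le_succ (hy.users.trans (by omega))⟩
  refine (Run.CostLE.scan (m := m + (k * t + k + 2 * n + 8)) (w := 1)
    (fun x yes no m h1 h2 => h1.test h2 _)
    (fun u => (hK y u hy.succ.succ).mono (by omega)) hnew y.users).mono ?_
  have := hy.users
  omega

theorem costLE_simCommit (s e x : ℕ) {K : SimState t k → ℕ → Run q t k} (hy : y.Size n)
    (hK : ∀ y' R, y'.Size n → (K y' R).CostLE m) : (simCommit y s e x K).CostLE (m + 5) := by
  unfold simCommit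
  exact ((((Run.CostLE.op
    (hK y.pushP.pushP.pushP.pushP.pushP _ ⟨hy.h1, hy.h5, hy.users⟩) _).op _).op _).op _).op _

/-- The target's signature is the expensive case: two draws, five instructions for the commitment
and a scan with two tests for each entry. -/
theorem costLE_simSign (u : UserRegs) (i : ℕ) {K : SimState t k → ℕ → ℕ → Run q t k}
    (hy : y.Size n) (hK : ∀ y' s e, y'.Size (n + 1) → (K y' s e).CostLE m) :
    (simSign y u i K).CostLE (m + (2 * n + 7)) := by
  rw [simSign]
  split_ifs
  · refine Run.CostLE.mono (m := m + 2 * n + 5 + 1 + 1) (Run.CostLE.random (Run.CostLE.random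
      (costLE_simCommit _ _ _ (y := y.pushS.pushS) ⟨hy.h1, hy.h5, hy.users⟩ fun y' R hy' =>
      costLE_simSearchH5 (m := m) i R hy' (fun _ => trivial) (hK _ _ _ ?_)))) (by omega)
    exact ⟨hy'.h1.trans n.le_succ, Nat.succ_le_succ hy'.h5, hy'.users.trans n.le_succ⟩
  · exact Run.CostLE.mono (m := m + 2 + (2 * n + 1) + 1 + 1)
      (Run.CostLE.random (Run.CostLE.op (costLE_simHash (m := m + 2) _ _
      (y := y.pushS.pushP) ⟨hy.h1, hy.h5, hy.users⟩ fun y' e o hy' =>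
      ((hK y'.pushS.pushS _ _ ⟨hy'.h1, hy'.h5, hy'.users⟩).op _).op _) _)) (by omega)

theorem costLE_simForge (u : UserRegs) (i s e : ℕ) (hy : y.Size n) :
    (simForge y u i s e : Run q t k).CostLE (2 * n + 7) := by
  rw [simForge]
  split_ifs
  · refine (costLE_simCommit (m := 1 + (2 * n + 1)) _ _ _ hy fun y' R hy' =>
      costLE_simHash _ _ hy' fun y'' e' o _ => ?_).mono (by omega)
    cases o with
    | none => trivial
    | some o => exact ⟨0, trivial, trivial, le_rfl⟩
  · trivial

-- Signing is the most expensive round: `1` for `inspect`, `k * t + k + 3 * n + 8` for the user, `2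
-- * (n + 2) + 7` for the signature and `k + 1` for the answer, in total `5 * n + k * t + 2 * k +
-- 21`. A round enlarges each table by at most `3`, so `n + 3 * f` bounds the size throughout.
set_option maxHeartbeats 1000000 in
theorem costLE_simRun (g : ℕ) (S : Scheme) (f : ℕ) (hy : y.Size n) :
    (simRun g S f y : Run q t k).CostLE (f * (5 * (n + 3 * f) + k * t + 2 * k + 21)) := by
  induction f generalizing y n with
  | zero => trivial
  | succ f ih =>
    set E := 5 * (n + 3 * (f + 1)) + k * t + 2 * k + 21 with hE
    have hrun : ∀ y' : SimState t k, y'.Size (n + 3) → (simRun g S f y' : Run q t k).CostLE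
        (f * E) := fun y' hy' => (ih hy').mono (Nat.mul_le_mul_left _ (by omega))
    have hrep : ∀ (r : Reply t k) (y' : SimState t k), y'.Size (n + 3) →
        (Run.reply r (simRun g S f y') : Run q t k).CostLE (f * E + (k + 1)) := fun r y' hy' =>
      (hrun y' hy').reply r
    have hfin : f * E + (5 * n + k * t + 2 * k + 21) ≤ (f + 1) * E := by
      rw [add_mul, one_mul]
      omega
    refine Run.CostLE.mono (m := f * E + (5 * n + k * t + 2 * k + 20) + 1) ⟨_, fun o => ?_, le_rfl⟩
      (by omega)
    have hz : (y.pushMessage o).Size n := ⟨hy.h1, hy.h5, hy.users⟩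
    rcases o with _ | o
    · exact (costLE_simUser (m := 2 * (n + 2) + 7) g S _ hz fun y' u hy' =>
        costLE_simForge u _ _ _ hy').mono (by omega)
    · have huser : ∀ r : SimState t k → UserRegs → Run q t k,
          (∀ y' u, y'.Size (n + 2) → (r y' u).CostLE (f * E + (2 * (n + 2) + 7 + (k + 1)))) →
          (simUser g S (y.pushMessage (some o)) y.c.i r).CostLE
            (f * E + (5 * n + k * t + 2 * k + 20)) := fun r hr =>
        (costLE_simUser g S _ hz hr).mono (by omega)
      cases o with
      | h1 =>
        exact (costLE_simH1 _ _ hz fun y' j hy' => hrep _ _ hy'.succ.succ).mono (by omega)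
      | h5 =>
        exact (costLE_simHash _ _ hz fun y' e _ hy' => hrep _ _ hy'.succ.succ).mono (by omega)
      | pubKey => exact huser _ fun y' u hy' => Run.CostLE.mono (hrep _ _ hy'.succ) (by omega)
      | secKey => exact huser _ fun y' u hy' => Run.CostLE.mono (hrep _ _ hy'.succ) (by omega)
      | partKey =>
        refine huser _ fun y' u hy' => ?_
        split_ifs
        · trivial
        · exact (hrep _ _ hy'.succ).mono (by omega)
      | corrupt =>
        refine huser _ fun y' u hy' => ?_
        split_ifs
        · trivial
        · exact (hrep _ _ hy'.succ).mono (by omega)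
      | sign =>
        refine huser (fun y' u => simSign y' u y.c.m fun y'' s e =>
          .reply (.sign s e) (simRun g S f y'')) fun y' u hy' => ?_
        have := costLE_simSign (m := f * E + (k + 1)) u y.c.m hy'
          (K := fun y'' s e => .reply (.sign s e) (simRun g S f y''))
          fun y'' s e hy'' => hrep (.sign s e) y'' hy''
        exact this.mono (by omega)

end Cost

/-! ## The algorithm for the discrete logarithm problem -/

section Solver

variable {q t k : ℕ}

/-- Draw `n` scalars. -/
def Prog.randoms : ℕ → Prog q t k → Prog q t k
  | 0, p => p
  | n + 1, p => .random (Prog.randoms n p)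

/-- Multiply the first point by the scalars in some registers. -/
def Prog.multiples : List ℕ → Prog q t k → Prog q t k
  | [], p => p
  | i :: l, p => .mulPt i 0 (Prog.multiples l p)

/-- The simulator with its input: the master secret key in the first `t` scalar registers, the
instance of the discrete logarithm problem and the master public key in the first `t + 2` point
registers, and one suspended run. -/
def SimState.start (t k : ℕ) : SimState t k := ⟨⟨t, t + 2, 0, 0, 1⟩, [], [], [], 0⟩

/-- Guess the target, simulate the experiment, and rewind the adversary. -/
def solver (q : ℕ) [NeZero t] (S : Scheme) (B : OracleKind → ℕ) : Prog q t k :=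
  .branch (B .pubKey + B .partKey + B .secKey + B .corrupt + B .sign) fun g =>
  .randoms t <| .multiples (List.ofFn fun i : Fin t => (i : ℕ)) <| .start (fun i => i + 2) <|
  (simRun g S (totalQueries B + 1) (SimState.start t k)).compile rewind 0 []
    ⟨List.range t, List.range (t + 2), [], []⟩ (SimState.start t k).c

variable [Fact q.Prime] {ID M G : Type} [DecidableEq ID] [DecidableEq M] [AddCommGroup G]
  [DecidableEq G] {A : Adversary q t k ID M G}

theorem Prog.exec_randoms (n : ℕ) (p : Prog q t k) (s : Machine q t k ID M G) :
    (Prog.randoms n p).exec A s = (PMF.uniformOfFintype (Fin n → ZMod q)).bind fun v =>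
      p.exec A { s with scalars := s.scalars ++ List.ofFn v, clock := s.clock + n } := by
  induction n generalizing s with
  | zero =>
    ext o
    change _ = expect _ fun _ => _
    simp [randoms]
  | succ n ih =>
    ext o
    simp only [randoms, Prog.exec, ih]
    -- The probability of one outcome of a `bind` is by definition an expectation, so the splitting
    -- of a uniform vector applies.
    change (expect _ fun x => expect _ fun v => _) = expect _ fun v => _
    rw [expect_uniform_succ]
    congr 1
    funext x
    congr 1
    funext v
    simp [Machine.pushScalar, Machine.tick, List.ofFn_succ, add_assoc, add_comm 1]

theorem Prog.exec_multiples (l : List ℕ) (p : Prog q t k) (s : Machine q t k ID M G) {P : G}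
    (hP : s.points[0]? = some P) :
    (Prog.multiples l p).exec A s = p.exec A { s with
      points := s.points ++ l.map fun i => smulPt (s.scalar i) P, clock := s.clock + l.length } := by
  induction l generalizing s with
  | nil => simp [multiples]
  | cons i l ih =>
    have h0 : s.point 0 = P := by simp [Machine.point, List.getD_eq_getElem?_getD, hP]
    simp only [multiples, Prog.exec, h0]
    rw [ih _ (getElem?_of_prefix (((Machine.Le.refl s).tick 1).pushPt _).points hP)]
    simp [Machine.pushPt, Machine.tick, Machine.scalar, add_assoc, add_comm 1]

/-- The machine after the adversary has been started. -/
def Machine.started (P X : G) (v : Fin t → ZMod q) (σ : Strategy q t k ID M G) (c : ℕ) :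
    Machine q t k ID M G :=
  ⟨List.ofFn v, P :: X :: List.ofFn (masterPublicKey P v), [], [], [σ], c⟩

/-- The setup takes `identityBound B` for the guess, `t` for the master secret key, `t` for its
multiples and `t + 1` for starting the adversary. -/
theorem exec_solver [NeZero t] (S : Scheme) (B : OracleKind → ℕ) (P X : G) :
    (solver q S B).run A P X =
      (PMF.uniformOfFintype (Fin (B .pubKey + B .partKey + B .secKey + B .corrupt + B .sign +
        1))).bind fun g =>
      (PMF.uniformOfFintype (Fin t → ZMod q)).bind fun v => A.tape.bind fun ω =>
      ((simRun g S (totalQueries B + 1) (SimState.start t k)).compile rewind 0 []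
        ⟨List.range t, List.range (t + 2), [], []⟩ (SimState.start t k).c).exec A
        (Machine.started P X v (A.strategy ω (masterPublicKey P v))
          (identityBound B + 3 * t + 1 + (A.strategy ω (masterPublicKey P v)).work)) := by
  simp only [Prog.run, solver, Prog.exec]
  congr 1
  funext g
  rw [Prog.exec_randoms]
  congr 1
  funext v
  rw [Prog.exec_multiples _ _ _ (P := P) (by simp [Machine.tick]), Prog.exec]
  congr 1
  funext ω
  have hs : ∀ i : Fin t, (List.ofFn v).getD i 0 = v i := fun i => by
    simp [List.getD_eq_getElem?_getD]
  have hV : (fun i : Fin t => (P :: X :: List.ofFn (masterPublicKey P v)).getD (i + 2) 0) =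
      masterPublicKey P v := by
    funext i
    simp [List.getD_eq_getElem?_getD]
  have hm : (List.ofFn fun i : Fin t => (i : ℕ)).map (fun i => smulPt ((List.ofFn v).getD i 0) P) =
      List.ofFn (masterPublicKey P v) := by
    rw [List.map_ofFn]
    congr 1
    funext i
    simp only [Function.comp, hs, masterPublicKey]
  simp only [Machine.scalar, Machine.tick, Machine.point, Machine.pushRun, Machine.started,
    List.nil_append, hm, List.cons_append, hV, List.length_ofFn]
  congr 2
  simp only [identityBound]
  ring

theorem embedded_range {α : Type} (l : List α) : Embedded (List.range l.length) l l :=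
  List.forall₂_iff_get.2 ⟨by simp, fun i h1 h2 => by simp⟩

theorem embeds_started (P X : G) (v : Fin t → ZMod q) (σ : Strategy q t k ID M G) (c : ℕ) :
    Embeds ⟨List.range t, List.range (t + 2), [], []⟩ (Machine.started P X v σ c)
      (Machine.started P X v σ c) where
  scalars := by simpa [Machine.started] using embedded_range (List.ofFn v)
  points := by
    simpa [Machine.started] using embedded_range (P :: X :: List.ofFn (masterPublicKey P v))
  ids := List.Forall₂.nil
  msgs := List.Forall₂.nil

theorem ctr_started (P X : G) (v : Fin t → ZMod q) (σ : Strategy q t k ID M G) (c : ℕ) :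
    (SimState.start t k).c = (Machine.started P X v σ c).ctr := by
  simp [Machine.started, Machine.ctr, SimState.start]

theorem sim_start [NeZero t] (P : G) (v : Fin t → ZMod q) (a : ZMod q) (g : ℕ)
    (σ : Strategy q t k ID M G) (c : ℕ) :
    Sim P v a g (SimState.start t k) ⟨[], [], []⟩ (Machine.started P (smulPt a P) v σ c) []
      (GameState.init q t k ID M G) [] where
  counts := ⟨by simp [Machine.started, SimState.start], by simp [Machine.started, SimState.start],
    by simp [Machine.started, SimState.start], by simp [Machine.started, SimState.start]⟩
  master i := by simp [Machine.started]
  base := rfl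
  inst := rfl
  h1 := List.Forall₂.nil
  h5 := List.Forall₂.nil
  users := List.Forall₂.nil
  d := rfl
  d_le := le_rfl
  tableH1 _ _ := rfl
  tableH5 _ _ := rfl
  tableUsers _ := rfl
  ord_length := rfl
  ord_mem _ h := by simp at h
  tgt _ h := by simp at h
  key _ h := by simp at h
  hist _ h := by simp at h
  programmed _ h := by simp at h

/-- The running time of the algorithm. -/
theorem solver_time [NeZero t] (S : Scheme) (B : OracleKind → ℕ) (P X : G) {T : ℕ}
    (hT : A.RunsIn T) :
    ∀ o ∈ ((solver q S B).run A P X).support,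
      o.2 ≤ 2 * T + 100 * (t + k + totalQueries B + 1) ^ 3 := by
  intro o ho
  rw [exec_solver] at ho
  simp only [PMF.mem_support_bind_iff] at ho
  obtain ⟨g, -, v, -, ω, -, ho⟩ := ho
  obtain ⟨T', h1, h2⟩ := (hT ω (masterPublicKey P v)).exists_restIn
  have hcost := costLE_simRun (q := q) (y := SimState.start t k) (n := 0) g S (totalQueries B + 1)
    ⟨le_rfl, le_rfl, le_rfl⟩
  have := Run.timeLE_compile_rewind (A := A) (T := T) _ hcost
    (s := Machine.started P X v (A.strategy ω (masterPublicKey P v))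
      (identityBound B + 3 * t + 1 + (A.strategy ω (masterPublicKey P v)).work))
    (r := 0) (ρ := ⟨List.range t, List.range (t + 2), [], []⟩) rfl (by omega) h2
    (ctr_started P X v _ _) o ho
  simp only [Machine.started] at this
  have hN : identityBound B ≤ totalQueries B + 1 := by
    simp only [identityBound, totalQueries]
    omega
  set Q := totalQueries B
  set W := t + k + Q + 1 with hW
  have hW1 : 1 ≤ W := by omega
  have hW2 : W ≤ W ^ 3 := Nat.le_self_pow (by norm_num) W
  have hW3 : W ≤ W ^ 2 := Nat.le_self_pow (by norm_num) W
  -- The second factor is at most `(15 + 1 + 2 + 21) * W ^ 2`. Two passes thus cost at most `78 * W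
  -- ^ 3`, which leaves room below `100` for the setup and the extra `9` of the rewinding.
  have hc : (Q + 1) * (5 * (0 + 3 * (Q + 1)) + k * t + 2 * k + 21) ≤ 39 * W ^ 3 := by
    have hkt : k * t ≤ W ^ 2 := by
      rw [sq]
      exact Nat.mul_le_mul (by omega) (by omega)
    calc _ ≤ W * (39 * W ^ 2) := Nat.mul_le_mul (by omega) (by omega)
      _ = _ := by ring
  omega

/-- The result of the algorithm before it rewinds the adversary. -/
def totalTree [NeZero t] (S : Scheme) (B : OracleKind → ℕ) (P : G) (A : Adversary q t k ID M G) :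
    Tree q :=
  .coin (ZMod q) (PMF.uniformOfFintype _) fun a =>
  .coin _ (PMF.uniformOfFintype (Fin (B .pubKey + B .partKey + B .secKey + B .corrupt + B .sign +
    1))) fun g =>
  .coin _ (PMF.uniformOfFintype (Fin t → ZMod q)) fun v => .coin _ A.tape fun ω =>
  (simRun g S (totalQueries B + 1) (SimState.start t k)).tree P (smulPt a P)
    (B .h5 + B .sign + 1) (Machine.started P (smulPt a P) v (A.strategy ω (masterPublicKey P v))
      (identityBound B + 3 * t + 1 + (A.strategy ω (masterPublicKey P v)).work)) []
    (A.strategy ω (masterPublicKey P v))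

theorem indexed_totalTree [NeZero t] (S : Scheme) (B : OracleKind → ℕ) (P : G)
    (A : Adversary q t k ID M G) : (totalTree S B P A).Indexed (B .h5 + B .sign + 1) 0 :=
  fun a _ _ _ => Run.indexed_tree P (smulPt a P) _ _ _ [] _

/-- For fixed challenge, guess, master key and tape this is `Run.val_le_prob` with the rewinding
closures. The registers of the simulator and of the machine coincide at the start. -/
theorem val_totalTree_le [NeZero t] (S : Scheme) (B : OracleKind → ℕ) {P : G}
    (hP : addOrderOf P = q) :
    (totalTree S B P A).val Tree.refork (fun _ => 0) 0 ≤
      ((PMF.uniformOfFintype (ZMod q)).bind fun a =>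
        ((solver q S B).run A P (smulPt a P)).map fun o => decide (o.1 = some a)) true := by
  rw [← expect_single]
  simp only [expect_bind, expect_map, decide_eq_true_eq, exec_solver, totalTree, Tree.val]
  refine expect_mono fun a => expect_mono fun g => expect_mono fun v => expect_mono fun ω => ?_
  exact Run.val_le_prob (goodSnap_rewind hP rfl _) _ _ _ [] _ _ 0 [] _ _
    (embeds_started P _ v _ _) rfl (GoodClosures.nil _ _) (ctr_started P _ v _ _)

/-- Honest key generation may be replaced by its uniform description because `P` is killed by `q`.
-/
theorem euCMA_eq [NeZero t] (S : Scheme) {P : G} (hP : q • P = 0) :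
    ((euCMA S P A).run' (GameState.init q t k ID M G)) true =
      expect (PMF.uniformOfFintype (Fin t → ZMod q)) fun v => expect A.tape fun ω =>
        win S P v (A.strategy ω (masterPublicKey P v)) (GameState.init q t k ID M G) := by
  have h : ((euCMA S P A).run' (GameState.init q t k ID M G)) true =
      wp (euCMA S P A) (GameState.init q t k ID M G) fun b _ => if b = true then 1 else 0 := by
    rw [← expect_single]
    exact expect_map _ _ _
  rw [h]
  simp only [euCMA, kgcSetup, wp_bind, wp_sample, wp_lift, win, finale, wp_user hP]

/-- The sum over the targets is `identityBound B` times the mean over a uniform guess, and each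
summand is bounded by the acceptance of the simulator plus the same error. -/
theorem advantage_le [NeZero t] (S : Scheme) (B : OracleKind → ℕ) {P : G} (hP : addOrderOf P = q)
    (hB : A.QueriesWithin B) :
    ((euCMA S P A).run' (GameState.init q t k ID M G)) true ≤
      identityBound B * ((totalTree S B P A).acc + B .sign * ((B .h5 + B .sign : ℕ) / q)) := by
  have hP' : q • P = 0 := hP ▸ addOrderOf_nsmul_eq_zero P
  rw [euCMA_eq S hP']
  set N := B .pubKey + B .partKey + B .secKey + B .corrupt + B .sign with hN
  set acc : ZMod q → ℕ → (Fin t → ZMod q) → A.Tape → ℝ≥0∞ := fun a g v ω =>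
    (simRun g S (totalQueries B + 1) (SimState.start t k)).accept P (smulPt a P)
    (B .h5 + B .sign + 1) (Machine.started P (smulPt a P) v (A.strategy ω (masterPublicKey P v))
      (identityBound B + 3 * t + 1 + (A.strategy ω (masterPublicKey P v)).work)) []
    (A.strategy ω (masterPublicKey P v)) with hacc
  set δ : ℝ≥0∞ := B .sign * ((B .h5 + B .sign : ℕ) / q) with hδ
  have key : ∀ v ω, win S P v (A.strategy ω (masterPublicKey P v)) (GameState.init q t k ID M G) ≤
      identityBound B * ((expect (PMF.uniformOfFintype (Fin (N + 1))) fun g =>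
        expect (PMF.uniformOfFintype (ZMod q)) fun a => acc a g v ω) + δ) := by
    intro v ω
    refine (win_le_sum hP' S v (N + 1) _ _ [] B (hB ω _) (by simp [GameState.init]) ?_).trans ?_
    · simp [identityBound, hN]
    rw [← Fin.sum_univ_eq_sum_range fun g => winWith S P v g none _ _ _]
    have hstep : ∀ g : Fin (N + 1), winWith S P v g none (A.strategy ω (masterPublicKey P v))
        (GameState.init q t k ID M G) [] ≤
        (expect (PMF.uniformOfFintype (ZMod q)) fun a => acc a g v ω) + δ := by
      intro g
      -- No user exists yet, so the target's `β` may be drawn now; it becomes the secret of the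
      -- challenge.
      rw [← expect_winWith S P v _ _ _ (Nat.zero_le _)]
      exact expect_le_add fun a => winWith_le_accept hP S (Nat.lt_succ_self _) _ _ B _ _ _ _ _ _
        (sim_start P v a g _ _) (hB ω _) (by simp [SimState.start]) (Nat.lt_succ_self _)
    refine (Finset.sum_le_sum fun g _ => hstep g).trans_eq ?_
    rw [expect_uniform, Finset.sum_add_distrib, Finset.sum_const, Finset.card_univ,
      Fintype.card_fin, mul_add, nsmul_eq_mul]
    have : identityBound B = N + 1 := rfl
    rw [this, ENNReal.mul_div_cancel (by simp) (ENNReal.natCast_ne_top _)]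
  refine (expect_mono fun v => expect_mono fun ω => key v ω).trans_eq ?_
  simp only [expect_const_mul, expect_add, expect_const]
  congr 2
  have hT : (totalTree S B P A).acc = expect (PMF.uniformOfFintype (ZMod q)) fun a =>
      expect (PMF.uniformOfFintype (Fin (N + 1))) fun g =>
      expect (PMF.uniformOfFintype (Fin t → ZMod q)) fun v => expect A.tape fun ω =>
      acc a g v ω := rfl
  rw [hT]
  -- All four draws are independent; they only have to be brought from the order of the experiment
  -- into the order of `totalTree`.
  exact (congrArg (expect _) (funext fun v => (expect_comm _ _ _).trans
    ((congrArg (expect _) (funext fun g => expect_comm _ _ _)).trans (expect_comm _ _ _)))).trans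
    ((expect_comm _ _ _).trans (congrArg (expect _) (funext fun a => expect_comm _ _ _)))

theorem Tree.acc_le_one (T : Tree q) : T.acc ≤ 1 := by
  induction T with
  | leaf i => simp only [acc, leafE]; split_ifs <;> simp
  | coin S p next ih => exact expect_le_one ih
  | hash next ih => exact expect_le_one ih

/-- The inequalities are finite and pass to real numbers. The forking bound holds for the true
acceptance probability `x`, of which `accept` is a lower bound, so monotonicity has to be checked.
-/
theorem forkingBound_le [NeZero t] (S : Scheme) (B : OracleKind → ℕ) {P : G}
    (hP : addOrderOf P = q) (hB : A.QueriesWithin B) :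
    forkingBound q B (advantage S P A) ≤ (solver q S B).ecdlpSuccess A P := by
  have hadv := advantage_le S B hP hB
  have hval := val_totalTree_le (A := A) S B hP
  have hfork := Tree.acc_sq_le_val (indexed_totalTree S B P A)
  have hacc := (totalTree S B P A).acc_le_one
  set x := (totalTree S B P A).acc
  have hq : (0 : ℝ) < q := by exact_mod_cast (Fact.out : q.Prime).pos
  set n : ℝ := B .h5 + B .sign + 1 with hn
  have hn0 : 0 < n := by positivity
  have hx : x ≠ ⊤ := ne_top_of_le_ne_top ENNReal.one_ne_top hacc
  rw [forkingBound, Prog.ecdlpSuccess]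
  set z := ((PMF.uniformOfFintype (ZMod q)).bind fun a =>
    ((solver q S B).run A P (smulPt a P)).map fun o => decide (o.1 = some a)) true with hz
  have hz' : z ≠ ⊤ := PMF.apply_ne_top _ _
  have hqt : (q : ℝ≥0∞) ≠ 0 := by exact_mod_cast (Fact.out : q.Prime).ne_zero
  have h1 : x.toReal ^ 2 ≤ n * (z.toReal + x.toReal / q) := by
    have := hfork.trans (mul_le_mul_right (add_le_add_left hval (x / q)) _)
    have := ENNReal.toReal_mono (ENNReal.mul_ne_top (ENNReal.natCast_ne_top _)
      (ENNReal.add_ne_top.2 ⟨hz', ENNReal.div_ne_top hx hqt⟩)) this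
    rw [ENNReal.toReal_pow, ENNReal.toReal_mul, ENNReal.toReal_add hz' (ENNReal.div_ne_top hx hqt),
      ENNReal.toReal_div, ENNReal.toReal_natCast, ENNReal.toReal_natCast] at this
    rw [hn]
    exact_mod_cast this
  have h2 : accept q B (advantage S P A) ≤ x.toReal := by
    rw [accept]
    refine max_le ENNReal.toReal_nonneg ?_
    have hfin : (B .sign : ℝ≥0∞) * ((B .h5 + B .sign : ℕ) / q) ≠ ⊤ :=
      ENNReal.mul_ne_top (ENNReal.natCast_ne_top _)
        (ENNReal.div_ne_top (ENNReal.natCast_ne_top _) hqt)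
    have := ENNReal.toReal_mono (ENNReal.mul_ne_top (ENNReal.natCast_ne_top _)
      (ENNReal.add_ne_top.2 ⟨hx, hfin⟩)) hadv
    rw [ENNReal.toReal_mul, ENNReal.toReal_add hx hfin, ENNReal.toReal_mul, ENNReal.toReal_div,
      ENNReal.toReal_natCast, ENNReal.toReal_natCast, ENNReal.toReal_natCast,
      ENNReal.toReal_natCast] at this
    have hN : (0 : ℝ) < identityBound B := by
      simp only [identityBound]
      positivity
    rw [sub_le_iff_le_add, div_le_iff₀ hN, advantage]
    refine this.trans_eq ?_
    push_cast
    ring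
  have h0 : 0 ≤ accept q B (advantage S P A) := le_max_left _ _
  set β := accept q B (advantage S P A)
  have h3 : x.toReal * (x.toReal / n - 1 / q) ≤ z.toReal := by
    have : x.toReal ^ 2 / n ≤ z.toReal + x.toReal / q := by
      rw [div_le_iff₀ hn0]
      linarith
    calc _ = x.toReal ^ 2 / n - x.toReal / q := by ring
      _ ≤ _ := by linarith
  -- The function `u ↦ u (u / n - 1 / q)` is monotone where its second factor is nonnegative; where
  -- that factor is nonpositive at `β`, the claimed bound is at most zero.
  rcases le_total (β / n - 1 / q) 0 with h | h
  · exact (mul_nonpos_of_nonneg_of_nonpos h0 h).trans ENNReal.toReal_nonneg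
  · refine le_trans ?_ h3
    gcongr

end Solver

end

end SchnorrCL

theorem mainTheorem3 :
    ∃ c : ℕ, ∀ (q t k : ℕ) [Fact q.Prime] [NeZero t] (S : SchnorrCL.Scheme)
      (B : SchnorrCL.OracleKind → ℕ),
      ∃ C : SchnorrCL.Prog q t k,
        ∀ (F : Type) [Field F] [Fintype F] [DecidableEq F] (E : WeierstrassCurve F) [E.IsElliptic]
          (P : E.toAffine.Point) (_ : addOrderOf P = q)
          (ID M : Type) [DecidableEq ID] [DecidableEq M]
          (A : SchnorrCL.Adversary q t k ID M E.toAffine.Point) (T : ℕ)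
          (_ : A.QueriesWithin B) (_ : A.RunsIn T),
          (∀ (a : ZMod q), ∀ o ∈ (C.run A P (SchnorrCL.smulPt a P)).support,
            o.2 ≤ 2 * T + c * (t + k + SchnorrCL.totalQueries B + 1) ^ 3) ∧
          SchnorrCL.forkingBound q B (SchnorrCL.advantage S P A) ≤ C.ecdlpSuccess A P := by
  -- The program does not depend on the curve, whose points enter only as an additive group with an
  -- element of order `q`.
  refine ⟨100, fun q t k _ _ S B => ⟨SchnorrCL.solver q S B, ?_⟩⟩
  intro F _ _ _ E _ P hP ID M _ _ A T hB hT
  exact ⟨fun a => SchnorrCL.solver_time S B P _ hT, SchnorrCL.forkingBound_le S B hP hB⟩
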